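/- Let $n\ge 3$ and $d\ge 3$ be integers. For a field $K$ with algebraic closure $\bar K$ and homogeneous $F_1,\dots,F_r\in \bar K[x_1,\dots,x_n]$, let $V(F_1,\dots,F_r)\subseteq\mathbb P^{n-1}_{\bar K}$ be the closed subscheme they define, let $\operatorname{Sing}$ denote its singular locus (the set of closed points at which its local ring is not regular), and let $\dim$ be the Krull dimension in the Zariski topology, with $\dim\varnothing=-1$. For a homogeneous polynomial $G$ and $\mathbf y\in\bar K^n$ put $G^{\mathbf y}=\sum_{i} y_i\,\partial G/\partial x_i$. For $F$ homogeneous of degree $d$ over $\bar K$ put \[ \sigma_{\mathbf y}(F)=\max\{\dim\operatorname{Sing}V(F,F^{\mathbf y}),\ \dim\operatorname{Sing}V(F^{\mathbf y})\}, \] \[ T_s(F)=\{[\mathbf y]\in\mathbb P^{n-1}(\bar K):\sigma_{\mathbf y}(F)\ge s\},\qquad T_{s,\mathbf y}(F)=\{[\mathbf z]\in\mathbb P^{n-1}(\bar K):\dim\operatorname{Sing}V(F,F^{\mathbf y},(F^{\mathbf y})^{\mathbf z})\ge s\}. \] Let $F\in\mathbb Z[x_1,\dots,x_n]$ be homogeneous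 of degree $d$. For a prime $p$ let $F_p$ be the image of $F$ in $\overline{\mathbb F}_p[x_1,\dots,x_n]$, and consider the conditions: * $(\mathrm R_0(p))$: $F_p\neq0$ and $\operatorname{Sing}V(F_p)=\varnothing$; * $(\mathrm R_1(p))$: $\dim T_s(F_p)\le n-2-s$ for every $s=-1,0,\dots,n-1$; * $(\mathrm R_2(p))$: $\dim T_{\sigma_{\mathbf y}(F_p)+s+1,\,\mathbf y}(F_p)\le n-2-s$ for every $\mathbf y\in\mathbb F_p^n$ and every $s=-1,0,\dots,n-1$. Let $\mathcal P(F)$ be the set of primes $p$ for which at least one of these three conditions fails, and let $\|F\|$ be the maximum of the absolute values of the coefficients of $F$. Then there are constants $C$ and $\kappa$ depending only on $n$ and $d$ such that, for every homogeneous $F\in\mathbb Z[x_1,\dots,x_n]$ of degree $d$ defining a non-singular hypersurface in $\mathbb P^{n-1}_{\mathbb Q}$ (that is, $F\ne0$ and $F=0$ has no singular point over $\overline{\mathbb Q}$), the set $\mathcal P(F)$ is finite and \[ \prod_{p\in\mathcal P(F)}p\le C\,\|F\|^{\kappa}. \] -/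

import Mathlib

open MvPolynomial
open scoped LinearAlgebra.Projectivization

noncomputable section

namespace Forms

section Geometry

attribute [local instance] MvPolynomial.gradedAlgebra

/-! Throughout this section `k` is meant to be an algebraically closed field, and
`ℙ k (Fin n → k)` is the set of closed points of `ℙ^{n-1}` over `k`. -/

variable {k : Type*} [Field k] {n : ℕ}

/-- The Zariski topology on the projective space of dimension `n - 1`: the sets `{f ≠ 0}`, for `f` a
homogeneous polynomial, form a basis of open sets. -/
@[reducible] def zariskiTopology : TopologicalSpace (ℙ k (Fin n → k)) :=
  TopologicalSpace.generateFrom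
    {U | ∃ (f : MvPolynomial (Fin n) k) (m : ℕ), f.IsHomogeneous m ∧
      U = {x | eval x.rep f ≠ 0}}

/-- The Krull dimension of a set of points of projective space (with the topology induced by the
Zariski topology), with the convention that the empty set has dimension `-1`. The Krull dimension
of a subspace of `ℙ^{n-1}` is at most `n - 1`, so `ENat.toNat` is never applied to `⊤`. -/
def projDim (S : Set (ℙ k (Fin n → k))) : ℤ :=
  WithBot.recBotCoe (-1) (fun m : ℕ∞ => (m.toNat : ℤ))
    (@topologicalKrullDim S (zariskiTopology.induced Subtype.val))

/-- The ideal of all polynomials vanishing at the vector `v`. -/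
def idealOf (v : Fin n → k) : Ideal (MvPolynomial (Fin n) k) :=
  RingHom.ker (eval v)

instance idealOf_isPrime (v : Fin n → k) : (idealOf v).IsPrime :=
  RingHom.ker_isPrime (eval v)

/-- The local ring of `ℙ^{n-1}` at the point `x`: the ring of fractions `f / g` with `f`, `g`
homogeneous of the same degree and `g(x) ≠ 0`. -/
abbrev LocalRingAt (x : ℙ k (Fin n → k)) : Type _ :=
  HomogeneousLocalization.AtPrime (homogeneousSubmodule (Fin n) k) (idealOf x.rep)

/-- For a set `E` of homogeneous polynomials, the ideal of the closed subscheme `V(E)` in the local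
ring of `ℙ^{n-1}` at `x`: the fractions of degree zero which lie in the ideal generated by `E`. -/
def localIdeal (E : Set (MvPolynomial (Fin n) k)) (x : ℙ k (Fin n → k)) :
    Ideal (LocalRingAt x) :=
  ((Ideal.span E).map
    (algebraMap (MvPolynomial (Fin n) k) (Localization.AtPrime (idealOf x.rep)))).comap
      (algebraMap (LocalRingAt x) (Localization.AtPrime (idealOf x.rep)))

/-- The singular locus of the closed subscheme `V(E)` of `ℙ^{n-1}`: the points of `V(E)`
at which the local ring of `V(E)` is not regular. -/
def Sing (E : Set (MvPolynomial (Fin n) k)) : Set (ℙ k (Fin n → k)) :=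
  {x | (∀ f ∈ E, eval x.rep f = 0) ∧ ¬ IsRegularLocalRing (LocalRingAt x ⧸ localIdeal E x)}

/-- The directional derivative `G^y = y₁ ∂G/∂x₁ + ⋯ + yₙ ∂G/∂xₙ`. -/
def dirDeriv (y : Fin n → k) (G : MvPolynomial (Fin n) k) : MvPolynomial (Fin n) k :=
  ∑ i, C (y i) * pderiv i G

/-- `σ_y(V) = max (dim Sing V(F, F^y)) (dim Sing V(F^y))` for `V = V(F)`. -/
def sigma (F : MvPolynomial (Fin n) k) (y : Fin n → k) : ℤ :=
  max (projDim (Sing {F, dirDeriv y F})) (projDim (Sing {dirDeriv y F}))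

/-- `T_s(V) = {y ∈ ℙ^{n-1} : σ_y(V) ≥ s}` for `V = V(F)`. -/
def sigmaLocus (F : MvPolynomial (Fin n) k) (s : ℤ) : Set (ℙ k (Fin n → k)) :=
  {y | s ≤ sigma F y.rep}

/-- `T_{s,y}(V) = {z ∈ ℙ^{n-1} : dim Sing V(F, F^y, F^{y,z}) ≥ s}` for `V = V(F)`, where
`F^{y,z} = (F^y)^z`. -/
def diffLocus (F : MvPolynomial (Fin n) k) (y : Fin n → k) (s : ℤ) : Set (ℙ k (Fin n → k)) :=
  {z | s ≤ projDim (Sing {F, dirDeriv y F, dirDeriv z.rep (dirDeriv y F)})}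

/-- `F = 0` defines a non-singular hypersurface in `ℙ^{n-1}`. -/
def IsNonsingularHypersurface (F : MvPolynomial (Fin n) k) : Prop :=
  F ≠ 0 ∧ Sing {F} = ∅

end Geometry

section Integral

variable {n : ℕ}

/-- `F`, regarded as a polynomial over an algebraic closure of `K`. -/
def baseChange (K : Type) [Field K] (F : MvPolynomial (Fin n) ℤ) :
    MvPolynomial (Fin n) (AlgebraicClosure K) :=
  map (Int.castRingHom (AlgebraicClosure K)) F

/-- The integral form `F` is non-singular over `ℚ`; as `ℚ` is perfect, this can be read off over
an algebraic closure of `ℚ`. -/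
def R0Zero (F : MvPolynomial (Fin n) ℤ) : Prop :=
  IsNonsingularHypersurface (baseChange ℚ F)

/-- The condition `R₀(p)`. -/
def R0 (p : ℕ) [Fact p.Prime] (F : MvPolynomial (Fin n) ℤ) : Prop :=
  IsNonsingularHypersurface (baseChange (ZMod p) F)

/-- The condition `R₁(p)`. -/
def R1 (p : ℕ) [Fact p.Prime] (F : MvPolynomial (Fin n) ℤ) : Prop :=
  ∀ s : ℤ, -1 ≤ s → s ≤ (n : ℤ) - 1 →
    projDim (sigmaLocus (baseChange (ZMod p) F) s) ≤ (n : ℤ) - 2 - s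

/-- The condition `R₂(p)`; here `y` runs over the vectors with coordinates in `𝔽_p`. -/
def R2 (p : ℕ) [Fact p.Prime] (F : MvPolynomial (Fin n) ℤ) : Prop :=
  ∀ y : Fin n → ZMod p, ∀ s : ℤ, -1 ≤ s → s ≤ (n : ℤ) - 1 →
    let Y : Fin n → AlgebraicClosure (ZMod p) := fun i => algebraMap _ _ (y i)
    projDim (diffLocus (baseChange (ZMod p) F) Y (sigma (baseChange (ZMod p) F) Y + s + 1))
      ≤ (n : ℤ) - 2 - s

/-- The set of primes `p` at which one of `R₀(p)`, `R₁(p)`, `R₂(p)` fails. -/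
def badPrimes (F : MvPolynomial (Fin n) ℤ) : Set ℕ :=
  {p | ∃ _ : Fact p.Prime, ¬ (R0 p F ∧ R1 p F ∧ R2 p F)}

/-- The maximum of the absolute values of the coefficients of `F`. -/
def height (F : MvPolynomial (Fin n) ℤ) : ℕ :=
  F.support.sup fun m => (F.coeff m).natAbs

end Integral

end Forms

end

/-! Bad primes have two sources. First, there is N depending only on n and d such that, in every
characteristic p > N, each form of degree d whose gradient has no nontrivial zero satisfies all
three conditions (`exists_good_of_large_prime`). Second, for the given F the gradient has no
nontrivial zero modulo p unless p divides an integer D ≠ 0 with D ≤ B‖F‖^κ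
(`exists_discriminant_bound`); this is elimination theory for the general form plus finite
generation of the ideal of eliminants. So a bad prime is at most N or divides D, and the product is
at most N!·D.

The dimension bounds rest on one fact about the incidence variety of pairs (x, z) with E(x) = 0 and
Hess G(x)z, ∇E_j(x) linearly dependent (`Crit`). It contains all pairs for which x is singular on
V(E, G^z). Suppose that the zeros of ∇G, and likewise the points where the Jacobian of E drops rank
on E = 0, are missed by m linear forms. In characteristic zero the incidence variety then has affine
dimension at most n + m (`trdeg_le_of_crit`). Let (ξ, ζ) be the generic point of a component. If ξ
is singular on E, then ξ is integral over m linear forms in ξ, and the n coordinates of ζ do the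
rest. Otherwise Hess G(ξ)ζ is a combination of the ∇E_j(ξ), and differentiating E_j(ξ) = 0 shows
that the 1-form Σ ζ_a dφ_a vanishes, where φ = ∇G(ξ). So does its exterior derivative: (φ, ζ) moves
in an isotropic subvariety of a 2n-dimensional symplectic space, and at most n of its coordinates
are independent (`card_le_of_forall_derivation`). Again ξ is integral over φ and m linear forms.

Cutting with a generic linear forms in x and b in z, where a + b = n + m - 1, leaves no pair of
nonzero vectors (`exists_avoids_of_charZero`). If this failed for arbitrarily large primes, it would
fail over a characteristic-zero residue field of a product of the fields concerned
(`exists_avoids_of_large_prime`).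

The set of z admitting a nonzero critical x on the a hyperplanes is closed, is missed by b linear
forms, hence has dimension below b, and it contains every z with dim Sing V(E, G^z) ≥ a. With b = n
- 1 - s, the choices E = ∅ or (F), G = F, m = 0, a = s give R₁; E = (F, F^y), G = F^y, m = σ_y + 1,
a = m + s give R₂. For R₂ the definition of σ_y must be turned into the two avoidance hypotheses.
That needs the harder half of the Jacobian criterion, from dependent gradients to a non-regular
local ring (`mem_sing_singleton`, `mem_sing_pair`), and hence irreducibility of F. -/

noncomputable section

namespace Forms

/-! ### Gradients, Jacobians and critical pairs, over arbitrary rings -/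

section Calculus

variable {A B : Type*} [CommRing A] [CommRing B] {n r : ℕ}

/-- The gradient of `f` at `x`. -/
def grad (f : MvPolynomial (Fin n) A) (x : Fin n → A) : Fin n → A :=
  fun i => eval x (pderiv i f)

/-- The Hessian matrix of `G` at `x`, applied to the vector `z`. -/
def hessMul (G : MvPolynomial (Fin n) A) (x z : Fin n → A) : Fin n → A :=
  fun i => ∑ l, z l * eval x (pderiv i (pderiv l G))

/-- The Jacobian matrix of the family `E` at `x`. -/
def jacobian (E : Fin r → MvPolynomial (Fin n) A) (x : Fin n → A) : Matrix (Fin r) (Fin n) A :=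
  Matrix.of fun j => grad (E j) x

/-- The Jacobian matrix of the family `E` at `x`, with the gradient of `G^z` as an additional
first row. -/
def augJacobian (E : Fin r → MvPolynomial (Fin n) A) (G : MvPolynomial (Fin n) A)
    (x z : Fin n → A) : Matrix (Fin (r + 1)) (Fin n) A :=
  Matrix.of (Fin.cons (hessMul G x z) (fun j => grad (E j) x))

/-- All maximal minors of `M` (with columns in any order) vanish. -/
def MinorsVanish {m : ℕ} (M : Matrix (Fin m) (Fin n) A) : Prop :=
  ∀ c : Fin m → Fin n, (M.submatrix id c).det = 0

/-- The point `x` lies on `E = 0` and the Jacobian matrix of `E` drops rank at `x`. -/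
def JacSing (E : Fin r → MvPolynomial (Fin n) A) (x : Fin n → A) : Prop :=
  (∀ j, eval x (E j) = 0) ∧ MinorsVanish (jacobian E x)

/-- The point `x` lies on `E = 0` and the augmented Jacobian matrix drops rank at `x`. -/
def Crit (E : Fin r → MvPolynomial (Fin n) A) (G : MvPolynomial (Fin n) A)
    (x z : Fin n → A) : Prop :=
  (∀ j, eval x (E j) = 0) ∧ MinorsVanish (augJacobian E G x z)

theorem map_eval_apply (φ : A →+* B) (f : MvPolynomial (Fin n) A) (x : Fin n → A) :
    φ (eval x f) = eval (φ ∘ x) (map φ f) := by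
  rw [eval_map, ← eval₂_id, eval₂_comp_left]
  rfl

theorem map_grad (φ : A →+* B) (f : MvPolynomial (Fin n) A) (x : Fin n → A) (i : Fin n) :
    φ (grad f x i) = grad (map φ f) (φ ∘ x) i := by
  simp only [grad, pderiv_map, map_eval_apply]

theorem map_hessMul (φ : A →+* B) (G : MvPolynomial (Fin n) A) (x z : Fin n → A) (i : Fin n) :
    φ (hessMul G x z i) = hessMul (map φ G) (φ ∘ x) (φ ∘ z) i := by
  simp only [hessMul, pderiv_map, map_sum, map_mul, map_eval_apply, Function.comp]

theorem map_jacobian (φ : A →+* B) (E : Fin r → MvPolynomial (Fin n) A) (x : Fin n → A) :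
    (jacobian E x).map φ = jacobian (fun j => map φ (E j)) (φ ∘ x) := by
  ext i j
  simp [jacobian, map_grad]

theorem map_augJacobian (φ : A →+* B) (E : Fin r → MvPolynomial (Fin n) A)
    (G : MvPolynomial (Fin n) A) (x z : Fin n → A) :
    (augJacobian E G x z).map φ =
      augJacobian (fun j => map φ (E j)) (map φ G) (φ ∘ x) (φ ∘ z) := by
  ext i j
  refine Fin.cases ?_ (fun i => ?_) i
  · simp [augJacobian, map_hessMul]
  · simp [augJacobian, map_grad]

theorem map_minor {m : ℕ} (φ : A →+* B) (M : Matrix (Fin m) (Fin n) A) (c : Fin m → Fin n) :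
    φ (M.submatrix id c).det = ((M.map φ).submatrix id c).det := by
  rw [RingHom.map_det]
  rfl

theorem MinorsVanish.map {m : ℕ} {M : Matrix (Fin m) (Fin n) A} (h : MinorsVanish M)
    (φ : A →+* B) : MinorsVanish (M.map φ) := fun c => by
  rw [← map_minor, h c, map_zero]

theorem Crit.map {E : Fin r → MvPolynomial (Fin n) A} {G : MvPolynomial (Fin n) A}
    {x z : Fin n → A} (h : Crit E G x z) (φ : A →+* B) :
    Crit (fun j => MvPolynomial.map φ (E j)) (MvPolynomial.map φ G) (φ ∘ x) (φ ∘ z) :=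
  ⟨fun j => by rw [← map_eval_apply, h.1 j, map_zero], by
    rw [← map_augJacobian]; exact h.2.map φ⟩

end Calculus

/-! ### Minors and linear independence over a field -/

section Minors

variable {k : Type*} [Field k]

/-- A functional that kills all columns is a linear relation between the rows. Independent rows
therefore force the columns to span, and a basis can be selected among them. -/
theorem exists_minor_ne_zero {m ι : Type*} [Fintype m] [DecidableEq m]
    (M : Matrix m ι k) (h : LinearIndependent k M.row) :
    ∃ c : m → ι, (M.submatrix id c).det ≠ 0 := by
  classical
  have hspan : Submodule.span k (Set.range M.col) = ⊤ := by
    by_contra hne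
    obtain ⟨f, hf, hle⟩ := Submodule.exists_le_ker_of_lt_top _ (lt_top_iff_ne_top.2 hne)
    apply hf
    have h0 : ∑ i, f (fun j => if i = j then 1 else 0) • M.row i = 0 := by
      funext j
      have := hle (Submodule.subset_span ⟨j, rfl⟩)
      rw [LinearMap.mem_ker, LinearMap.pi_apply_eq_sum_univ f] at this
      simpa [Finset.sum_apply, mul_comm, Matrix.row, Matrix.col] using this
    have := Fintype.linearIndependent_iff.1 h _ h0
    refine LinearMap.pi_ext' fun i => LinearMap.ext_ring ?_
    have hi : (Pi.single i 1 : m → k) = fun j => if i = j then 1 else 0 := by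
      funext j
      simp [Pi.single_apply, eq_comm]
    simpa [hi] using this i
  obtain ⟨s, hs, hs2, hs3⟩ := exists_linearIndependent k (Set.range M.col)
  rw [hspan] at hs2
  let b : Module.Basis s k (m → k) := Module.Basis.mk hs3 (by simp [hs2])
  have e : m ≃ s := (Pi.basisFun k m).indexEquiv b
  choose g hg using fun x : s => hs x.2
  refine ⟨fun i => g (e i), ?_⟩
  have hli : LinearIndependent k (M.submatrix id (fun i => g (e i))).col := by
    have : (M.submatrix id (fun i => g (e i))).col = fun i => ((e i : s) : m → k) := by
      funext i
      rw [← hg (e i)]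
      rfl
    rw [this]
    exact hs3.comp _ e.injective
  have := Matrix.linearIndependent_cols_iff_isUnit.1 hli
  rw [Matrix.isUnit_iff_isUnit_det] at this
  exact this.ne_zero

theorem minorsVanish_iff {m n : ℕ} (M : Matrix (Fin m) (Fin n) k) :
    MinorsVanish M ↔ ¬ LinearIndependent k M.row := by
  constructor
  · intro h hli
    obtain ⟨c, hc⟩ := exists_minor_ne_zero M hli
    exact hc (h c)
  · intro h c
    by_contra hc
    apply h
    have h1 : LinearIndependent k (M.submatrix id c).row := by
      rw [Matrix.linearIndependent_rows_iff_isUnit, Matrix.isUnit_iff_isUnit_det]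
      exact isUnit_iff_ne_zero.2 hc
    exact LinearIndependent.of_comp (LinearMap.funLeft k k c) h1

theorem jacSing_iff {n r : ℕ} {E : Fin r → MvPolynomial (Fin n) k} {x : Fin n → k} :
    JacSing E x ↔ (∀ j, eval x (E j) = 0) ∧ ¬ LinearIndependent k (fun j => grad (E j) x) := by
  rw [JacSing, minorsVanish_iff]
  rfl

theorem crit_iff {n r : ℕ} {E : Fin r → MvPolynomial (Fin n) k} {G : MvPolynomial (Fin n) k}
    {x z : Fin n → k} :
    Crit E G x z ↔ (∀ j, eval x (E j) = 0) ∧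
      ¬ LinearIndependent k
        (Fin.cons (hessMul G x z) (fun j => grad (E j) x) : Fin (r + 1) → Fin n → k) := by
  rw [Crit, minorsVanish_iff]
  rfl

end Minors

section Homogeneous

variable {A : Type*} [CommRing A] {n r : ℕ}

theorem isHomogeneous_det {σ : Type*} {m : ℕ} (M : Matrix (Fin m) (Fin m) (MvPolynomial σ A))
    (e : Fin m → ℕ) (h : ∀ i j, (M i j).IsHomogeneous (e i)) :
    M.det.IsHomogeneous (∑ i, e i) := by
  rw [← Matrix.det_transpose, Matrix.det_apply]
  refine IsHomogeneous.sum _ _ _ fun τ _ => ?_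
  have : (∏ i, M.transpose (τ i) i).IsHomogeneous (∑ i, e i) :=
    IsHomogeneous.prod _ _ _ fun i _ => h i _
  rw [Units.smul_def, zsmul_eq_mul]
  simpa using (isHomogeneous_C σ ((Equiv.Perm.sign τ : ℤ) : A)).mul this

theorem eval_smul_of_isHomogeneous {f : MvPolynomial (Fin n) A} {e : ℕ} (hf : f.IsHomogeneous e)
    (t : A) (x : Fin n → A) : eval (t • x) f = t ^ e * eval x f := by
  rw [eval_eq, eval_eq, Finset.mul_sum]
  refine Finset.sum_congr rfl fun m hm => ?_
  have : ∏ i ∈ m.support, t ^ m i = t ^ e := by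
    rw [Finset.prod_pow_eq_pow_sum, ← hf (mem_support_iff.1 hm)]
    simp [Finsupp.weight_apply, Finsupp.sum]
  simp only [Pi.smul_apply, smul_eq_mul, mul_pow, Finset.prod_mul_distrib, this]
  ring

end Homogeneous

/-! ### Elimination theory and homogeneous systems of parameters -/

section Elimination

attribute [local instance] MvPolynomial.gradedAlgebra

variable {n : ℕ} {ι : Type*}

theorem homogeneousComponent_mul_of_isHomogeneous {A σ : Type*} [CommRing A]
    (c : MvPolynomial σ A) {f : MvPolynomial σ A} {e : ℕ} (hf : f.IsHomogeneous e) (D : ℕ) :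
    homogeneousComponent D (c * f) =
      if e ≤ D then homogeneousComponent (D - e) c * f else 0 := by
  have := DirectSum.coe_decompose_mul_of_right_mem (homogeneousSubmodule σ A) (a := c) (b := f)
    D ((mem_homogeneousSubmodule e f).2 hf)
  rw [← decomposition.decompose'_apply, ← decomposition.decompose'_apply]
  exact this

theorem exists_homogeneous_coeffs {A σ : Type*} [CommRing A] [Fintype ι]
    {f : ι → MvPolynomial σ A} {e : ι → ℕ} (hf : ∀ j, (f j).IsHomogeneous (e j))
    {p : MvPolynomial σ A} {D : ℕ} (hp : p.IsHomogeneous D)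
    (hmem : p ∈ Ideal.span (Set.range f)) :
    ∃ g : ι → MvPolynomial σ A, (∀ j, (g j).IsHomogeneous (D - e j)) ∧
      (∀ j, D < e j → g j = 0) ∧ p = ∑ j, g j * f j := by
  obtain ⟨c, hc⟩ := Ideal.mem_span_range_iff_exists_fun.1 hmem
  refine ⟨fun j => if e j ≤ D then homogeneousComponent (D - e j) (c j) else 0,
    fun j => ?_, fun j hj => if_neg (not_le.2 hj), ?_⟩
  · dsimp only
    split_ifs
    · exact homogeneousComponent_isHomogeneous _ _
    · exact isHomogeneous_zero _ _ _
  · rw [← homogeneousComponent_eq_self hp, ← hc, map_sum]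
    refine Finset.sum_congr rfl fun j _ => ?_
    rw [homogeneousComponent_mul_of_isHomogeneous _ (hf j), ite_mul, zero_mul]

theorem IsHomogeneous.mem_span_X_pow {A σ : Type*} [CommRing A] {p : MvPolynomial σ A} {D : ℕ}
    (hp : p.IsHomogeneous D) :
    p ∈ Ideal.span (Set.range (X : σ → MvPolynomial σ A)) ^ D := by
  rw [Ideal.mem_span_pow_iff_exists_isHomogeneous]
  refine ⟨map C p, hp.map C, ?_⟩
  rw [eval_map]
  exact eval₂_eta p

variable {k : Type*} [Field k] [IsAlgClosed k]

/-- Nullstellensatz: the coordinates lie in the radical of an ideal whose zero set is at most the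
origin, and the ideal they generate is finitely generated. -/
theorem exists_span_X_pow_le {I : Ideal (MvPolynomial (Fin n) k)}
    (h : ∀ x : Fin n → k, (∀ p ∈ I, eval x p = 0) → x = 0) :
    ∃ N, Ideal.span (Set.range (X : Fin n → MvPolynomial (Fin n) k)) ^ N ≤ I := by
  apply Ideal.exists_pow_le_of_le_radical_of_fg
  · rw [Ideal.span_le]
    rintro _ ⟨i, rfl⟩
    rw [SetLike.mem_coe, ← vanishingIdeal_zeroLocus_eq_radical (K := k), mem_vanishingIdeal_iff]
    intro x hx
    have := h x fun p hp => by simpa [aeval_eq_eval] using hx p hp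
    simp [this]
  · exact (Submodule.fg_span (Set.finite_range _))

theorem exists_span_X_pow_le_span {f : ι → MvPolynomial (Fin n) k}
    (h : ∀ x : Fin n → k, (∀ j, eval x (f j) = 0) → x = 0) :
    ∃ N, Ideal.span (Set.range (X : Fin n → MvPolynomial (Fin n) k)) ^ N ≤
      Ideal.span (Set.range f) :=
  exists_span_X_pow_le fun x hx => h x fun j => hx _ (Ideal.subset_span ⟨j, rfl⟩)

/-- The main theorem of elimination theory: if the specialisation of a homogeneous system along `ψ`
has no nontrivial zero, then this is so because of the non-vanishing of an element of the ring of
parameters which annihilates the high degrees of the coordinate ring. -/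
theorem exists_eliminant {A : Type*} [CommRing A] (ψ : A →+* k) [Fintype ι]
    {f : ι → MvPolynomial (Fin n) A} {e : ι → ℕ} (hf : ∀ j, (f j).IsHomogeneous (e j))
    (h : ∀ x : Fin n → k, (∀ j, eval x (map ψ (f j)) = 0) → x = 0) :
    ∃ (a : A) (N : ℕ), ψ a ≠ 0 ∧ ∀ i, C a * X i ^ N ∈ Ideal.span (Set.range f) := by
  classical
  obtain ⟨N, hN⟩ := exists_span_X_pow_le_span h
  let Mon := {m : Fin n →₀ ℕ // m.degree = N}
  have : Finite Mon := (Finsupp.finite_of_degree_eq N).to_subtype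
  have := Fintype.ofFinite Mon
  -- A Macaulay matrix: the rows are the monomials of degree N, the columns the coefficient vectors
  -- of all monomial multiples of the f j.
  let M : Matrix Mon (ι × (Fin n →₀ ℕ)) A :=
    Matrix.of fun m c => coeff m.1 (monomial c.2 1 * f c.1)
  have hM : LinearIndependent k (M.map ψ).row := by
    rw [Fintype.linearIndependent_iff]
    intro c hc m₀
    -- A relation between the rows is a functional on forms of degree N that kills the specialised
    -- ideal. That ideal contains every monomial of degree N, so the functional is zero.
    let Λ : MvPolynomial (Fin n) k →ₗ[k] k := ∑ m : Mon, c m • lcoeff k m.1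
    have hΛ : ∀ p, Λ p = ∑ m : Mon, c m * coeff m.1 p := fun p => by
      simp [Λ]
    have hmono : ∀ j μ, Λ (monomial μ 1 * map ψ (f j)) = 0 := by
      intro j μ
      have h1 := congrFun hc (j, μ)
      rw [hΛ]
      simp only [Finset.sum_apply, Pi.smul_apply, Matrix.row, Matrix.map_apply, M, Matrix.of_apply,
        smul_eq_mul, Pi.zero_apply] at h1
      rw [← h1]
      refine Finset.sum_congr rfl fun m _ => ?_
      rw [← coeff_map, map_mul, map_monomial, ψ.map_one]
    have hker : ∀ p ∈ Ideal.span (Set.range fun j => map ψ (f j)), Λ p = 0 := by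
      intro p hp
      obtain ⟨g, rfl⟩ := Ideal.mem_span_range_iff_exists_fun.1 hp
      rw [map_sum]
      refine Finset.sum_eq_zero fun j _ => ?_
      induction g j using MvPolynomial.induction_on' with
      | monomial u a =>
        have : (monomial u a : MvPolynomial (Fin n) k) = a • monomial u 1 := by
          rw [smul_monomial, smul_eq_mul, mul_one]
        rw [this, smul_mul_assoc, map_smul, hmono, smul_zero]
      | add p q hp hq => rw [add_mul, map_add, hp, hq, add_zero]
    have h2 := hker (monomial m₀.1 1) (hN (by
      have := IsHomogeneous.mem_span_X_pow (isHomogeneous_monomial (1 : k) m₀.2)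
      exact this))
    rw [hΛ, Finset.sum_eq_single m₀] at h2
    · simpa using h2
    · intro m _ hm
      rw [coeff_monomial, if_neg (fun h => hm (Subtype.ext h.symm)), mul_zero]
    · simp
  obtain ⟨c, hc⟩ := exists_minor_ne_zero _ hM
  let M' := M.submatrix id c
  have hdet : ψ M'.det ≠ 0 := by
    rw [RingHom.map_det]
    exact hc
  -- A column belonging to a product of degree other than N vanishes identically, so the nonzero
  -- minor uses only products of degree exactly N.
  have hcol : ∀ i, (c i).2.degree + e (c i).1 = N := by
    intro i
    by_contra hne
    apply hdet
    rw [Matrix.det_eq_zero_of_column_eq_zero i, map_zero]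
    intro m
    have hh := (isHomogeneous_monomial (1 : A) (rfl : (c i).2.degree = _)).mul (hf (c i).1)
    exact hh.coeff_eq_zero (by rw [id, m.2]; exact fun h => hne h.symm)
  refine ⟨M'.det, N, hdet, fun i => ?_⟩
  let m₀ : Mon := ⟨Finsupp.single i N, by simp⟩
  -- Cramer's rule: the adjugate expresses det · X i ^ N through the selected products.
  have key : C M'.det * X i ^ N =
      ∑ l : Mon, C (M'.adjugate l m₀) * (monomial (c l).2 1 * f (c l).1) := by
    have h1 : (∑ l : Mon, C (M'.adjugate l m₀) *
        (monomial (c l).2 1 * f (c l).1)).IsHomogeneous N := by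
      refine IsHomogeneous.sum _ _ _ fun l _ => IsHomogeneous.C_mul ?_ _
      rw [← hcol l]
      exact (isHomogeneous_monomial (1 : A) rfl).mul (hf _)
    have h2 : (C M'.det * X i ^ N : MvPolynomial (Fin n) A).IsHomogeneous N :=
      isHomogeneous_C_mul_X_pow _ _ _
    ext m
    by_cases hm : m.degree = N
    · have h3 := congrFun (congrFun (Matrix.mul_adjugate M') ⟨m, hm⟩) m₀
      rw [Matrix.mul_apply] at h3
      rw [coeff_sum]
      simp only [coeff_C_mul, Matrix.smul_apply, Matrix.one_apply, smul_eq_mul] at h3 ⊢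
      rw [coeff_X_pow]
      have h4 : (⟨m, hm⟩ : Mon) = m₀ ↔ Finsupp.single i N = m := by
        rw [Subtype.ext_iff]
        exact eq_comm
      simp only [h4] at h3
      rw [← h3]
      refine Finset.sum_congr rfl fun l _ => ?_
      rw [mul_comm]
      rfl
    · rw [h1.coeff_eq_zero hm, h2.coeff_eq_zero hm]
  rw [key]
  refine Ideal.sum_mem _ fun l _ => ?_
  rw [← mul_assoc]
  exact Ideal.mul_mem_left _ _ (Ideal.subset_span ⟨_, rfl⟩)

/-- A homogeneous system of positive degrees without nontrivial zeros is a system of parameters: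
the coordinates are integral over the algebra it generates. -/
theorem isIntegral_X_of_no_zeros [Fintype ι]
    {f : ι → MvPolynomial (Fin n) k} {e : ι → ℕ} (hf : ∀ j, (f j).IsHomogeneous (e j))
    (he : ∀ j, 0 < e j) (h : ∀ x : Fin n → k, (∀ j, eval x (f j) = 0) → x = 0)
    (p : MvPolynomial (Fin n) k) :
    IsIntegral (Algebra.adjoin k (Set.range f)) p := by
  obtain ⟨N, hN⟩ := exists_span_X_pow_le_span h
  let S := Algebra.adjoin k (Set.range f)
  let W : Set (MvPolynomial (Fin n) k) := (fun m => monomial m 1) '' {m : Fin n →₀ ℕ | m.degree ≤ N}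
  have hW : W.Finite := (Finsupp.finite_of_degree_le N).image _
  let V : Submodule S (MvPolynomial (Fin n) k) := Submodule.span S W
  -- Induction on the degree: above N a form lies in the ideal, and its coefficients there have
  -- smaller degree because every e j is positive. Monomials of degree at most N thus generate the
  -- ring as a module over the subalgebra.
  have hV : ∀ D, ∀ q : MvPolynomial (Fin n) k, q.IsHomogeneous D → q ∈ V := by
    intro D
    induction D using Nat.strong_induction_on with
    | _ D ih =>
      intro q hq
      by_cases hD : D ≤ N
      · rw [q.as_sum]
        refine Submodule.sum_mem _ fun m hm => ?_
        have : monomial m (coeff m q) = (algebraMap k S (coeff m q)) • (monomial m (1 : k)) := by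
          rw [algebraMap_smul, smul_monomial, smul_eq_mul, mul_one]
        rw [this]
        refine V.smul_mem _ (Submodule.subset_span ⟨m, ?_, rfl⟩)
        by_contra hne
        refine mem_support_iff.1 hm (hq.coeff_eq_zero fun h' => hne ?_)
        simpa [h'] using hD
      · have hmem : q ∈ Ideal.span (Set.range f) :=
          hN (Ideal.pow_le_pow_right (not_le.1 hD).le (IsHomogeneous.mem_span_X_pow hq))
        obtain ⟨g, hg, -, rfl⟩ := exists_homogeneous_coeffs hf hq hmem
        refine Submodule.sum_mem _ fun j _ => ?_
        have : g j * f j = (⟨f j, Algebra.subset_adjoin ⟨j, rfl⟩⟩ : S) • g j := by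
          rw [mul_comm]
          rfl
        rw [this]
        exact V.smul_mem _ (ih _ (by have := he j; omega) _ (hg j))
  have htop : V = ⊤ := by
    rw [eq_top_iff]
    intro q _
    rw [← sum_homogeneousComponent q]
    exact Submodule.sum_mem _ fun i _ => hV i _ (homogeneousComponent_isHomogeneous _ _)
  have : Module.Finite S (MvPolynomial (Fin n) k) :=
    ⟨htop ▸ Submodule.fg_span hW⟩
  exact IsIntegral.of_finite S p

theorem isIntegral_of_no_zeros [Fintype ι]
    {f : ι → MvPolynomial (Fin n) k} {e : ι → ℕ} (hf : ∀ j, (f j).IsHomogeneous (e j))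
    (he : ∀ j, 0 < e j) (h : ∀ x : Fin n → k, (∀ j, eval x (f j) = 0) → x = 0)
    {L : Type*} [CommRing L] [Algebra k L] (ξ : Fin n → L) (S : Subalgebra k L)
    (hS : ∀ j, aeval ξ (f j) ∈ S) (i : Fin n) : IsIntegral S (ξ i) := by
  have h1 : ∀ p : Algebra.adjoin k (Set.range f), aeval ξ (p : MvPolynomial (Fin n) k) ∈ S := by
    intro p
    have : Algebra.adjoin k (Set.range f) ≤ S.comap (aeval ξ) := by
      rw [Algebra.adjoin_le_iff]
      rintro _ ⟨j, rfl⟩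
      exact hS j
    exact this p.2
  let φ : Algebra.adjoin k (Set.range f) →ₐ[k] S :=
    ((aeval ξ).comp (Algebra.adjoin k (Set.range f)).val).codRestrict S h1
  have := (isIntegral_X_of_no_zeros hf he h (X i)).map_of_comp_eq φ.toRingHom
    (aeval ξ : MvPolynomial (Fin n) k →ₐ[k] L).toRingHom (by ext; rfl)
  simpa using this

end Elimination

/-! ### Derivations in characteristic zero and isotropic subspaces -/

section Derivations

open scoped IntermediateField.algebraAdjoinAdjoin

variable {K L : Type*} [Field K] [CharZero K] [Field L] [Algebra K L]

/-- K[v] → K(v) is a localisation and K(v) ⊆ L is algebraic and separable, so L is formally étale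
over K[v]. The differentials of L are then a base change of those of K[v], and derivations extend.
Separability is where characteristic zero enters. -/
theorem exists_derivation_eq_pderiv {ι : Type*} {v : ι → L}
    (hv : IsTranscendenceBasis K v) (i : ι) :
    ∃ D : Derivation K L L, ∀ p : MvPolynomial ι K, D (aeval v p) = aeval v (pderiv i p) := by
  let S := Algebra.adjoin K (Set.range v)
  let F := IntermediateField.adjoin K (Set.range v)
  have : CharZero L := charZero_of_injective_algebraMap (algebraMap K L).injective
  have h1 : Algebra.FormallyEtale S F := .of_isLocalization (nonZeroDivisors _)
  have h2 : Algebra.IsAlgebraic F L := hv.isAlgebraic_field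
  have h3 : Algebra.FormallyEtale F L := .of_isSeparable F L
  have h4 : Algebra.FormallyEtale S L := .comp S F L
  let e : MvPolynomial ι K ≃ₐ[K] S := hv.1.aevalEquiv
  have he : ∀ s : S, aeval v (e.symm s) = (s : L) := fun s => by
    conv_rhs => rw [← e.apply_symm_apply s]
    exact (hv.1.algebraMap_aevalEquiv _).symm
  let d₀ : S →ₗ[K] L :=
    (aeval v : MvPolynomial ι K →ₐ[K] L).toLinearMap ∘ₗ (pderiv i).toLinearMap ∘ₗ
      e.symm.toLinearMap
  have hd₀ : ∀ s : S, d₀ s = aeval v (pderiv i (e.symm s)) := fun s => rfl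
  let d : Derivation K S L := Derivation.mk' d₀ fun a b => by
    rw [hd₀, hd₀, hd₀, map_mul, pderiv_mul, map_add, map_mul, map_mul, he, he,
      Algebra.smul_def, Algebra.smul_def]
    change _ = (a : L) * _ + (b : L) * _
    ring
  have hb := KaehlerDifferential.isBaseChange_of_formallyEtale K S L
  let D : Derivation K L L :=
    (hb.lift d.liftKaehlerDifferential).compDer (KaehlerDifferential.D K L)
  refine ⟨D, fun p => ?_⟩
  have h5 : aeval v p = algebraMap S L (e p) := (hv.1.algebraMap_aevalEquiv p).symm
  have h6 : D (algebraMap S L (e p)) = d (e p) := by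
    change hb.lift d.liftKaehlerDifferential (KaehlerDifferential.D K L (algebraMap S L (e p))) = _
    rw [← KaehlerDifferential.map_D K K S L, hb.lift_eq, Derivation.liftKaehlerDifferential_comp_D]
  rw [h5, h6]
  change aeval v (pderiv i (e.symm (e p))) = _
  rw [e.symm_apply_apply]

theorem exists_derivation_eq_single {ι : Type*} [DecidableEq ι] {u : ι → L}
    (hu : AlgebraicIndependent K u) (i : ι) :
    ∃ D : Derivation K L L, ∀ j, D (u j) = if j = i then 1 else 0 := by
  classical
  obtain ⟨t, hut, ht⟩ := exists_isTranscendenceBasis_superset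
    (s := Set.range u) hu.to_subtype_range
  obtain ⟨D, hD⟩ := exists_derivation_eq_pderiv ht ⟨u i, hut ⟨i, rfl⟩⟩
  refine ⟨D, fun j => ?_⟩
  have := hD (X ⟨u j, hut ⟨j, rfl⟩⟩)
  rw [aeval_X] at this
  rw [this, pderiv_X, Pi.single_apply]
  by_cases h : j = i
  · subst h
    simp
  · have h' : u j ≠ u i := fun h' => h (hu.injective h')
    simp [h, h']

/-- The span W of the v i is isotropic for the standard symplectic form B on a 2n-dimensional space.
As B is nondegenerate, it embeds W into the annihilator of W, whence 2 dim W ≤ 2n. -/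
theorem card_le_of_isotropic {F ι : Type*} [Field F] [Fintype ι] {n : ℕ}
    {v : ι → Fin n ⊕ Fin n → F} (hv : LinearIndependent F v)
    (h : ∀ i j, ∑ a, v i (.inr a) * v j (.inl a) = ∑ a, v j (.inr a) * v i (.inl a)) :
    Fintype.card ι ≤ n := by
  classical
  let B : (Fin n ⊕ Fin n → F) →ₗ[F] Module.Dual F (Fin n ⊕ Fin n → F) := LinearMap.mk₂ F
    (fun x y => ∑ a, (x (.inr a) * y (.inl a) - y (.inr a) * x (.inl a)))
    (fun x x' y => by
      rw [← Finset.sum_add_distrib]; exact Finset.sum_congr rfl fun a _ => by simp; ring)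
    (fun c x y => by
      rw [Finset.smul_sum]; exact Finset.sum_congr rfl fun a _ => by simp; ring)
    (fun x y y' => by
      rw [← Finset.sum_add_distrib]; exact Finset.sum_congr rfl fun a _ => by simp; ring)
    (fun c x y => by
      rw [Finset.smul_sum]; exact Finset.sum_congr rfl fun a _ => by simp; ring)
  have hB : ∀ x y, B x y = ∑ a, (x (.inr a) * y (.inl a) - y (.inr a) * x (.inl a)) :=
    fun x y => rfl
  have hinj : Function.Injective B := by
    rw [injective_iff_map_eq_zero]
    intro x hx
    funext s
    rcases s with a | a
    · have := LinearMap.congr_fun hx (Pi.single (.inr a) 1)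
      rw [hB] at this
      simpa [Pi.single_apply] using this
    · have := LinearMap.congr_fun hx (Pi.single (.inl a) 1)
      rw [hB] at this
      simpa [Pi.single_apply] using this
  let W : Subspace F (Fin n ⊕ Fin n → F) := Submodule.span F (Set.range v)
  have hW : Module.finrank F W = Fintype.card ι := finrank_span_eq_card hv
  have hle : W.map B ≤ W.dualAnnihilator := by
    rw [Submodule.map_span, Submodule.span_le]
    rintro _ ⟨_, ⟨i, rfl⟩, rfl⟩
    rw [SetLike.mem_coe, Submodule.mem_dualAnnihilator]
    intro w hw
    have : W ≤ LinearMap.ker (B (v i)) := by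
      rw [Submodule.span_le]
      rintro _ ⟨j, rfl⟩
      rw [SetLike.mem_coe, LinearMap.mem_ker, hB, Finset.sum_sub_distrib, h i j, sub_self]
    exact this hw
  have h1 := Submodule.finrank_mono hle
  have h2 := Subspace.finrank_add_finrank_dualAnnihilator_eq W
  have h3 : Module.finrank F (W.map B) = Module.finrank F W :=
    (Submodule.equivMapOfInjective B hinj W).finrank_eq.symm
  have h4 : Module.finrank F (Fin n ⊕ Fin n → F) = n + n := by simp
  omega

/-- If the form `∑ ζᵢ dφᵢ` vanishes, then at most `n` of the `2n` elements `φᵢ`, `ζᵢ` are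
algebraically independent. -/
theorem card_le_of_forall_derivation {n : ℕ} {φ ζ : Fin n → L}
    (h : ∀ D : Derivation K L L, ∑ a, ζ a * D (φ a) = 0)
    {ι : Type*} [Fintype ι] {g : ι → Fin n ⊕ Fin n}
    (hg : AlgebraicIndependent K (Sum.elim φ ζ ∘ g)) : Fintype.card ι ≤ n := by
  classical
  -- Derivations dual to the independent elements. The vectors formed by the values of D i on φ and
  -- ζ are independent because of this duality.
  choose D hD using fun i => exists_derivation_eq_single hg i
  refine card_le_of_isotropic (F := L) (v := fun i s => D i (Sum.elim φ ζ s)) ?_ fun i j => ?_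
  · rw [Fintype.linearIndependent_iff]
    intro c hc i
    have := congrFun hc (g i)
    have hD' : ∀ a b, D a (Sum.elim φ ζ (g b)) = if b = a then 1 else 0 := hD
    simpa [Finset.sum_apply, hD'] using this
  -- Cartan's formula for ω = Σ ζ dφ: differentiating ω(D j) = 0 along D i and ω(D i) = 0 along D j,
  -- and using ω([D i, D j]) = 0, leaves dω(D i, D j) = 0.
  · have h1 := congrArg (D i) (h (D j))
    have h2 := congrArg (D j) (h (D i))
    have h3 := h ⁅D i, D j⁆
    simp only [map_sum, Derivation.leibniz, smul_eq_mul, map_zero, Finset.sum_add_distrib,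
      Derivation.commutator_apply, mul_sub, Finset.sum_sub_distrib] at h1 h2 h3
    simp only [Sum.elim_inl, Sum.elim_inr]
    have e1 : ∑ a, D i (ζ a) * D j (φ a) = ∑ a, D j (φ a) * D i (ζ a) :=
      Finset.sum_congr rfl fun a _ => mul_comm _ _
    have e2 : ∑ a, D j (ζ a) * D i (φ a) = ∑ a, D i (φ a) * D j (ζ a) :=
      Finset.sum_congr rfl fun a _ => mul_comm _ _
    rw [e1, e2]
    linear_combination h1 - h2 - h3

end Derivations

/-! ### Linear forms and the equations of the incidence variety -/

section LinearForms

variable {A : Type*} [CommRing A] {n : ℕ}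

/-- The linear form with coefficients `c`. -/
def linForm (c : Fin n → A) : MvPolynomial (Fin n) A := ∑ i, C (c i) * X i

theorem linForm_isHomogeneous (c : Fin n → A) : (linForm c).IsHomogeneous 1 :=
  IsHomogeneous.sum _ _ _ fun _ _ => isHomogeneous_C_mul_X _ _

@[simp]
theorem eval_linForm (c x : Fin n → A) : eval x (linForm c) = c ⬝ᵥ x := by
  simp [linForm, dotProduct]

/-- The set `S` of vectors meets the subspace cut out by the linear forms `c` at most in zero. -/
def Misses (S : Set (Fin n → A)) {m : ℕ} (c : Fin m → Fin n → A) : Prop :=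
  ∀ x ∈ S, (∀ j, c j ⬝ᵥ x = 0) → x = 0

end LinearForms

section Incidence

variable {K : Type*} [CommRing K] {n r : ℕ}

/-- The ring of polynomials in two blocks of variables: the outer variables are the coordinates of
the first vector, the inner ones those of the second vector. -/
abbrev BiPoly (n : ℕ) (K : Type*) [CommRing K] : Type _ :=
  MvPolynomial (Fin n) (MvPolynomial (Fin n) K)

/-- Evaluation of polynomials in two blocks of variables. -/
def biEval {B : Type*} [CommRing B] (f : K →+* B) (x z : Fin n → B) : BiPoly n K →+* B :=
  eval₂Hom (eval₂Hom f z) x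

variable {B : Type*} [CommRing B] (f : K →+* B) (x z : Fin n → B)

@[simp]
theorem biEval_X (i : Fin n) : biEval f x z (X i) = x i := by simp [biEval]

@[simp]
theorem biEval_C_X (i : Fin n) : biEval f x z (C (X i)) = z i := by simp [biEval]

theorem biEval_comp_C_comp_C : (biEval f x z).comp (C.comp C) = f := by
  ext a
  simp [biEval]

theorem comp_biEval {B' : Type*} [CommRing B'] (g : B →+* B') :
    g.comp (biEval f x z) = biEval (g.comp f) (g ∘ x) (g ∘ z) := by
  ext a <;> simp [biEval]

/-- The equations of the incidence variety `{(x, z) | Crit E G x z}`. -/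
def critEqn (E : Fin r → MvPolynomial (Fin n) K) (G : MvPolynomial (Fin n) K) :
    Fin r ⊕ (Fin (r + 1) → Fin n) → BiPoly n K :=
  Sum.elim (fun j => eval X (map (C.comp C) (E j))) fun c =>
    ((augJacobian (fun j => map (C.comp C) (E j)) (map (C.comp C) G) X
      (fun i => C (X i))).submatrix id c).det

theorem forall_map_critEqn_eq_zero_iff (E : Fin r → MvPolynomial (Fin n) K)
    (G : MvPolynomial (Fin n) K) (θ : BiPoly n K →+* B) :
    (∀ s, θ (critEqn E G s) = 0) ↔
      Crit (fun j => map (θ.comp (C.comp C)) (E j)) (map (θ.comp (C.comp C)) G)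
        (fun i => θ (X i)) (fun i => θ (C (X i))) := by
  rw [Sum.forall, Crit, MinorsVanish]
  simp only [critEqn, Sum.elim_inl, Sum.elim_inr, map_minor, map_augJacobian, map_eval_apply,
    map_map]
  rfl

theorem eval_X_map_C_comp_C (p : MvPolynomial (Fin n) K) :
    eval (X : Fin n → BiPoly n K) (map (C.comp C) p) = map C p := by
  rw [← map_map, eval_map, eval₂_eta]

theorem critEqn_isHomogeneous {E : Fin r → MvPolynomial (Fin n) K} {G : MvPolynomial (Fin n) K}
    {e : Fin r → ℕ} {g : ℕ} (hE : ∀ j, (E j).IsHomogeneous (e j)) (hG : G.IsHomogeneous g)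
    (s : Fin r ⊕ (Fin (r + 1) → Fin n)) :
    (critEqn E G s).IsHomogeneous
      (Sum.elim e (fun _ => ∑ i, (Fin.cons (g - 1 - 1) (fun j => e j - 1) : Fin (r + 1) → ℕ) i)
        s) := by
  rcases s with j | c
  · simp only [critEqn, Sum.elim_inl, eval_X_map_C_comp_C]
    exact (hE j).map C
  · refine isHomogeneous_det _ _ fun i l => ?_
    refine Fin.cases ?_ (fun i => ?_) i
    · simp only [augJacobian, hessMul, pderiv_map, eval_X_map_C_comp_C, Matrix.submatrix_apply,
        Matrix.of_apply, id, Fin.cons_zero]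
      exact IsHomogeneous.sum _ _ _ fun a _ => ((hG.pderiv.pderiv).map C).C_mul _
    · simp only [augJacobian, grad, pderiv_map, eval_X_map_C_comp_C, Matrix.submatrix_apply,
        Matrix.of_apply, id, Fin.cons_succ]
      exact (hE i).pderiv.map C

theorem Crit.smul {E : Fin r → MvPolynomial (Fin n) K} {G : MvPolynomial (Fin n) K}
    {e : Fin r → ℕ} {g : ℕ} (hE : ∀ j, (E j).IsHomogeneous (e j)) (hG : G.IsHomogeneous g)
    {x z : Fin n → K} (h : Crit E G x z) (s t : K) : Crit E G (s • x) (t • z) := by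
  refine ⟨fun j => by rw [eval_smul_of_isHomogeneous (hE j), h.1 j, mul_zero], fun c => ?_⟩
  have : (augJacobian E G (s • x) (t • z)).submatrix id c = Matrix.of fun i j =>
      (Fin.cons (t * s ^ (g - 1 - 1)) (fun j => s ^ (e j - 1)) : Fin (r + 1) → K) i *
        (augJacobian E G x z).submatrix id c i j := by
    ext i l
    refine Fin.cases ?_ (fun i => ?_) i
    · simp only [augJacobian, hessMul, Matrix.submatrix_apply,
        Matrix.of_apply, id, Fin.cons_zero, Finset.mul_sum]
      refine Finset.sum_congr rfl fun a _ => ?_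
      rw [eval_smul_of_isHomogeneous hG.pderiv.pderiv, Pi.smul_apply, smul_eq_mul]
      ring
    · simp only [augJacobian, grad, Matrix.submatrix_apply, Matrix.of_apply, id, Fin.cons_succ]
      rw [eval_smul_of_isHomogeneous (hE i).pderiv]
  rw [this, Matrix.det_mul_column, h.2 c, mul_zero]

end Incidence

/-! ### Transcendence degree of a generic critical pair -/

section TranscendenceDegree

variable {K L : Type*} [Field K] [Field L] [Algebra K L] {n r : ℕ}

theorem derivation_aeval (D : Derivation K L L) (ξ : Fin n → L) (f : MvPolynomial (Fin n) K) :
    D (aeval ξ f) = ∑ i, aeval ξ (pderiv i f) * D (ξ i) := by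
  classical
  induction f using MvPolynomial.induction_on with
  | C a => simp
  | add p q hp hq => simp only [map_add, hp, hq, add_mul, Finset.sum_add_distrib]
  | mul_X p j hp =>
    have h1 : ∀ i, aeval ξ (pderiv i (p * X j)) * D (ξ i) =
        ξ j * (aeval ξ (pderiv i p) * D (ξ i)) + (if i = j then aeval ξ p * D (ξ j) else 0) := by
      intro i
      rw [pderiv_mul, pderiv_X, Pi.single_apply]
      by_cases h : i = j
      · subst h
        simp
        ring
      · simp [h, Ne.symm h]
        ring
    rw [Finset.sum_congr rfl fun i _ => h1 i, Finset.sum_add_distrib, ← Finset.mul_sum, ← hp,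
      map_mul, aeval_X, Derivation.leibniz, Finset.sum_ite_eq' Finset.univ j]
    simp only [smul_eq_mul, Finset.mem_univ, if_true]
    ring

theorem aeval_pderiv (f : MvPolynomial (Fin n) K) (ξ : Fin n → L) (i : Fin n) :
    aeval ξ (pderiv i f) = grad (map (algebraMap K L) f) ξ i := by
  rw [grad, pderiv_map, eval_map]
  rfl

theorem aeval_eq_eval_map (f : MvPolynomial (Fin n) K) (ξ : Fin n → L) :
    aeval ξ f = eval ξ (map (algebraMap K L) f) := by
  rw [eval_map]
  rfl

/-- All elements of K[ξ, ζ] are integral over S, and L consists of their fractions. -/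
theorem isAlgebraic_of_forall_isIntegral {ξ ζ : Fin n → L}
    (hL : ∀ y : L, ∃ p ∈ Algebra.adjoin K (Set.range ξ ∪ Set.range ζ),
      ∃ q ∈ Algebra.adjoin K (Set.range ξ ∪ Set.range ζ), y = p / q)
    (S : Subalgebra K L) (hξ : ∀ i, IsIntegral S (ξ i)) (hζ : ∀ i, ζ i ∈ S) :
    Algebra.IsAlgebraic S L := by
  have hle : Algebra.adjoin K (Set.range ξ ∪ Set.range ζ) ≤
      (integralClosure S L).restrictScalars K := by
    rw [Algebra.adjoin_le_iff]
    rintro _ (⟨i, rfl⟩ | ⟨i, rfl⟩)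
    · exact hξ i
    · exact isIntegral_algebraMap (R := S) (x := ⟨ζ i, hζ i⟩)
  refine ⟨fun y => ?_⟩
  obtain ⟨p, hp, q, hq, rfl⟩ := hL y
  have hp' : IsIntegral S p := hle hp
  have hq' : IsIntegral S q := hle hq
  rw [div_eq_mul_inv]
  exact hp'.isAlgebraic.mul hq'.isAlgebraic.inv

/-- Pairing a vector with (D ξ_i) kills each ∇E_j(ξ), by the chain rule applied to E_j(ξ) = 0. Since
the gradients are independent at ξ, criticality puts Hess G(ξ)ζ in their span. Its pairing with (D
ξ_i) is the sum in question, by the chain rule for ∂G/∂x_a. -/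
theorem sum_mul_derivation_eq_zero {E : Fin r → MvPolynomial (Fin n) K}
    {G : MvPolynomial (Fin n) K} {ξ ζ : Fin n → L}
    (hc : Crit (fun j => map (algebraMap K L) (E j)) (map (algebraMap K L) G) ξ ζ)
    (hs : ¬ JacSing (fun j => map (algebraMap K L) (E j)) ξ) (D : Derivation K L L) :
    ∑ a, ζ a * D (aeval ξ (pderiv a G)) = 0 := by
  rw [crit_iff, linearIndependent_finCons] at hc
  rw [jacSing_iff] at hs
  obtain ⟨h0, h1⟩ := hc
  have hli := not_not.1 fun h => hs ⟨h0, h⟩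
  have hmem := not_not.1 fun h => h1 ⟨hli, h⟩
  let δ : (Fin n → L) →ₗ[L] L := Fintype.linearCombination L fun i => D (ξ i)
  have hker : Submodule.span L (Set.range fun j => grad (map (algebraMap K L) (E j)) ξ) ≤
      LinearMap.ker δ := by
    rw [Submodule.span_le]
    rintro _ ⟨j, rfl⟩
    have : D (aeval ξ (E j)) = 0 := by
      rw [aeval_eq_eval_map, h0 j, map_zero]
    rw [derivation_aeval] at this
    simpa [δ, Fintype.linearCombination_apply, aeval_pderiv] using this
  have h2 := hker hmem
  rw [LinearMap.mem_ker, Fintype.linearCombination_apply] at h2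
  rw [← h2]
  simp only [derivation_aeval, hessMul, smul_eq_mul, Finset.sum_mul, Finset.mul_sum]
  rw [Finset.sum_comm]
  refine Finset.sum_congr rfl fun i _ => Finset.sum_congr rfl fun a _ => ?_
  rw [pderiv_map, pderiv_map, aeval_eq_eval_map, mul_assoc]

/-- Two cases, according to whether the Jacobian of E drops rank at ξ. If it does, L is algebraic
over ζ and the forms c' at ξ. If not, L is algebraic over φ = ∇G(ξ), ζ and the forms c at ξ, and
isotropy allows only n independent elements among the 2n coordinates of (φ, ζ). -/
theorem trdeg_le_of_crit [IsAlgClosed K] [CharZero K] {E : Fin r → MvPolynomial (Fin n) K}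
    {G : MvPolynomial (Fin n) K}
    {e : Fin r → ℕ} {g : ℕ} (hE : ∀ j, (E j).IsHomogeneous (e j)) (hG : G.IsHomogeneous g)
    (hg : 2 ≤ g) {m : ℕ} {c c' : Fin m → Fin n → K} (hc : Misses {x | grad G x = 0} c)
    (hc' : Misses {x | JacSing E x} c') {ξ ζ : Fin n → L}
    (hL : ∀ y : L, ∃ p ∈ Algebra.adjoin K (Set.range ξ ∪ Set.range ζ),
      ∃ q ∈ Algebra.adjoin K (Set.range ξ ∪ Set.range ζ), y = p / q)
    (hcrit : Crit (fun j => map (algebraMap K L) (E j)) (map (algebraMap K L) G) ξ ζ) :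
    Algebra.trdeg K L ≤ (n + m : ℕ) := by
  classical
  by_cases hs : JacSing (fun j => map (algebraMap K L) (E j)) ξ
  · let T : Set L := Set.range (Sum.elim ζ fun j => aeval ξ (linForm (c' j)))
    -- The equations and minors are multiplied by the coordinates to make all degrees positive, as
    -- the integrality lemma requires. The nontrivial common zeros stay the same.
    let f : (Fin n × (Fin r ⊕ (Fin r → Fin n))) ⊕ Fin m → MvPolynomial (Fin n) K :=
      Sum.elim (fun s => X s.1 * Sum.elim E
        (fun q => ((Matrix.of fun j i => pderiv i (E j)).submatrix id q).det) s.2)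
        fun j => linForm (c' j)
    have hf : ∀ s, (f s).IsHomogeneous (Sum.elim (fun s => 1 + Sum.elim e
        (fun _ => ∑ j, (e j - 1)) s.2) (fun _ => 1) s) := by
      rintro (⟨i, j | q⟩ | j)
      · exact (isHomogeneous_X _ _).mul (hE j)
      · exact (isHomogeneous_X _ _).mul (isHomogeneous_det _ _ fun j i => (hE j).pderiv)
      · exact linForm_isHomogeneous _
    have hminor : ∀ q, aeval ξ ((Matrix.of fun j i => pderiv i (E j)).submatrix id q).det =
        ((jacobian (fun j => map (algebraMap K L) (E j)) ξ).submatrix id q).det := by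
      intro q
      rw [AlgHom.map_det]
      congr 1
      ext i j
      exact aeval_pderiv _ _ _
    have hminor' : ∀ (x : Fin n → K) q,
        eval x ((Matrix.of fun j i => pderiv i (E j)).submatrix id q).det =
        ((jacobian E x).submatrix id q).det := by
      intro x q
      rw [RingHom.map_det]
      rfl
    have hnz : ∀ x : Fin n → K, (∀ s, eval x (f s) = 0) → x = 0 := by
      intro x hx
      by_contra hne
      obtain ⟨i, hi⟩ := Function.ne_iff.1 hne
      refine hne (hc' x ⟨fun j => ?_, fun q => ?_⟩ fun j => ?_)
      · have := hx (.inl (i, .inl j))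
        simpa [f, show x i ≠ 0 from hi] using this
      · have := hx (.inl (i, .inr q))
        simp only [f, Sum.elim_inl, Sum.elim_inr, map_mul, eval_X, hminor'] at this
        exact (mul_eq_zero.1 this).resolve_left hi
      · simpa [f] using hx (.inr j)
    have hmem : ∀ s, aeval ξ (f s) ∈ Algebra.adjoin K T := by
      rintro (⟨i, j | q⟩ | j)
      · have : aeval ξ (f (.inl (i, .inl j))) = 0 := by
          simp only [f, Sum.elim_inl, map_mul]
          rw [aeval_eq_eval_map (E j), hs.1 j, mul_zero]
        rw [this]
        exact zero_mem _
      · have : aeval ξ (f (.inl (i, .inr q))) = 0 := by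
          simp only [f, Sum.elim_inl, Sum.elim_inr, map_mul]
          rw [hminor, hs.2 q, mul_zero]
        rw [this]
        exact zero_mem _
      · exact Algebra.subset_adjoin ⟨.inr j, rfl⟩
    have halg : Algebra.IsAlgebraic (Algebra.adjoin K T) L :=
      isAlgebraic_of_forall_isIntegral hL _
        (isIntegral_of_no_zeros hf (by rintro (s | j) <;> simp) hnz ξ _ hmem)
        fun i => Algebra.subset_adjoin ⟨.inl i, rfl⟩
    refine (Algebra.IsAlgebraic.trdeg_le_cardinalMk K T).trans ?_
    have := Cardinal.mk_range_le_lift (f := Sum.elim ζ fun j => aeval ξ (linForm (c' j)))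
    simpa [T] using this
  · let φ : Fin n → L := fun a => aeval ξ (pderiv a G)
    let T₁ : Set L := Set.range (Sum.elim φ ζ)
    let T₂ : Set L := Set.range fun j => aeval ξ (linForm (c j))
    let f : Fin n ⊕ Fin m → MvPolynomial (Fin n) K :=
      Sum.elim (fun a => pderiv a G) fun j => linForm (c j)
    have hf : ∀ s, (f s).IsHomogeneous (Sum.elim (fun _ => g - 1) (fun _ => 1) s) := by
      rintro (a | j)
      · exact hG.pderiv
      · exact linForm_isHomogeneous _
    have hnz : ∀ x : Fin n → K, (∀ s, eval x (f s) = 0) → x = 0 := by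
      intro x hx
      refine hc x (funext fun a => hx (.inl a)) fun j => ?_
      simpa [f] using hx (.inr j)
    have halg : Algebra.IsAlgebraic (Algebra.adjoin K (T₁ ∪ T₂)) L := by
      refine isAlgebraic_of_forall_isIntegral hL _
        (isIntegral_of_no_zeros hf (by rintro (s | j) <;> simp; omega) hnz ξ _ ?_)
        fun i => Algebra.subset_adjoin (.inl ⟨.inr i, rfl⟩)
      rintro (a | j)
      · exact Algebra.subset_adjoin (.inl ⟨.inl a, rfl⟩)
      · exact Algebra.subset_adjoin (.inr ⟨j, rfl⟩)
    -- The transcendence basis is chosen inside the generators, so that its members among the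
    -- coordinates of (φ, ζ) and among the linear forms can be counted separately.
    obtain ⟨t, ht, htb⟩ := exists_isTranscendenceBasis_subset (R := K) (T₁ ∪ T₂)
    rw [← htb.cardinalMk_eq_trdeg]
    have hT₁ : T₁.Finite := Set.finite_range _
    have hT₂ : T₂.Finite := Set.finite_range _
    have h1 : (t ∩ T₁).ncard ≤ n := by
      have hfin : (t ∩ T₁).Finite := hT₁.subset Set.inter_subset_right
      have := hfin.fintype
      choose q hq using fun y : (t ∩ T₁ : Set L) => y.2.2
      have hai : AlgebraicIndependent K (Sum.elim φ ζ ∘ q) := by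
        have : Sum.elim φ ζ ∘ q = (fun y : t => (y : L)) ∘ Set.inclusion Set.inter_subset_left :=
          funext fun y => hq y
        rw [this]
        exact htb.1.comp _ (Set.inclusion_injective _)
      have := card_le_of_forall_derivation (φ := φ) (ζ := ζ)
        (sum_mul_derivation_eq_zero hcrit hs) hai
      rwa [← Nat.card_eq_fintype_card] at this
    have h2 : (t ∩ T₂).ncard ≤ m := by
      refine (Set.ncard_le_ncard Set.inter_subset_right hT₂).trans ?_
      refine (Set.ncard_image_le (s := Set.univ) (f := fun j => aeval ξ (linForm (c j)))
        Set.finite_univ |>.trans ?_) |> (by simpa [T₂] using ·)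
      simp
    have h3 : t.ncard ≤ n + m := by
      have : t = (t ∩ T₁) ∪ (t ∩ T₂) := by
        rw [← Set.inter_union_distrib_left, Set.inter_eq_left.2 ht]
      rw [this]
      exact (Set.ncard_union_le _ _).trans (add_le_add h1 h2)
    have hfin : t.Finite := (hT₁.union hT₂).subset ht
    rw [← Set.cast_ncard hfin]
    exact_mod_cast h3

end TranscendenceDegree

/-! ### Krull dimension and generic hyperplane sections -/

section Cutting

theorem le_of_add_one_le_add_one {a : WithBot ℕ∞} {N : ℕ}
    (h : a + 1 ≤ (N : WithBot ℕ∞) + 1) : a ≤ N := by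
  induction a using WithBot.recBotCoe with
  | bot => exact bot_le
  | coe a =>
    have h' : a + 1 ≤ (N : ℕ∞) + 1 := by exact_mod_cast h
    exact_mod_cast (ENat.addLECancellable_of_ne_top ENat.one_ne_top).add_le_add_iff_right.1 h'

theorem ringKrullDim_quotient_add_one_le {R : Type*} [CommRing R] {P Q : Ideal R} [P.IsPrime]
    (h : P < Q) : ringKrullDim (R ⧸ Q) + 1 ≤ ringKrullDim (R ⧸ P) := by
  obtain ⟨a, haQ, haP⟩ := SetLike.exists_of_lt h
  refine ringKrullDim_succ_le_of_surjective (Ideal.Quotient.factor h.le)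
    (Ideal.Quotient.factor_surjective h.le) (r := Ideal.Quotient.mk P a) ?_ ?_
  · rw [mem_nonZeroDivisors_iff_ne_zero, Ne, Ideal.Quotient.eq_zero_iff_mem]
    exact haP
  · rw [Ideal.Quotient.factor_mk, Ideal.Quotient.eq_zero_iff_mem]
    exact haQ

theorem ringKrullDim_le_of_isIntegral {R S : Type*} [CommRing R] [CommRing S] [Algebra R S]
    [Algebra.IsIntegral R S] : ringKrullDim S ≤ ringKrullDim R :=
  Order.krullDim_le_of_strictMono (PrimeSpectrum.comap (algebraMap R S)) fun _ _ h =>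
    Ideal.IsIntegral.comap_lt_comap h

/-- Noether normalisation: A is integral over a polynomial ring, whose number of variables is at
most the transcendence degree. -/
theorem ringKrullDim_le_of_trdeg_le {K A : Type*} [Field K] [CommRing A] [IsDomain A]
    [Algebra K A] [Algebra.FiniteType K A] {N : ℕ} (h : Algebra.trdeg K A ≤ N) :
    ringKrullDim A ≤ N := by
  obtain ⟨s, g, hinj, hint⟩ := exists_integral_inj_algHom_of_fg K A
  have h1 : (s : Cardinal) ≤ Algebra.trdeg K A := by
    have hai : AlgebraicIndependent K fun i => g (X i) := by
      have : (aeval fun i => g (X i) : MvPolynomial (Fin s) K →ₐ[K] A) = g := by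
        ext i
        simp
      rw [AlgebraicIndependent, this]
      exact hinj
    simpa using hai.lift_cardinalMk_le_trdeg
  have h2 : s ≤ N := by exact_mod_cast h1.trans h
  algebraize [g.toRingHom]
  have : Algebra.IsIntegral (MvPolynomial (Fin s) K) A := ⟨hint⟩
  refine (ringKrullDim_le_of_isIntegral (R := MvPolynomial (Fin s) K)).trans ?_
  rw [MvPolynomial.ringKrullDim_of_isNoetherianRing, ringKrullDim_eq_zero_of_field]
  simpa using h2

variable {K R : Type*} [Field K] [Infinite K] [CommRing R] [IsNoetherianRing R] [Algebra K R]
  {n : ℕ}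

/-- Each of the finitely many minimal primes concerned excludes only a proper subspace of
coefficient vectors, and finitely many proper subspaces do not cover a vector space over an infinite
field. -/
theorem exists_linearCombination_notMem_minimalPrimes (v : Fin n → R) (I : Ideal R) :
    ∃ c : Fin n → K, ∀ P ∈ I.minimalPrimes, (∃ i, v i ∉ P) → ∑ i, c i • v i ∉ P := by
  classical
  let T : Ideal R → Subspace K (Fin n → K) := fun P =>
    (P.restrictScalars K).comap (Fintype.linearCombination K v)
  let Ps := {P ∈ I.minimalPrimes | ∃ i, v i ∉ P}
  have hfin : Ps.Finite := (Ideal.finite_minimalPrimes_of_isNoetherianRing R I).subset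
    fun P hP => hP.1
  have hne : ∀ P ∈ Ps, T P ≠ ⊤ := by
    rintro P ⟨-, i, hi⟩ htop
    have : Pi.single i 1 ∈ T P := htop ▸ Submodule.mem_top
    apply hi
    simpa [T, Fintype.linearCombination_apply] using this
  have hcov := Subspace.biUnion_ne_univ_of_top_notMem (s := hfin.toFinset.image T) (by
    intro h
    obtain ⟨P, hP, hPt⟩ := Finset.mem_image.1 h
    exact hne P (hfin.mem_toFinset.1 hP) hPt)
  obtain ⟨c, hc⟩ := (Set.ne_univ_iff_exists_notMem _).1 hcov
  refine ⟨c, fun P hP hi hmem => hc ?_⟩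
  simp only [Set.mem_iUnion]
  exact ⟨T P, Finset.mem_image.2 ⟨P, hfin.mem_toFinset.2 ⟨hP, hi⟩, rfl⟩, by
    simpa [T, Fintype.linearCombination_apply] using hmem⟩

/-- Cutting by generic hyperplanes lowers the dimension of the part of `V(I)` on which the
predicate `Rel` holds. -/
theorem exists_cut {Rel : Ideal R → Prop} (hmono : ∀ P Q, P ≤ Q → Rel Q → Rel P) (v : Fin n → R)
    (hv : ∀ P, Rel P → ∃ i, v i ∉ P) (a D : ℕ) (I : Ideal R)
    (h : ∀ P : Ideal R, P.IsPrime → I ≤ P → Rel P → ringKrullDim (R ⧸ P) ≤ (D + a : ℕ)) :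
    ∃ c : Fin a → Fin n → K, ∀ P : Ideal R, P.IsPrime → I ≤ P →
      (∀ j, ∑ i, c j i • v i ∈ P) → Rel P → ringKrullDim (R ⧸ P) ≤ D := by
  induction a generalizing I with
  | zero => exact ⟨Fin.elim0, fun P hP hI _ hR => h P hP hI hR⟩
  | succ a ih =>
    obtain ⟨c₀, hc₀⟩ := exists_linearCombination_notMem_minimalPrimes (K := K) v I
    -- A prime over the enlarged ideal lies strictly above a minimal prime of I. The latter still
    -- satisfies `Rel` and so does not contain the new linear combination; this costs one dimension.
    obtain ⟨c, hc⟩ := ih (I ⊔ Ideal.span {∑ i, c₀ i • v i}) fun Q hQ hIQ hR => by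
      obtain ⟨P, hP, hPQ⟩ := Ideal.exists_minimalPrimes_le (le_sup_left.trans hIQ)
      have := hP.1.1
      have hRP := hmono P Q hPQ hR
      have hlt : P < Q := lt_of_le_of_ne hPQ fun heq => by
        refine hc₀ P hP (hv P hRP) (heq ▸ ?_)
        exact hIQ (Ideal.mem_sup_right (Ideal.mem_span_singleton_self _))
      have h1 := (ringKrullDim_quotient_add_one_le hlt).trans (h P this hP.1.2 hRP)
      have h2 : ((D + (a + 1) : ℕ) : WithBot ℕ∞) = ((D + a : ℕ) : WithBot ℕ∞) + 1 := by
        push_cast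
        rw [add_assoc]
      rw [h2] at h1
      exact le_of_add_one_le_add_one h1
    refine ⟨Fin.cons c₀ c, fun P hP hI hmem hR => hc P hP (sup_le hI ?_) (fun j => ?_) hR⟩
    · rw [Ideal.span_singleton_le_iff_mem]
      exact hmem 0
    · exact hmem j.succ

end Cutting

/-! ### Generic linear forms avoid the critical pairs: characteristic zero -/

section Generic

variable {K : Type*} [Field K] {n r : ℕ}

/-- Two systems of linear forms, in the first and in the second vector, such that no critical pair
of nonzero vectors is annihilated by both. -/
def Avoids {A : Type*} [CommRing A] (E : Fin r → MvPolynomial (Fin n) A)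
    (G : MvPolynomial (Fin n) A) {a b : ℕ} (c : Fin a → Fin n → A) (d : Fin b → Fin n → A) : Prop :=
  ∀ x z : Fin n → A, x ≠ 0 → z ≠ 0 → Crit E G x z → (∀ j, c j ⬝ᵥ x = 0) →
    (∀ j, d j ⬝ᵥ z = 0) → False

theorem ringKrullDim_le_of_crit [IsAlgClosed K] [CharZero K] {E : Fin r → MvPolynomial (Fin n) K}
    {G : MvPolynomial (Fin n) K} {e : Fin r → ℕ} {g : ℕ} (hE : ∀ j, (E j).IsHomogeneous (e j))
    (hG : G.IsHomogeneous g) (hg : 2 ≤ g) {m : ℕ} {c c' : Fin m → Fin n → K}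
    (hc : Misses {x | grad G x = 0} c) (hc' : Misses {x | JacSing E x} c')
    {Q : Type*} [CommRing Q] [IsDomain Q] [Algebra K Q] (q : BiPoly n K →ₐ[K] Q)
    (hq : Function.Surjective q) (hP : ∀ s, q (critEqn E G s) = 0) :
    ringKrullDim Q ≤ (n + m : ℕ) := by
  let L := FractionRing Q
  let θ : BiPoly n K →ₐ[K] L := (IsScalarTower.toAlgHom K Q L).comp q
  have hθ : ∀ p, θ p = algebraMap Q L (q p) := fun p => rfl
  have hθC : θ.toRingHom.comp (C.comp C) = algebraMap K L := by
    ext a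
    exact θ.commutes a
  let ξ : Fin n → L := fun i => θ (X i)
  let ζ : Fin n → L := fun i => θ (C (X i))
  have hcrit : Crit (fun j => map (algebraMap K L) (E j)) (map (algebraMap K L) G) ξ ζ := by
    rw [← hθC]
    refine (forall_map_critEqn_eq_zero_iff E G θ.toRingHom).1 fun s => ?_
    change θ _ = 0
    rw [hθ, hP s, map_zero]
  have hadj : ∀ p, θ p ∈ Algebra.adjoin K (Set.range ξ ∪ Set.range ζ) := by
    intro p
    induction p using MvPolynomial.induction_on with
    | C q =>
      induction q using MvPolynomial.induction_on with
      | C a =>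
        have : θ (C (C a)) = algebraMap K L a := θ.commutes a
        rw [this]
        exact Subalgebra.algebraMap_mem _ a
      | add p q hp hq => simpa only [map_add] using add_mem hp hq
      | mul_X p i hp =>
        simpa only [map_mul] using mul_mem hp (Algebra.subset_adjoin (.inr ⟨i, rfl⟩))
    | add p q hp hq => simpa only [map_add] using add_mem hp hq
    | mul_X p i hp =>
      simpa only [map_mul] using mul_mem hp (Algebra.subset_adjoin (.inl ⟨i, rfl⟩))
  have htr := trdeg_le_of_crit hE hG hg hc hc' (ξ := ξ) (ζ := ζ) (fun y => by
    obtain ⟨a, b, hb, rfl⟩ := IsFractionRing.div_surjective (A := Q) y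
    obtain ⟨a, rfl⟩ := hq a
    obtain ⟨b, rfl⟩ := hq b
    exact ⟨_, hadj a, _, hadj b, rfl⟩) hcrit
  have : Algebra.FiniteType K Q := .of_surjective q hq
  refine ringKrullDim_le_of_trdeg_le (K := K) (le_trans ?_ htr)
  exact trdeg_le_of_injective (IsScalarTower.toAlgHom K Q L) (IsFractionRing.injective Q L)

/-- P is the ideal of the plane {(sx, tz)}. The chain consists of this plane, the line {(0, tz)} and
the origin; it is strict because x and z are nonzero. -/
theorem two_le_ringKrullDim_quotient_ker {x z : Fin n → K} (hx : x ≠ 0) (hz : z ≠ 0)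
    {P : Ideal (BiPoly n K)}
    (hP : P = RingHom.ker (biEval (C : K →+* MvPolynomial (Fin 2) K)
      (fun i => X 0 * C (x i)) (fun i => X 1 * C (z i)))) :
    2 ≤ ringKrullDim (BiPoly n K ⧸ P) := by
  subst hP
  obtain ⟨i, hi⟩ := Function.ne_iff.1 hx
  obtain ⟨l, hl⟩ := Function.ne_iff.1 hz
  let θ₀ : BiPoly n K →+* MvPolynomial (Fin 2) K :=
    biEval C (fun i => X 0 * C (x i)) (fun i => X 1 * C (z i))
  let θ₁ : BiPoly n K →+* MvPolynomial (Fin 2) K := biEval C (fun _ => 0) (fun i => X 1 * C (z i))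
  let θ₂ : BiPoly n K →+* MvPolynomial (Fin 2) K := biEval C (fun _ => 0) (fun _ => 0)
  have h01 : RingHom.ker θ₀ < RingHom.ker θ₁ := by
    let π : MvPolynomial (Fin 2) K →+* MvPolynomial (Fin 2) K := eval₂Hom C ![0, X 1]
    have hπ : π.comp θ₀ = θ₁ := by
      rw [comp_biEval]
      congr 1
      · ext; simp [π]
      · funext i; simp [π]
      · funext i; simp [π]
    refine lt_of_le_of_ne (fun p hp => ?_) fun heq => ?_
    · rw [RingHom.mem_ker, ← hπ, RingHom.comp_apply, RingHom.mem_ker.1 hp, map_zero]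
    · have : (X i : BiPoly n K) ∈ RingHom.ker θ₁ := by simp [θ₁, RingHom.mem_ker]
      rw [← heq] at this
      simp [θ₀, RingHom.mem_ker] at this
      exact hi this
  have h12 : RingHom.ker θ₁ < RingHom.ker θ₂ := by
    let π : MvPolynomial (Fin 2) K →+* MvPolynomial (Fin 2) K := eval₂Hom C ![X 0, 0]
    have hπ : π.comp θ₁ = θ₂ := by
      rw [comp_biEval]
      congr 1
      · ext; simp [π]
      · funext i; simp [π]
    refine lt_of_le_of_ne (fun p hp => ?_) fun heq => ?_
    · rw [RingHom.mem_ker, ← hπ, RingHom.comp_apply, RingHom.mem_ker.1 hp, map_zero]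
    · have : (C (X l) : BiPoly n K) ∈ RingHom.ker θ₂ := by simp [θ₂, RingHom.mem_ker]
      rw [← heq] at this
      simp [θ₁, RingHom.mem_ker] at this
      exact hl this
  have := RingHom.ker_isPrime θ₀
  have := RingHom.ker_isPrime θ₁
  have := RingHom.ker_isPrime θ₂
  have h0 : 0 ≤ ringKrullDim (BiPoly n K ⧸ RingHom.ker θ₂) := ringKrullDim_nonneg_of_nontrivial
  calc (2 : WithBot ℕ∞) = 0 + 1 + 1 := by norm_num
    _ ≤ ringKrullDim (BiPoly n K ⧸ RingHom.ker θ₂) + 1 + 1 := by gcongr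
    _ ≤ ringKrullDim (BiPoly n K ⧸ RingHom.ker θ₁) + 1 := by
      gcongr
      exact ringKrullDim_quotient_add_one_le h12
    _ ≤ _ := ringKrullDim_quotient_add_one_le h01

/-- From dimension at most n + m = a + b + 1, the a cuts in x and b cuts in z leave dimension at
most 1 away from x = 0 and z = 0. By bihomogeneity a surviving pair of nonzero vectors would bring
along a whole plane. -/
theorem exists_avoids_of_charZero [IsAlgClosed K] [CharZero K] {E : Fin r → MvPolynomial (Fin n) K}
    {G : MvPolynomial (Fin n) K} {e : Fin r → ℕ} {g : ℕ} (hE : ∀ j, (E j).IsHomogeneous (e j))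
    (hG : G.IsHomogeneous g) (hg : 2 ≤ g) {m : ℕ} {c c' : Fin m → Fin n → K}
    (hc : Misses {x | grad G x = 0} c) (hc' : Misses {x | JacSing E x} c')
    {a b : ℕ} (hab : a + b + 1 = n + m) :
    ∃ (u : Fin a → Fin n → K) (w : Fin b → Fin n → K), Avoids E G u w := by
  have : Infinite K := IsAlgClosed.instInfinite
  let I : Ideal (BiPoly n K) := Ideal.span (Set.range (critEqn E G))
  -- Only components contained neither in x = 0 nor in z = 0 matter: a generic form in x lowers the
  -- dimension only outside x = 0, and similarly for z.
  let Rel : Ideal (BiPoly n K) → Prop := fun P =>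
    (∃ i, (X i : BiPoly n K) ∉ P) ∧ ∃ i, (C (X i) : BiPoly n K) ∉ P
  have hmono : ∀ P Q, P ≤ Q → Rel Q → Rel P := fun P Q h ⟨⟨i, hi⟩, ⟨j, hj⟩⟩ =>
    ⟨⟨i, fun h' => hi (h h')⟩, ⟨j, fun h' => hj (h h')⟩⟩
  obtain ⟨u, hu⟩ := exists_cut (K := K) hmono (fun i => (X i : BiPoly n K)) (fun P h => h.1) a
    (1 + b) I fun P hP hI _ => by
      have := ringKrullDim_le_of_crit hE hG hg hc hc'
        (Ideal.Quotient.mkₐ K P) (Ideal.Quotient.mkₐ_surjective K P)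
        fun s => Ideal.Quotient.eq_zero_iff_mem.2 (hI (Ideal.subset_span ⟨s, rfl⟩))
      rwa [show 1 + b + a = n + m by omega]
  obtain ⟨w, hw⟩ := exists_cut (K := K) hmono (fun i => (C (X i) : BiPoly n K)) (fun P h => h.2) b
    1 (I ⊔ Ideal.span (Set.range fun j => ∑ i, u j i • (X i : BiPoly n K))) fun P hP hI hR =>
      hu P hP (le_sup_left.trans hI)
        (fun j => hI (Ideal.mem_sup_right (Ideal.subset_span ⟨j, rfl⟩))) hR
  refine ⟨u, w, fun x z hx hz hcrit hux hwz => ?_⟩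
  let θ : BiPoly n K →+* MvPolynomial (Fin 2) K :=
    biEval C (fun i => X 0 * C (x i)) (fun i => X 1 * C (z i))
  have hθ : ∀ (t : K) (p : BiPoly n K), θ (t • p) = C t * θ p := fun t p => by
    rw [Algebra.smul_def, map_mul]
    congr 1
    exact RingHom.congr_fun (biEval_comp_C_comp_C _ _ _) t
  have hprime := RingHom.ker_isPrime θ
  have hsum : ∀ (t y : Fin n → K) (s : MvPolynomial (Fin 2) K), t ⬝ᵥ y = 0 →
      ∑ i, C (t i) * (s * C (y i)) = 0 := by
    intro t y s h
    have : ∑ i, C (t i) * (s * C (y i)) = s * C (t ⬝ᵥ y) := by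
      rw [dotProduct, map_sum, Finset.mul_sum]
      refine Finset.sum_congr rfl fun i _ => ?_
      rw [map_mul]
      ring
    rw [this, h, map_zero, mul_zero]
  have hIker : ∀ s, critEqn E G s ∈ RingHom.ker θ := by
    refine (forall_map_critEqn_eq_zero_iff E G θ).2 ?_
    rw [biEval_comp_C_comp_C]
    have h1 := Crit.smul (fun j => (hE j).map (C : K →+* MvPolynomial (Fin 2) K)) (hG.map C)
      (hcrit.map (C : K →+* MvPolynomial (Fin 2) K)) (X 0) (X 1)
    convert h1 using 1 <;> funext i <;> simp [θ]
  have h1 := hw (RingHom.ker θ) hprime (sup_le ?_ ?_) ?_ ?_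
  · have h2 := two_le_ringKrullDim_quotient_ker hx hz (P := RingHom.ker θ) rfl
    have h3 := h2.trans h1
    norm_num at h3
  · rw [Ideal.span_le]
    rintro _ ⟨s, rfl⟩
    exact hIker s
  · rw [Ideal.span_le]
    rintro _ ⟨j, rfl⟩
    rw [SetLike.mem_coe, RingHom.mem_ker, map_sum]
    simp only [hθ, θ, biEval_X]
    exact hsum _ _ _ (hux j)
  · intro j
    rw [RingHom.mem_ker, map_sum]
    simp only [hθ, θ, biEval_C_X]
    exact hsum _ _ _ (hwz j)
  · obtain ⟨i, hi⟩ := Function.ne_iff.1 hx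
    obtain ⟨l, hl⟩ := Function.ne_iff.1 hz
    refine ⟨⟨i, fun h => ?_⟩, ⟨l, fun h => ?_⟩⟩
    · simp [θ, RingHom.mem_ker] at h
      exact hi h
    · simp [θ, RingHom.mem_ker] at h
      exact hl h

end Generic

/-! ### Transfer to large characteristic through residue fields of products -/

section Ultraproduct

variable {ι : Type*} {k : ι → Type*} [∀ i, Field (k i)] {K : Type*} [Field K]
  (φ : (∀ i, k i) →+* K) {n r : ℕ}

/-- A finite system of equations and one inequation that hold in a residue field of a product of
fields hold in one of the factors. -/
theorem exists_coord {s : Type*} [Fintype s] (f : s → ∀ i, k i) (h : ∀ i, k i)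
    (hf : ∀ a, φ (f a) = 0) (hh : φ h ≠ 0) : ∃ i, (∀ a, f a i = 0) ∧ h i ≠ 0 := by
  classical
  by_contra! hcon
  -- If no coordinate works, then in each factor either some f a is invertible or h vanishes. Thus h
  -- lies in the ideal generated by the f a, and φ h = 0.
  have H : ∀ i, ∃ g : s → k i, ∑ a, f a i * g a = h i := by
    intro i
    by_cases hi : ∀ a, f a i = 0
    · exact ⟨0, by simp [hcon i hi]⟩
    · push Not at hi
      obtain ⟨a, ha⟩ := hi
      refine ⟨Pi.single a (h i / f a i), ?_⟩
      rw [Finset.sum_eq_single a]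
      · simp [mul_div_cancel₀ _ ha]
      · intro b _ hb
        simp [hb]
      · simp
  choose g hg using H
  have : h = ∑ a, f a * fun i => g i a := by
    funext i
    rw [← hg i]
    simp [Finset.sum_apply]
  apply hh
  rw [this, map_sum]
  exact Finset.sum_eq_zero fun a _ => by rw [map_mul, hf a, zero_mul]

/-- The common degree leaves only finitely many monomials, so a family of forms is a single form
over the product ring. -/
theorem exists_map_eval_eq {e : ℕ} (f : ∀ i, MvPolynomial (Fin n) (k i))
    (hf : ∀ i, (f i).IsHomogeneous e) :
    ∃ F : MvPolynomial (Fin n) (∀ i, k i), F.IsHomogeneous e ∧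
      ∀ i, map (Pi.evalRingHom k i) F = f i := by
  classical
  let T := (Finsupp.finite_of_degree_eq (σ := Fin n) e).toFinset
  refine ⟨∑ m ∈ T, monomial m fun i => coeff m (f i), ?_, fun i => ?_⟩
  · refine IsHomogeneous.sum _ _ _ fun m hm => isHomogeneous_monomial _ ?_
    simpa [T] using hm
  · ext m
    rw [map_sum, coeff_sum]
    simp only [map_monomial, coeff_monomial, Pi.evalRingHom_apply, Finset.sum_ite_eq']
    split_ifs with hm
    · rfl
    · exact ((hf i).coeff_eq_zero fun h => hm (by simpa [T] using h)).symm

/-- A monic polynomial lifts to a monic one of the same degree over the product; it has a root in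
each coordinate, and the family of roots is a root. -/
theorem isAlgClosed_of_surjective_pi [∀ i, IsAlgClosed (k i)] (hφ : Function.Surjective φ) :
    IsAlgClosed K := by
  refine IsAlgClosed.of_exists_root K fun p hp hirr => ?_
  have hlift : p ∈ Polynomial.lifts φ :=
    (Polynomial.lifts_iff_coeff_lifts p).2 fun j => hφ _
  obtain ⟨q, rfl, hdeg, hq⟩ := Polynomial.lifts_and_natDegree_eq_and_monic hlift hp
  have : Nontrivial (∀ i, k i) := φ.domain_nontrivial
  have hroot : ∀ i, ∃ x, (q.map (Pi.evalRingHom k i)).eval x = 0 := by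
    intro i
    refine IsAlgClosed.exists_root _ ?_
    have h1 : q.natDegree ≠ 0 := by
      rw [hdeg]
      exact hirr.natDegree_pos.ne'
    rw [hq.degree_map, Polynomial.degree_eq_natDegree hq.ne_zero]
    exact_mod_cast h1
  choose x hx using hroot
  refine ⟨φ x, ?_⟩
  have : q.eval x = 0 := by
    funext i
    have h1 := hx i
    rw [Polynomial.eval_map] at h1
    have h2 := Polynomial.hom_eval₂ q (RingHom.id _) (Pi.evalRingHom k i) x
    rw [Polynomial.eval₂_id] at h2
    exact h2.trans h1
  rw [Polynomial.eval_map, Polynomial.eval₂_hom, this, map_zero]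

/-- The avoidance hypotheses pass to K by `exists_coord`, since a nontrivial zero over K would give
one in some coordinate. The characteristic-zero theorem then supplies linear forms over K. Their
lifts must work in some coordinate: otherwise the bad pairs of all coordinates assemble to a bad
pair over K. -/
theorem exists_avoids_of_surjective_pi [∀ i, IsAlgClosed (k i)] [CharZero K]
    (hφ : Function.Surjective φ)
    {E : ∀ i, Fin r → MvPolynomial (Fin n) (k i)} {G : ∀ i, MvPolynomial (Fin n) (k i)}
    {e : Fin r → ℕ} {g : ℕ} (hE : ∀ i j, (E i j).IsHomogeneous (e j))
    (hG : ∀ i, (G i).IsHomogeneous g) (hg : 2 ≤ g) {m : ℕ} {c c' : ∀ i, Fin m → Fin n → k i}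
    (hc : ∀ i, Misses {x | grad (G i) x = 0} (c i)) (hc' : ∀ i, Misses {x | JacSing (E i) x} (c' i))
    {a b : ℕ} (hab : a + b + 1 = n + m) :
    ∃ i, ∃ (u : Fin a → Fin n → k i) (w : Fin b → Fin n → k i), Avoids (E i) (G i) u w := by
  have := isAlgClosed_of_surjective_pi φ hφ
  choose E' hE' hmapE using fun j => exists_map_eval_eq (fun i => E i j) fun i => hE i j
  obtain ⟨G', hG', hmapG⟩ := exists_map_eval_eq G hG
  have hmapE' : ∀ i, (fun j => map (Pi.evalRingHom k i) (E' j)) = E i := fun i =>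
    funext fun j => hmapE j i
  have hdot : ∀ (i : ι) (u x : Fin n → ∀ i, k i),
      (u ⬝ᵥ x) i = (fun l => u l i) ⬝ᵥ fun l => x l i := by
    intro i u x
    simp [dotProduct, Finset.sum_apply]
  have hdotφ : ∀ (u x : Fin n → ∀ i, k i),
      φ (u ⬝ᵥ x) = (fun l => φ (u l)) ⬝ᵥ fun l => φ (x l) := by
    intro u x
    simp [dotProduct]
  have hmiss : Misses {x | grad (map φ G') x = 0} fun j l => φ fun i => c i j l := by
    intro x hx hcx
    choose y hy using fun l => hφ (x l)
    obtain rfl : φ ∘ y = x := funext hy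
    by_contra hne
    obtain ⟨l, hl⟩ := Function.ne_iff.1 hne
    obtain ⟨i, hi, hli⟩ := exists_coord φ (s := Fin n ⊕ Fin m)
      (Sum.elim (fun q => grad G' y q) fun j => (fun l i => c i j l) ⬝ᵥ y) (y l) (by
        rintro (q | j)
        · rw [Sum.elim_inl, map_grad]
          exact congrFun hx q
        · rw [Sum.elim_inr, hdotφ]
          exact hcx j) hl
    have h0 : (fun l => y l i) = 0 := by
      refine hc i _ (funext fun q => ?_) fun j => ?_
      · have this : Pi.evalRingHom k i (grad G' y q) = 0 := hi (.inl q)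
        rw [map_grad, hmapG] at this
        exact this
      · have := hi (.inr j)
        rw [Sum.elim_inr, hdot] at this
        exact this
    exact hli (congrFun h0 l)
  have hmiss' : Misses {x | JacSing (fun j => map φ (E' j)) x} fun j l => φ fun i => c' i j l := by
    intro x hx hcx
    choose y hy using fun l => hφ (x l)
    obtain rfl : φ ∘ y = x := funext hy
    by_contra hne
    obtain ⟨l, hl⟩ := Function.ne_iff.1 hne
    obtain ⟨i, hi, hli⟩ := exists_coord φ (s := (Fin r ⊕ (Fin r → Fin n)) ⊕ Fin m)
      (Sum.elim (Sum.elim (fun j => eval y (E' j))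
        fun q => ((jacobian E' y).submatrix id q).det) fun j => (fun l i => c' i j l) ⬝ᵥ y) (y l) (by
        rintro ((j | q) | j)
        · simp only [Sum.elim_inl, map_eval_apply]
          exact hx.1 j
        · simp only [Sum.elim_inl, Sum.elim_inr, map_minor, map_jacobian]
          exact hx.2 q
        · rw [Sum.elim_inr, hdotφ]
          exact hcx j) hl
    have h0 : (fun l => y l i) = 0 := by
      refine hc' i _ ⟨fun j => ?_, fun q => ?_⟩ fun j => ?_
      · have this : Pi.evalRingHom k i (eval y (E' j)) = 0 := hi (.inl (.inl j))
        rw [map_eval_apply, hmapE] at this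
        exact this
      · have this : Pi.evalRingHom k i ((jacobian E' y).submatrix id q).det = 0 :=
          hi (.inl (.inr q))
        rw [map_minor, map_jacobian, hmapE'] at this
        exact this
      · have := hi (.inr j)
        rw [Sum.elim_inr, hdot] at this
        exact this
    exact hli (congrFun h0 l)
  obtain ⟨u, w, huw⟩ := exists_avoids_of_charZero (fun j => (hE' j).map φ) (hG'.map φ) hg
    hmiss hmiss' hab
  choose u' hu' using fun j l => hφ (u j l)
  choose w' hw' using fun j l => hφ (w j l)
  by_contra! hcon
  have hcon' := fun i => hcon i (fun j l => u' j l i) (fun j l => w' j l i)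
  simp only [Avoids, not_forall] at hcon'
  choose x z hx hz hcrit hux hwz _ using hcon'
  -- Which entry is nonzero may vary with the coordinate. Being nonzero is therefore encoded by the
  -- equation y · x = 1, which survives φ.
  have hone : ∀ i (x : Fin n → k i), x ≠ 0 → ∃ y : Fin n → k i, y ⬝ᵥ x = 1 := by
    classical
    intro i x hx
    obtain ⟨l, hl⟩ := Function.ne_iff.1 hx
    exact ⟨Pi.single l (x l)⁻¹, by simpa using inv_mul_cancel₀ hl⟩
  have hne : ∀ x : ∀ i, Fin n → k i, (∀ i, x i ≠ 0) → (fun l => φ fun i => x i l) ≠ 0 := by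
    intro x hx h0
    choose y hy using fun i => hone i (x i) (hx i)
    have h1 : ((fun l i => y i l) ⬝ᵥ fun l i => x i l : ∀ i, k i) = 1 := by
      funext i
      rw [hdot]
      exact hy i
    have h2 := congrArg φ h1
    rw [hdotφ, h0, dotProduct_zero, map_one] at h2
    exact zero_ne_one h2
  have hcritR : Crit E' G' (fun l i => x i l) (fun l i => z i l) := by
    refine ⟨fun j => funext fun i => ?_, fun q => funext fun i => ?_⟩
    · suffices h : Pi.evalRingHom k i (eval (fun l i => x i l) (E' j)) = 0 from h
      rw [map_eval_apply, hmapE]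
      exact (hcrit i).1 j
    · suffices h : Pi.evalRingHom k i ((augJacobian E' G' (fun l i => x i l)
          (fun l i => z i l)).submatrix id q).det = 0 from h
      rw [map_minor, map_augJacobian, hmapE', hmapG]
      exact (hcrit i).2 q
  refine huw _ _ (hne x hx) (hne z hz) (hcritR.map φ) (fun j => ?_) fun j => ?_
  · have h1 : (u' j ⬝ᵥ fun l i => x i l) = 0 := by
      funext i
      rw [hdot]
      exact hux i j
    have h2 := congrArg φ h1
    rw [hdotφ, map_zero] at h2
    simpa only [hu'] using h2
  · have h1 : (w' j ⬝ᵥ fun l i => z i l) = 0 := by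
      funext i
      rw [hdot]
      exact hwz i j
    have h2 := congrArg φ h1
    rw [hdotφ, map_zero] at h2
    simpa only [hw'] using h2

end Ultraproduct

/-- The conclusion of `exists_avoids_of_charZero` holds in all sufficiently large
characteristics. -/
theorem exists_avoids_of_large_prime (n : ℕ) {r : ℕ} (e : Fin r → ℕ) {g : ℕ} (hg : 2 ≤ g)
    (m a b : ℕ) (hab : a + b + 1 = n + m) :
    ∃ N : ℕ, ∀ (p : ℕ) [Fact p.Prime], N < p →
      ∀ (E : Fin r → MvPolynomial (Fin n) (AlgebraicClosure (ZMod p)))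
        (G : MvPolynomial (Fin n) (AlgebraicClosure (ZMod p))),
        (∀ j, (E j).IsHomogeneous (e j)) → G.IsHomogeneous g →
        ∀ c c' : Fin m → Fin n → AlgebraicClosure (ZMod p),
        Misses {x | grad G x = 0} c → Misses {x | JacSing E x} c' →
        ∃ (u : Fin a → Fin n → AlgebraicClosure (ZMod p))
          (w : Fin b → Fin n → AlgebraicClosure (ZMod p)), Avoids E G u w := by
  classical
  by_contra! hcon
  choose q hq hlt E G hE hG c c' hc hc' hno using hcon
  let k : ℕ → Type := fun i => AlgebraicClosure (ZMod (q i))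
  -- The families of finite support. A maximal ideal containing J ignores any finite set of
  -- coordinates.
  let J : Ideal (∀ i, k i) :=
    { carrier := {f | {i | f i ≠ 0}.Finite}
      zero_mem' := by simp
      add_mem' := fun {f h} hf hh => (hf.union hh).subset fun i hi => by
        by_contra hne
        simp only [Set.mem_union, Set.mem_ofPred_eq, not_or, not_not] at hne
        exact hi (by rw [Pi.add_apply, hne.1, hne.2, add_zero])
      smul_mem' := fun f h hh => hh.subset fun i hi h0 => hi (by
        rw [smul_eq_mul, Pi.mul_apply, h0, mul_zero]) }
  have hJ : J ≠ ⊤ := fun h => by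
    have h1 : (1 : ∀ i, k i) ∈ J := h ▸ Submodule.mem_top
    exact Set.infinite_univ (h1.subset fun i _ => one_ne_zero)
  obtain ⟨M, hM, hJM⟩ := Ideal.exists_le_maximal J hJ
  let := Ideal.Quotient.field M
  -- A positive integer N is invertible in every coordinate i ≥ N, because i < q i; so it is
  -- invertible modulo J.
  have hchar : CharZero ((∀ i, k i) ⧸ M) := by
    refine charZero_of_inj_zero fun N hN => ?_
    by_contra hN0
    have h1 : ((N : ∀ i, k i)) ∈ M := by
      rw [← Ideal.Quotient.eq_zero_iff_mem, map_natCast]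
      exact hN
    have hcoord : ∀ i, N < q i → ((N : ℕ) : k i) ≠ 0 := by
      intro i hi h0
      have : CharP (k i) (q i) := charP_of_injective_algebraMap
        (algebraMap (ZMod (q i)) (k i)).injective (q i)
      rw [CharP.cast_eq_zero_iff (k i) (q i)] at h0
      exact absurd (Nat.le_of_dvd (Nat.pos_of_ne_zero hN0) h0) (not_le.2 hi)
    let inv : ∀ i, k i := fun i => ((N : ℕ) : k i)⁻¹
    have h2 : 1 - (N : ∀ i, k i) * inv ∈ J := by
      refine (Set.finite_Iio N).subset fun i hi => ?_
      by_contra hNi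
      apply hi
      have hni : N < q i := lt_of_le_of_lt (not_lt.1 hNi) (hlt i)
      simp [inv, mul_inv_cancel₀ (hcoord i hni)]
    have h3 : (1 : ∀ i, k i) ∈ M := by
      have := M.add_mem (hJM h2) (M.mul_mem_right inv h1)
      rwa [sub_add_cancel] at this
    exact hM.ne_top ((Ideal.eq_top_iff_one M).2 h3)
  obtain ⟨i, u, w, huw⟩ := exists_avoids_of_surjective_pi (Ideal.Quotient.mk M)
    Ideal.Quotient.mk_surjective hE hG hg hc hc' hab
  exact hno i u w huw

/-! ### The Jacobian criterion in a local ring with a rational point -/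

section TangentData

open IsLocalRing

/-- A rational point of the spectrum of a `k`-algebra `L`, with local parameters `t` and the
corresponding partial derivatives at the point. -/
structure TangentData (k σ L : Type*) [Field k] [Fintype σ] [DecidableEq σ] [CommRing L]
    [Algebra k L] where
  /-- evaluation at the point -/
  ev : L →ₐ[k] k
  /-- the gradient at the point -/
  D : L →ₗ[k] (σ → k)
  leibniz : ∀ a b, D (a * b) = ev a • D b + ev b • D a
  /-- the local parameters -/
  t : σ → L
  ker_ev : RingHom.ker ev = Ideal.span (Set.range t)
  D_t : ∀ j, D (t j) = Pi.single j 1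

namespace TangentData

variable {k σ L : Type*} [Field k] [Fintype σ] [DecidableEq σ] [CommRing L] [Algebra k L]
  (τ : TangentData k σ L)

lemma ker_eq_maximalIdeal [IsLocalRing L] : RingHom.ker τ.ev = maximalIdeal L :=
  IsLocalRing.eq_maximalIdeal (RingHom.ker_isMaximal_of_surjective τ.ev
    (fun c => ⟨algebraMap k L c, by simp⟩))

lemma mem_maximalIdeal_iff [IsLocalRing L] {a : L} : a ∈ maximalIdeal L ↔ τ.ev a = 0 := by
  rw [← τ.ker_eq_maximalIdeal, RingHom.mem_ker]

lemma D_mul_of_ev_eq_zero {a g : L} (hg : τ.ev g = 0) : τ.D (a * g) = τ.ev a • τ.D g := by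
  rw [τ.leibniz, hg, zero_smul, add_zero]

lemma D_mem_of_mem_span {S : Set L} {W : Submodule k (σ → k)} (hS : ∀ g ∈ S, τ.ev g = 0)
    (hW : ∀ g ∈ S, τ.D g ∈ W) {a : L} (ha : a ∈ Ideal.span S) : τ.D a ∈ W := by
  have h : τ.ev a = 0 ∧ τ.D a ∈ W := by
    induction ha using Submodule.span_induction with
    | mem x hx => exact ⟨hS x hx, hW x hx⟩
    | zero => simp
    | add x y _ _ hx hy =>
      exact ⟨by rw [map_add, hx.1, hy.1, add_zero], by rw [map_add]; exact W.add_mem hx.2 hy.2⟩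
    | smul c x _ hx =>
      refine ⟨by rw [smul_eq_mul, map_mul, hx.1, mul_zero], ?_⟩
      rw [smul_eq_mul, τ.D_mul_of_ev_eq_zero hx.1]
      exact W.smul_mem _ hx.2
  exact h.2

/-- On the maximal ideal, multiplication by a scales the gradient by the value of a. Gradients of
any generators hence span those of the parameters, which form the standard basis. -/
lemma top_le_of_D_mem {S : Set L} {W : Submodule k (σ → k)} (hS : ∀ g ∈ S, τ.ev g = 0)
    (hW : ∀ g ∈ S, τ.D g ∈ W) (h : RingHom.ker τ.ev ≤ Ideal.span S) : W = ⊤ := by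
  rw [eq_top_iff, ← (Pi.basisFun k σ).span_eq, Submodule.span_le]
  rintro _ ⟨j, rfl⟩
  rw [Pi.basisFun_apply, ← τ.D_t j]
  refine τ.D_mem_of_mem_span hS hW (h ?_)
  rw [τ.ker_ev]
  exact Ideal.subset_span ⟨j, rfl⟩

/-- Write a as a combination of the parameters. Its gradient lists the values of the coefficients at
the point, so these all lie in the maximal ideal. -/
lemma mem_sq_of_D_eq_zero {a : L} (ha : τ.ev a = 0) (hD : τ.D a = 0) :
    a ∈ (RingHom.ker τ.ev) ^ 2 := by
  have ha' : a ∈ Ideal.span (Set.range τ.t) := by rw [← τ.ker_ev]; exact ha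
  obtain ⟨c, rfl⟩ := (Ideal.mem_span_range_iff_exists_fun).1 ha'
  have ht : ∀ j, τ.ev (τ.t j) = 0 := fun j => by
    have : τ.t j ∈ RingHom.ker τ.ev := by rw [τ.ker_ev]; exact Ideal.subset_span ⟨j, rfl⟩
    exact this
  rw [pow_two]
  refine Ideal.sum_mem _ fun j _ => Ideal.mul_mem_mul ?_ (ht j)
  rw [RingHom.mem_ker]
  have := congrFun hD j
  rw [map_sum, Finset.sum_apply, Pi.zero_apply] at this
  rw [← this, Finset.sum_eq_single j]
  · rw [τ.D_mul_of_ev_eq_zero (ht j), τ.D_t]; simp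
  · intro i _ hij
    rw [τ.D_mul_of_ev_eq_zero (ht i), τ.D_t]; simp [Pi.single_eq_of_ne hij.symm]
  · simp

lemma span_ne_top [IsLocalRing L] {S : Set L} (hS : ∀ g ∈ S, τ.ev g = 0) : Ideal.span S ≠ ⊤ := by
  refine ne_top_of_le_ne_top (IsLocalRing.maximalIdeal.isMaximal L).ne_top
    (Ideal.span_le.2 fun g hg => τ.mem_maximalIdeal_iff.2 (hS g hg))

lemma isLocalRing_quotient [IsLocalRing L] {S : Set L} (hS : ∀ g ∈ S, τ.ev g = 0) :
    IsLocalRing (L ⧸ Ideal.span S) := by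
  have := Ideal.Quotient.nontrivial_iff.2 (τ.span_ne_top hS)
  exact IsLocalRing.of_surjective' _ Ideal.Quotient.mk_surjective

variable [IsLocalRing L] [IsNoetherianRing L]

/-- Lower bound for the embedding dimension of a quotient: lifts of generators of its maximal ideal,
together with S, generate the maximal ideal upstairs, so their gradients span everything. It is used
to disprove regularity. -/
lemma card_le_spanFinrank_add {S : Set L} (hS : ∀ g ∈ S, τ.ev g = 0) {W : Submodule k (σ → k)}
    (hW : ∀ g ∈ S, τ.D g ∈ W) [IsLocalRing (L ⧸ Ideal.span S)] :
    Fintype.card σ ≤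
      (maximalIdeal (L ⧸ Ideal.span S)).spanFinrank + Module.finrank k W := by
  classical
  obtain ⟨s, hs, hs'⟩ := (IsNoetherian.noetherian
    (maximalIdeal (L ⧸ Ideal.span S))).exists_span_finset_card_eq_spanFinrank
  choose l hl using Ideal.Quotient.mk_surjective (I := Ideal.span S)
  have hloc : IsLocalHom (Ideal.Quotient.mk (Ideal.span S)) :=
    IsLocalHom.of_surjective _ Ideal.Quotient.mk_surjective
  have hmax : (maximalIdeal (L ⧸ Ideal.span S)).comap (Ideal.Quotient.mk (Ideal.span S)) =
      maximalIdeal L := IsLocalRing.maximalIdeal_comap _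
  have hl0 : ∀ g ∈ s, τ.ev (l g) = 0 := fun g hg => by
    rw [← τ.mem_maximalIdeal_iff, ← hmax, Ideal.mem_comap, hl, ← hs']
    exact Ideal.subset_span hg
  have key := τ.top_le_of_D_mem (S := (s.image l : Finset L) ∪ S)
    (W := Submodule.span k ((s.image (τ.D ∘ l) : Finset (σ → k)) : Set (σ → k)) ⊔ W) ?_ ?_ ?_
  · calc Fintype.card σ = Module.finrank k (⊤ : Submodule k (σ → k)) := by simp
      _ ≤ _ := by
        rw [← key]
        refine (Submodule.finrank_add_le_finrank_add_finrank _ _).trans ?_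
        gcongr
        refine (finrank_span_finset_le_card _).trans (Finset.card_image_le.trans hs.le)
  · rintro g (hg | hg)
    · obtain ⟨g, hg', rfl⟩ := Finset.mem_image.1 (Finset.mem_coe.1 hg)
      exact hl0 g hg'
    · exact hS g hg
  · rintro g (hg | hg)
    · obtain ⟨g, hg', rfl⟩ := Finset.mem_image.1 (Finset.mem_coe.1 hg)
      refine Submodule.mem_sup_left (Submodule.subset_span ?_)
      exact Finset.mem_coe.2 (Finset.mem_image.2 ⟨g, hg', rfl⟩)
    · exact Submodule.mem_sup_right (hW g hg)
  · rw [Ideal.span_union, τ.ker_eq_maximalIdeal, ← hmax]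
    intro a ha
    rw [Ideal.mem_comap, ← hs'] at ha
    have : Ideal.span (s : Set (L ⧸ Ideal.span S)) ≤
        (Ideal.span ((s.image l : Finset L) : Set L)).map (Ideal.Quotient.mk (Ideal.span S)) := by
      rw [Ideal.span_le]
      intro g hg
      rw [← hl g]
      refine Ideal.mem_map_of_mem _ (Ideal.subset_span ?_)
      exact Finset.mem_coe.2 (Finset.mem_image.2 ⟨g, hg, rfl⟩)
    obtain ⟨b, hb, hab⟩ := (Ideal.mem_map_iff_of_surjective _ Ideal.Quotient.mk_surjective).1
      (this ha)
    rw [Ideal.Quotient.mk_eq_mk_iff_sub_mem] at hab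
    rw [show a = b - (b - a) by ring]
    exact Ideal.sub_mem _ (Ideal.mem_sup_left hb) (Ideal.mem_sup_right hab)

lemma spanFinrank_maximalIdeal (τ : TangentData k σ L) :
    (maximalIdeal L).spanFinrank = Fintype.card σ := by
  refine le_antisymm ?_ ?_
  · rw [← τ.ker_eq_maximalIdeal, τ.ker_ev]
    refine (Submodule.spanFinrank_span_le_ncard_of_finite (Set.finite_range _)).trans ?_
    rw [← Set.image_univ]
    refine (Set.ncard_image_le Set.finite_univ).trans ?_
    rw [Set.ncard_univ, Nat.card_eq_fintype_card]
  · obtain ⟨s, hs, hs'⟩ := (IsNoetherian.noetherian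
      (maximalIdeal L)).exists_span_finset_card_eq_spanFinrank
    classical
    have hs0 : ∀ g ∈ (s : Set L), τ.ev g = 0 := fun g hg => by
      rw [← τ.mem_maximalIdeal_iff, ← hs']
      exact Ideal.subset_span hg
    have key := τ.top_le_of_D_mem (S := s)
      (W := Submodule.span k ((s.image τ.D : Finset (σ → k)) : Set (σ → k))) hs0
      (fun g hg => Submodule.subset_span (Finset.mem_coe.2 (Finset.mem_image.2 ⟨g, hg, rfl⟩)))
      (by rw [τ.ker_eq_maximalIdeal]; exact hs'.ge)
    calc Fintype.card σ = Module.finrank k (⊤ : Submodule k (σ → k)) := by simp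
      _ ≤ _ := by
        rw [← key]
        exact (finrank_span_finset_le_card _).trans (Finset.card_image_le.trans hs.le)

/-- Upper bound for the embedding dimension: complete the gradients of f to a spanning set by
combinations g of the parameters. Then f and g generate the maximal ideal modulo its square, hence
generate it by Nakayama, and the g alone generate it in the quotient. -/
lemma spanFinrank_add_card_le {ι : Type*} [Fintype ι] {f : ι → L} (hf : ∀ j, τ.ev (f j) = 0)
    (hD : LinearIndependent k fun j => τ.D (f j)) [IsLocalRing (L ⧸ Ideal.span (Set.range f))] :
    (maximalIdeal (L ⧸ Ideal.span (Set.range f))).spanFinrank + Fintype.card ι ≤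
      Fintype.card σ := by
  classical
  set W := Submodule.span k (Set.range fun j => τ.D (f j)) with hWdef
  have hWr : Module.finrank k W = Fintype.card ι := finrank_span_eq_card hD
  have hq : Module.finrank k ((σ → k) ⧸ W) + Fintype.card ι = Fintype.card σ := by
    rw [← hWr, Submodule.finrank_quotient_add_finrank]; simp
  let b := Module.finBasis k ((σ → k) ⧸ W)
  choose w hw using fun i => Submodule.mkQ_surjective W (b i)
  let g : Fin (Module.finrank k ((σ → k) ⧸ W)) → L := fun i => ∑ j, w i j • τ.t j
  have hev : ∀ i, τ.ev (g i) = 0 := fun i => by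
    have : g i ∈ RingHom.ker τ.ev := by
      rw [τ.ker_ev]
      refine Ideal.sum_mem _ fun j _ => ?_
      rw [Algebra.smul_def]
      exact Ideal.mul_mem_left _ _ (Ideal.subset_span ⟨j, rfl⟩)
    exact this
  have hDg : ∀ i, τ.D (g i) = w i := fun i => by
    simp only [g, map_sum, map_smul, τ.D_t]
    ext l
    simp [Finset.sum_apply, Pi.single_apply]
  have h1 : maximalIdeal L ≤ (Ideal.span (Set.range g) ⊔ Ideal.span (Set.range f)) ⊔
      maximalIdeal L * maximalIdeal L := by
    intro a ha
    have hmem : τ.D a - ∑ i, b.repr (W.mkQ (τ.D a)) i • w i ∈ W := by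
      rw [← Submodule.Quotient.mk_eq_zero, ← Submodule.mkQ_apply, map_sub, map_sum, sub_eq_zero]
      conv_lhs => rw [← b.sum_repr (W.mkQ (τ.D a))]
      exact Finset.sum_congr rfl fun i _ => by rw [map_smul, hw]
    obtain ⟨c, hc⟩ := (Submodule.mem_span_range_iff_exists_fun k).1 hmem
    set a' := ∑ i, b.repr (W.mkQ (τ.D a)) i • g i
    set a'' := ∑ j, c j • f j
    have h0 : a' ∈ Ideal.span (Set.range g) := Ideal.sum_mem _ fun i _ => by
      rw [Algebra.smul_def]
      exact Ideal.mul_mem_left _ _ (Ideal.subset_span ⟨i, rfl⟩)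
    have h0' : a'' ∈ Ideal.span (Set.range f) := Ideal.sum_mem _ fun i _ => by
      rw [Algebra.smul_def]
      exact Ideal.mul_mem_left _ _ (Ideal.subset_span ⟨i, rfl⟩)
    have h2 : a - (a' + a'') ∈ (RingHom.ker τ.ev) ^ 2 := by
      apply τ.mem_sq_of_D_eq_zero
      · simp [a', a'', hev, hf, τ.mem_maximalIdeal_iff.1 ha]
      · simp only [a', a'', map_sub, map_add, map_sum, map_smul, hDg, hc]
        abel
    rw [τ.ker_eq_maximalIdeal, pow_two] at h2
    rw [show a = (a' + a'') + (a - (a' + a'')) by ring]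
    exact Ideal.add_mem _ (Ideal.mem_sup_left
      (Ideal.add_mem _ (Ideal.mem_sup_left h0) (Ideal.mem_sup_right h0'))) (Ideal.mem_sup_right h2)
  have h2 : maximalIdeal L ≤ Ideal.span (Set.range g) ⊔ Ideal.span (Set.range f) :=
    Submodule.le_of_le_smul_of_le_jacobson_bot (IsNoetherian.noetherian _)
      (IsLocalRing.maximalIdeal_le_jacobson _) h1
  have hloc : IsLocalHom (Ideal.Quotient.mk (Ideal.span (Set.range f))) :=
    IsLocalHom.of_surjective _ Ideal.Quotient.mk_surjective
  have hmax : (maximalIdeal (L ⧸ Ideal.span (Set.range f))).comap (Ideal.Quotient.mk _) =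
      maximalIdeal L := IsLocalRing.maximalIdeal_comap _
  have h3 : maximalIdeal (L ⧸ Ideal.span (Set.range f)) =
      Ideal.span ((Finset.univ.image fun i => Ideal.Quotient.mk (Ideal.span (Set.range f)) (g i) :
        Finset _) : Set (L ⧸ Ideal.span (Set.range f))) := by
    refine le_antisymm ?_ ?_
    · intro a ha
      obtain ⟨a, rfl⟩ := Ideal.Quotient.mk_surjective a
      have ha' : a ∈ maximalIdeal L := by rw [← hmax]; exact ha
      obtain ⟨x, hx, y, hy, rfl⟩ := Submodule.mem_sup.1 (h2 ha')
      rw [map_add, Ideal.Quotient.eq_zero_iff_mem.2 hy, add_zero]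
      have := Ideal.mem_map_of_mem (Ideal.Quotient.mk (Ideal.span (Set.range f))) hx
      rw [Ideal.map_span, ← Set.range_comp] at this
      simpa [Function.comp_def] using this
    · rw [Ideal.span_le]
      intro a ha
      obtain ⟨i, _, rfl⟩ := Finset.mem_image.1 (Finset.mem_coe.1 ha)
      have : g i ∈ maximalIdeal L := τ.mem_maximalIdeal_iff.2 (hev i)
      rw [← hmax] at this
      exact this
  have h4 : (maximalIdeal (L ⧸ Ideal.span (Set.range f))).spanFinrank ≤
      Module.finrank k ((σ → k) ⧸ W) := by
    rw [h3]
    refine (Submodule.spanFinrank_span_le_ncard_of_finite (Finset.finite_toSet _)).trans ?_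
    rw [Set.ncard_coe_finset]
    exact Finset.card_image_le.trans (by simp)
  omega

end TangentData

namespace TangentData

variable {k σ L : Type*} [Field k] [Fintype σ] [DecidableEq σ] [CommRing L] [Algebra k L]
  (τ : TangentData k σ L) [IsRegularLocalRing L]

lemma ringKrullDim_eq (τ : TangentData k σ L) : ringKrullDim L = (Fintype.card σ : ℕ) := by
  rw [← IsRegularLocalRing.spanFinrank_maximalIdeal, τ.spanFinrank_maximalIdeal]

/-- The Jacobian criterion: independent gradients cut out a regular scheme. -/
lemma isRegularLocalRing_quotient {ι : Type*} [Fintype ι] {f : ι → L} (hf : ∀ j, τ.ev (f j) = 0)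
    (hD : LinearIndependent k fun j => τ.D (f j)) :
    IsRegularLocalRing (L ⧸ Ideal.span (Set.range f)) := by
  classical
  have hS : ∀ g ∈ Set.range f, τ.ev g = 0 := by rintro _ ⟨j, rfl⟩; exact hf j
  have := τ.isLocalRing_quotient hS
  apply IsRegularLocalRing.of_spanFinrank_maximalIdeal_le
  have h1 := τ.spanFinrank_add_card_le hf hD
  have h2 := ringKrullDim_le_ringKrullDim_quotient_add_card (Finset.univ.image f) (by
    intro g hg
    rw [Finset.coe_image, Finset.coe_univ, Set.image_univ] at hg
    rw [SetLike.mem_coe, IsLocalRing.ringJacobson_eq_maximalIdeal]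
    exact τ.mem_maximalIdeal_iff.2 (hS g hg))
  rw [Finset.coe_image, Finset.coe_univ, Set.image_univ, τ.ringKrullDim_eq] at h2
  have h3 : (Finset.univ.image f).card ≤ Fintype.card ι := Finset.card_image_le
  obtain ⟨m, hm⟩ : ∃ m : ℕ, ringKrullDim (L ⧸ Ideal.span (Set.range f)) = m := by
    have a1 : ringKrullDim (L ⧸ Ideal.span (Set.range f)) ≠ ⊥ := ringKrullDim_ne_bot
    have a2 := ringKrullDim_quotient_le (Ideal.span (Set.range f))
    rw [τ.ringKrullDim_eq] at a2
    generalize ringKrullDim (L ⧸ Ideal.span (Set.range f)) = x at a1 a2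
    induction x with
    | bot => exact absurd rfl a1
    | coe x =>
      induction x with
      | top =>
        have a3 : (⊤ : ℕ∞) ≤ (Fintype.card σ : ℕ∞) := WithBot.coe_le_coe.1 a2
        exact absurd (top_le_iff.1 a3) (ENat.natCast_ne_top _)
      | coe m => exact ⟨m, rfl⟩
  rw [hm] at h2 ⊢
  have h4 : Fintype.card σ ≤ m + (Finset.univ.image f).card := by exact_mod_cast h2
  exact_mod_cast (by omega : _ ≤ m)

/-- A hypersurface is singular where its gradient vanishes. -/
lemma not_isRegularLocalRing_quotient_singleton [IsDomain L] {f : L} (hf0 : f ≠ 0)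
    (hf : τ.ev f = 0) (hD : τ.D f = 0) : ¬ IsRegularLocalRing (L ⧸ Ideal.span {f}) := by
  intro h
  have h1 := τ.card_le_spanFinrank_add (S := {f}) (W := ⊥) (by simpa using hf) (by simpa using hD)
  have h2 := ringKrullDim_quotient_succ_le_of_nonZeroDivisor (mem_nonZeroDivisors_of_ne_zero hf0)
  rw [← h.spanFinrank_maximalIdeal, τ.ringKrullDim_eq] at h2
  have h3 : (maximalIdeal (L ⧸ Ideal.span {f})).spanFinrank + 1 ≤ Fintype.card σ := by
    exact_mod_cast h2
  rw [finrank_bot] at h1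
  omega

/-- A complete intersection of codimension two is singular where the gradients are dependent. -/
lemma not_isRegularLocalRing_quotient_pair [IsDomain L] [UniqueFactorizationMonoid L] {f g : L}
    (hf : τ.ev f = 0) (hg : τ.ev g = 0) (hDf : τ.D f ≠ 0) (hDg : ∃ c : k, τ.D g = c • τ.D f)
    (hfg : ¬ f ∣ g) : ¬ IsRegularLocalRing (L ⧸ Ideal.span {f, g}) := by
  intro h
  have hf0 : f ≠ 0 := by rintro rfl; simp at hDf
  have hfu : ¬ IsUnit f := fun hu => by
    have := hu.map τ.ev
    rw [hf] at this
    exact not_isUnit_zero this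
  -- A product of two non-units has zero gradient. With unique factorisation f is therefore prime,
  -- so g is a nonzero element of the domain L/(f); each of the two equations lowers the dimension,
  -- while the embedding dimension drops by at most one.
  have hirr : Irreducible f := by
    refine ⟨hfu, fun a b hab => ?_⟩
    by_contra! hcon
    have ha : τ.ev a = 0 := τ.mem_maximalIdeal_iff.1 ((mem_maximalIdeal a).2 hcon.1)
    have hb : τ.ev b = 0 := τ.mem_maximalIdeal_iff.1 ((mem_maximalIdeal b).2 hcon.2)
    apply hDf
    rw [hab, τ.leibniz, ha, hb]
    simp
  have hprime : (Ideal.span {f}).IsPrime :=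
    (Ideal.span_singleton_prime hf0).2 hirr.prime
  have h1 := τ.card_le_spanFinrank_add (S := {f, g}) (W := Submodule.span k {τ.D f})
    (by rintro _ (rfl | rfl) <;> assumption) (by
      rintro _ (rfl | rfl)
      · exact Submodule.mem_span_singleton_self _
      · exact Submodule.mem_span_singleton.2 (hDg.imp fun _ h => h.symm))
  have h2 := ringKrullDim_quotient_succ_le_of_nonZeroDivisor (mem_nonZeroDivisors_of_ne_zero hf0)
  have hg0 : Ideal.Quotient.mk (Ideal.span {f}) g ≠ 0 := by
    rwa [Ne, Ideal.Quotient.eq_zero_iff_mem, Ideal.mem_span_singleton]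
  have h3 := ringKrullDim_quotient_succ_le_of_nonZeroDivisor (mem_nonZeroDivisors_of_ne_zero hg0)
  have e : ((L ⧸ Ideal.span {f}) ⧸ Ideal.span {Ideal.Quotient.mk (Ideal.span {f}) g}) ≃+*
      (L ⧸ Ideal.span {f, g}) :=
    (Ideal.quotEquivOfEq (by rw [Ideal.map_span, Set.image_singleton])).trans
      ((DoubleQuot.quotQuotEquivQuotSup (Ideal.span {f}) (Ideal.span {g})).trans
        (Ideal.quotEquivOfEq (by rw [← Ideal.span_union, Set.singleton_union])))
  rw [ringKrullDim_eq_of_ringEquiv e, ← h.spanFinrank_maximalIdeal] at h3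
  have h4 : ((maximalIdeal (L ⧸ Ideal.span {f, g})).spanFinrank : WithBot ℕ∞) + 1 + 1 ≤
      ringKrullDim L := (add_le_add_left h3 1).trans h2
  rw [τ.ringKrullDim_eq] at h4
  have h5 : (maximalIdeal (L ⧸ Ideal.span {f, g})).spanFinrank + 1 + 1 ≤ Fintype.card σ := by
    exact_mod_cast h4
  have h6 : Module.finrank k (Submodule.span k {τ.D f}) ≤ 1 := by
    simpa using finrank_span_le_card (R := k) ({τ.D f} : Set (σ → k))
  omega

end TangentData

end TangentData

/-! ### Local rings of affine space at rational points -/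

section AffinePoint

variable {k σ : Type*} [Field k]

lemma fst_aeval_trivSqZeroExt {ι M : Type*} [AddCommGroup M] [Module k M] [Module kᵐᵒᵖ M]
    [IsCentralScalar k M] (v : ι → k) (m : ι → M) (f : MvPolynomial ι k) :
    (aeval (fun j => TrivSqZeroExt.inl (v j) + TrivSqZeroExt.inr (m j) : ι → TrivSqZeroExt k M)
      f).fst = eval v f := by
  have : (TrivSqZeroExt.fstHom k k M).comp
      (aeval (fun j => TrivSqZeroExt.inl (v j) + TrivSqZeroExt.inr (m j))) = aeval v := by
    ext j
    simp
  have h2 := DFunLike.congr_fun this f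
  simpa [MvPolynomial.aeval_eq_eval] using h2

lemma snd_aeval_trivSqZeroExt {ι M : Type*} [Fintype ι] [AddCommGroup M] [Module k M]
    [Module kᵐᵒᵖ M] [IsCentralScalar k M] (v : ι → k) (m : ι → M) (f : MvPolynomial ι k) :
    (aeval (fun j => TrivSqZeroExt.inl (v j) + TrivSqZeroExt.inr (m j) : ι → TrivSqZeroExt k M)
      f).snd = ∑ j, eval v (pderiv j f) • m j := by
  classical
  induction f using MvPolynomial.induction_on with
  | C a =>
    rw [← algebraMap_eq, AlgHom.commutes, TrivSqZeroExt.algebraMap_eq_inl]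
    simp
  | add p q hp hq =>
    rw [map_add, TrivSqZeroExt.snd_add, hp, hq, ← Finset.sum_add_distrib]
    exact Finset.sum_congr rfl fun j _ => by rw [map_add, map_add, add_smul]
  | mul_X p i hp =>
    rw [map_mul, TrivSqZeroExt.snd_mul, fst_aeval_trivSqZeroExt, hp, aeval_X]
    simp only [TrivSqZeroExt.snd_add, TrivSqZeroExt.snd_inl, TrivSqZeroExt.snd_inr, zero_add,
      TrivSqZeroExt.fst_add, TrivSqZeroExt.fst_inl, TrivSqZeroExt.fst_inr, add_zero,
      op_smul_eq_smul, Derivation.leibniz, smul_eq_mul, map_add, map_mul, eval_X, add_smul,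
      Finset.sum_add_distrib, Finset.smul_sum, mul_smul, pderiv_X]
    congr 1
    rw [Finset.sum_eq_single i]
    · simp
    · intro j _ hj
      simp [Pi.single_eq_of_ne hj.symm]
    · simp

lemma sub_C_mem_span_X_sub_C (v : σ → k) (f : MvPolynomial σ k) :
    f - C (eval v f) ∈ Ideal.span (Set.range fun j => X j - C (v j)) := by
  induction f using MvPolynomial.induction_on with
  | C a => simp
  | add p q hp hq =>
    have := Ideal.add_mem _ hp hq
    rw [map_add, map_add]
    convert this using 1
    ring
  | mul_X p i hp =>
    rw [map_mul, map_mul, eval_X]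
    rw [show p * X i - C (eval v p) * C (v i) = p * (X i - C (v i)) +
      C (v i) * (p - C (eval v p)) by ring]
    exact Ideal.add_mem _ (Ideal.mul_mem_left _ _ (Ideal.subset_span ⟨i, rfl⟩))
      (Ideal.mul_mem_left _ _ hp)

lemma ker_eval_eq_span (v : σ → k) :
    RingHom.ker (eval v) = Ideal.span (Set.range fun j => X j - C (v j)) := by
  refine le_antisymm (fun f hf => ?_) (Ideal.span_le.2 ?_)
  · have := sub_C_mem_span_X_sub_C v f
    rwa [(RingHom.mem_ker).1 hf, map_zero, sub_zero] at this
  · rintro _ ⟨j, rfl⟩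
    simp [RingHom.mem_ker]

variable [Fintype σ] [DecidableEq σ]

instance ker_eval_isPrime {σ : Type*} (v : σ → k) : (RingHom.ker (eval v)).IsPrime :=
  RingHom.ker_isPrime (eval v)

/-- The first-order expansion of functions regular at the point `v` of affine space. -/
def firstOrder {σ : Type*} [DecidableEq σ] (v : σ → k) :
    Localization.AtPrime (RingHom.ker (eval v)) →ₐ[k] TrivSqZeroExt k (σ → k) :=
  IsLocalization.liftAlgHom (M := (RingHom.ker (eval v)).primeCompl)
    (f := aeval fun j => TrivSqZeroExt.inl (v j) + TrivSqZeroExt.inr (Pi.single j 1)) (by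
      rintro ⟨f, hf⟩
      rw [TrivSqZeroExt.isUnit_iff_isUnit_fst, fst_aeval_trivSqZeroExt]
      exact isUnit_iff_ne_zero.2 hf)

lemma firstOrder_algebraMap {σ : Type*} [DecidableEq σ] (v : σ → k) (f : MvPolynomial σ k) :
    firstOrder v (algebraMap _ _ f) =
      aeval (fun j => TrivSqZeroExt.inl (v j) + TrivSqZeroExt.inr (Pi.single j 1)) f := by
  simp [firstOrder]

/-- The local ring of affine space at a rational point, with the coordinates as parameters. -/
def tangentDataAt (v : σ → k) :
    TangentData k σ (Localization.AtPrime (RingHom.ker (eval v))) where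
  ev := (TrivSqZeroExt.fstHom k k (σ → k)).comp (firstOrder v)
  D := (TrivSqZeroExt.sndHom k (σ → k)).comp (firstOrder v).toLinearMap
  leibniz a b := by
    simp [TrivSqZeroExt.snd_mul]
  t j := algebraMap _ _ (X j - C (v j))
  ker_ev := by
    set L := Localization.AtPrime (RingHom.ker (eval v))
    have h1 : RingHom.ker ((TrivSqZeroExt.fstHom k k (σ → k)).comp (firstOrder v)) =
        IsLocalRing.maximalIdeal L :=
      IsLocalRing.eq_maximalIdeal (RingHom.ker_isMaximal_of_surjective
        ((TrivSqZeroExt.fstHom k k (σ → k)).comp (firstOrder v))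
        (fun c => ⟨algebraMap k L c, by rw [AlgHom.commutes]; rfl⟩))
    have h2 := congrArg (Ideal.map (algebraMap (MvPolynomial σ k) L)) (ker_eval_eq_span v)
    rw [Ideal.map_span, ← Set.range_comp] at h2
    rw [h1, ← Localization.AtPrime.map_eq_maximalIdeal]
    exact h2
  D_t j := by
    simp only [LinearMap.comp_apply, AlgHom.toLinearMap_apply, firstOrder_algebraMap]
    simp [TrivSqZeroExt.algebraMap_eq_inl, ← algebraMap_eq]

lemma tangentDataAt_ev (v : σ → k) (f : MvPolynomial σ k) :
    (tangentDataAt v).ev (algebraMap _ _ f) = eval v f := by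
  rw [← fst_aeval_trivSqZeroExt v (fun j => (Pi.single j 1 : σ → k)), ← firstOrder_algebraMap]
  rfl

lemma tangentDataAt_D (v : σ → k) (f : MvPolynomial σ k) :
    (tangentDataAt v).D (algebraMap _ _ f) =
      (aeval (fun j => TrivSqZeroExt.inl (v j) + TrivSqZeroExt.inr (Pi.single j 1) :
        σ → TrivSqZeroExt k (σ → k)) f).snd := by
  rw [← firstOrder_algebraMap]
  rfl

end AffinePoint

/-! ### Comparison of the local rings of projective space and of an affine chart -/

section Chart

attribute [local instance] MvPolynomial.gradedAlgebra

variable {k : Type*} [Field k] {n : ℕ}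

/-- The affine chart `x_i ≠ 0`, scaled so that it is compatible with evaluation at `v`. -/
def dehom (v : Fin n → k) (i : Fin n) :
    MvPolynomial (Fin n) k →ₐ[k] MvPolynomial {j : Fin n // j ≠ i} k :=
  aeval fun j => if h : j = i then C (v i) else C (v i) * X ⟨j, h⟩

/-- The affine coordinates of `v` in the chart `x_i ≠ 0`. -/
def chartPoint (v : Fin n → k) (i : Fin n) : {j : Fin n // j ≠ i} → k := fun j => v j / v i

lemma eval_dehom (v : Fin n → k) (i : Fin n) (w : {j : Fin n // j ≠ i} → k)
    (f : MvPolynomial (Fin n) k) :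
    eval w (dehom v i f) = eval (fun j => if h : j = i then v i else v i * w ⟨j, h⟩) f := by
  have : (aeval w).comp (dehom v i) =
      aeval (fun j => if h : j = i then v i else v i * w ⟨j, h⟩) := by
    ext j
    simp only [dehom, AlgHom.comp_apply, aeval_X]
    split_ifs <;> simp
  have h2 := DFunLike.congr_fun this f
  simpa [MvPolynomial.aeval_eq_eval] using h2

lemma eval_chartPoint_dehom {v : Fin n → k} {i : Fin n} (hv : v i ≠ 0)
    (f : MvPolynomial (Fin n) k) : eval (chartPoint v i) (dehom v i f) = eval v f := by
  rw [eval_dehom]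
  congr 2
  ext j
  split_ifs with h
  · rw [h]
  · simp only [chartPoint]; field_simp

lemma comap_dehom {v : Fin n → k} {i : Fin n} (hv : v i ≠ 0) :
    idealOf v = (RingHom.ker (eval (chartPoint v i))).comap (dehom v i).toRingHom := by
  ext f
  simp only [idealOf, Ideal.mem_comap, RingHom.mem_ker]
  rw [← eval_chartPoint_dehom hv]
  rfl

/-- A form that vanishes on the chart vanishes wherever x_i ≠ 0, by rescaling; its product with X i
then vanishes everywhere, and k is infinite. -/
lemma dehom_injOn [Infinite k] {v : Fin n → k} {i : Fin n} (hv : v i ≠ 0)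
    {f : MvPolynomial (Fin n) k} {m : ℕ} (hf : f.IsHomogeneous m) (h : dehom v i f = 0) :
    f = 0 := by
  have : X i * f = 0 := by
    refine MvPolynomial.funext fun w => ?_
    rw [map_mul, eval_X, map_zero, mul_eq_zero]
    by_cases hw : w i = 0
    · exact Or.inl hw
    · right
      have h1 := eval_dehom v i (chartPoint w i) f
      rw [h, map_zero] at h1
      have h2 : (fun j => if h : j = i then v i else v i * chartPoint w i ⟨j, h⟩) =
          (v i / w i) • w := by
        ext j
        simp only [chartPoint, Pi.smul_apply, smul_eq_mul]
        split_ifs with hj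
        · subst hj; field_simp
        · field_simp
      rw [h2, eval_smul_of_isHomogeneous hf] at h1
      exact (mul_eq_zero.1 h1.symm).resolve_left (pow_ne_zero _ (div_ne_zero hv hw))
  exact (mul_eq_zero.1 this).resolve_left (X_ne_zero i)

/-- The map from the local ring of projective space at `v` to that of the affine chart. -/
def chartHom {v : Fin n → k} {i : Fin n} (hv : v i ≠ 0) :
    HomogeneousLocalization.AtPrime (homogeneousSubmodule (Fin n) k) (idealOf v) →+*
      Localization.AtPrime (RingHom.ker (eval (chartPoint v i))) :=
  (Localization.localRingHom (idealOf v) (RingHom.ker (eval (chartPoint v i)))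
    (dehom v i).toRingHom (comap_dehom hv)).comp
    (algebraMap (HomogeneousLocalization.AtPrime (homogeneousSubmodule (Fin n) k) (idealOf v))
      (Localization.AtPrime (idealOf v)))

lemma chartHom_mk {v : Fin n → k} {i : Fin n} (hv : v i ≠ 0)
    (c : HomogeneousLocalization.NumDenSameDeg (homogeneousSubmodule (Fin n) k)
      (idealOf v).primeCompl) :
    chartHom hv (HomogeneousLocalization.mk c) * algebraMap _ _ (dehom v i c.den) =
      algebraMap _ _ (dehom v i c.num) := by
  have h1 : (HomogeneousLocalization.mk c).val * algebraMap _ _ (c.den : MvPolynomial (Fin n) k) =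
      algebraMap _ (Localization.AtPrime (idealOf v)) (c.num : MvPolynomial (Fin n) k) := by
    rw [HomogeneousLocalization.val_mk, Localization.mk_eq_mk']
    exact IsLocalization.mk'_spec _ _ _
  have h2 := congrArg (Localization.localRingHom (idealOf v)
    (RingHom.ker (eval (chartPoint v i))) (dehom v i).toRingHom (comap_dehom hv)) h1
  rw [map_mul, Localization.localRingHom_to_map, Localization.localRingHom_to_map] at h2
  exact h2

lemma chartHom_injective [Infinite k] {v : Fin n → k} {i : Fin n} (hv : v i ≠ 0) :
    Function.Injective (chartHom hv) := by
  rw [injective_iff_map_eq_zero]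
  intro a ha
  obtain ⟨c, rfl⟩ := HomogeneousLocalization.mk_surjective a
  have h := chartHom_mk hv c
  rw [ha, zero_mul] at h
  have h2 : dehom v i c.num = 0 := by
    refine IsLocalization.injective (Localization.AtPrime (RingHom.ker (eval (chartPoint v i))))
      (RingHom.ker (eval (chartPoint v i))).primeCompl_le_nonZeroDivisors ?_
    rw [← h, map_zero]
  exact HomogeneousLocalization.mk_eq_zero_of_num _
    (Subtype.ext (dehom_injOn hv ((mem_homogeneousSubmodule _ _).1 c.num.2) h2))

lemma isLocalHom_chartHom {v : Fin n → k} {i : Fin n} (hv : v i ≠ 0) :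
    IsLocalHom (chartHom hv) := by
  refine ⟨fun a ha => ?_⟩
  have h1 : IsUnit a.val := by
    have := Localization.isLocalHom_localRingHom (idealOf v)
      (RingHom.ker (eval (chartPoint v i))) (dehom v i).toRingHom (comap_dehom hv)
    exact this.map_nonunit _ ha
  exact (HomogeneousLocalization.isUnit_iff_isUnit_val _ _ a).1 h1

/-- The homogeneous fraction `f / x_i ^ m` in the local ring at `v`. -/
def chartFrac {v : Fin n → k} {i : Fin n} (hv : v i ≠ 0) {f : MvPolynomial (Fin n) k} {m : ℕ}
    (hf : f.IsHomogeneous m) :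
    HomogeneousLocalization.AtPrime (homogeneousSubmodule (Fin n) k) (idealOf v) :=
  HomogeneousLocalization.mk ⟨m, ⟨f, (mem_homogeneousSubmodule _ _).2 hf⟩,
    ⟨X i ^ m, (mem_homogeneousSubmodule _ _).2 (by simpa using (isHomogeneous_X k i).pow m)⟩, by
      change ¬ eval v (X i ^ m) = 0
      rw [map_pow, eval_X]
      exact pow_ne_zero _ hv⟩

lemma chartHom_chartFrac {v : Fin n → k} {i : Fin n} (hv : v i ≠ 0) {f : MvPolynomial (Fin n) k}
    {m : ℕ} (hf : f.IsHomogeneous m) :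
    chartHom hv (chartFrac hv hf) *
      algebraMap (MvPolynomial {j : Fin n // j ≠ i} k) _ (C (v i ^ m)) =
      algebraMap _ _ (dehom v i f) := by
  have := chartHom_mk hv (⟨m, ⟨f, (mem_homogeneousSubmodule _ _).2 hf⟩,
    ⟨X i ^ m, (mem_homogeneousSubmodule _ _).2 (by simpa using (isHomogeneous_X k i).pow m)⟩, by
      change ¬ eval v (X i ^ m) = 0
      rw [map_pow, eval_X]
      exact pow_ne_zero _ hv⟩)
  rw [← this]
  congr 2
  simp [dehom]

lemma chartFrac_mul_pow {v : Fin n → k} {i : Fin n} (hv : v i ≠ 0) {f : MvPolynomial (Fin n) k}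
    {m : ℕ} (hf : f.IsHomogeneous m) :
    (chartFrac hv hf).val * algebraMap _ _ (X i ^ m : MvPolynomial (Fin n) k) =
      algebraMap _ (Localization.AtPrime (idealOf v)) f := by
  rw [chartFrac, HomogeneousLocalization.val_mk, Localization.mk_eq_mk']
  exact IsLocalization.mk'_spec _ _ _

lemma isUnit_algebraMap_C {σ : Type*} (w : σ → k) {c : k} (hc : c ≠ 0) :
    IsUnit (algebraMap (MvPolynomial σ k) (Localization.AtPrime (RingHom.ker (eval w))) (C c)) :=
  ((isUnit_iff_ne_zero.2 hc).map C).map _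

lemma chartHom_surjective {v : Fin n → k} {i : Fin n} (hv : v i ≠ 0) :
    Function.Surjective (chartHom hv) := by
  have hloc := isLocalHom_chartHom hv
  have hC : ∀ c : k, ∃ a, chartHom hv a =
      algebraMap (MvPolynomial {j : Fin n // j ≠ i} k) _ (C c) := fun c => by
    refine ⟨chartFrac hv (isHomogeneous_C (Fin n) c), ?_⟩
    have := chartHom_chartFrac hv (isHomogeneous_C (Fin n) c)
    rw [pow_zero, map_one, map_one, mul_one] at this
    rw [this]
    congr 1
    simp [dehom, ← algebraMap_eq]
  have hB : ∀ b : MvPolynomial {j : Fin n // j ≠ i} k, ∃ a, chartHom hv a = algebraMap _ _ b := by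
    intro b
    induction b using MvPolynomial.induction_on with
    | C c => exact hC c
    | add p q hp hq =>
      obtain ⟨a, ha⟩ := hp
      obtain ⟨b, hb⟩ := hq
      exact ⟨a + b, by rw [map_add, map_add, ha, hb]⟩
    | mul_X p j hp =>
      obtain ⟨a, ha⟩ := hp
      refine ⟨a * chartFrac hv (isHomogeneous_X k (j : Fin n)), ?_⟩
      rw [map_mul, map_mul, ha]
      congr 1
      have := chartHom_chartFrac hv (isHomogeneous_X k (j : Fin n))
      refine (isUnit_algebraMap_C (chartPoint v i) (pow_ne_zero 1 hv)).mul_left_injective ?_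
      simp only [this]
      simp [dehom, j.2, mul_comm]
  intro l
  obtain ⟨b, s, rfl⟩ := IsLocalization.exists_mk'_eq
    (RingHom.ker (eval (chartPoint v i))).primeCompl l
  obtain ⟨b', hb'⟩ := hB b
  obtain ⟨s', hs'⟩ := hB s
  have hu : IsUnit s' := by
    refine hloc.map_nonunit _ ?_
    rw [hs']
    exact IsLocalization.map_units _ s
  obtain ⟨u, rfl⟩ := hu
  refine ⟨b' * ↑u⁻¹, ?_⟩
  rw [IsLocalization.eq_mk'_iff_mul_eq, ← hs', ← map_mul, mul_assoc, Units.inv_mul, mul_one, hb']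

/-- The local ring of projective space at `v` is that of the affine chart. -/
def chartEquiv [Infinite k] {v : Fin n → k} {i : Fin n} (hv : v i ≠ 0) :
    HomogeneousLocalization.AtPrime (homogeneousSubmodule (Fin n) k) (idealOf v) ≃+*
      Localization.AtPrime (RingHom.ker (eval (chartPoint v i))) :=
  RingEquiv.ofBijective (chartHom hv) ⟨chartHom_injective hv, chartHom_surjective hv⟩

/-- In the chart, f differs from the image of f / x_i^m by the unit v_i^m. The converse inclusion
follows from mapping the full localisation. -/
lemma map_localIdeal {x : ℙ k (Fin n → k)} {i : Fin n} (hv : x.rep i ≠ 0)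
    {E : Set (MvPolynomial (Fin n) k)} (hE : ∀ f ∈ E, ∃ m, f.IsHomogeneous m) :
    Ideal.span ((fun f => algebraMap _ (Localization.AtPrime (RingHom.ker
      (eval (chartPoint x.rep i)))) (dehom x.rep i f)) '' E) =
      (localIdeal E x).map (chartHom hv) := by
  refine le_antisymm ?_ ?_
  · rw [Ideal.span_le]
    rintro _ ⟨f, hf, rfl⟩
    obtain ⟨m, hm⟩ := hE f hf
    simp only [← chartHom_chartFrac hv hm]
    refine Ideal.mul_mem_right _ _ (Ideal.mem_map_of_mem _ ?_)
    change (chartFrac hv hm).val ∈ (Ideal.span E).map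
      (algebraMap (MvPolynomial (Fin n) k) (Localization.AtPrime (idealOf x.rep)))
    have hu : IsUnit (algebraMap (MvPolynomial (Fin n) k) (Localization.AtPrime (idealOf x.rep))
        (X i ^ m)) := by
      refine IsLocalization.map_units (M := (idealOf x.rep).primeCompl) _ ⟨X i ^ m, ?_⟩
      change ¬ eval x.rep (X i ^ m) = 0
      rw [map_pow, eval_X]
      exact pow_ne_zero _ hv
    rw [← Ideal.mul_unit_mem_iff_mem _ hu, chartFrac_mul_pow]
    exact Ideal.mem_map_of_mem _ (Ideal.subset_span hf)
  · rw [Ideal.map_le_iff_le_comap]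
    intro a ha
    have h1 := Ideal.mem_map_of_mem (Localization.localRingHom (idealOf x.rep)
      (RingHom.ker (eval (chartPoint x.rep i))) (dehom x.rep i).toRingHom (comap_dehom hv))
      (Ideal.mem_comap.1 ha)
    rw [Ideal.map_span, Ideal.map_span, Set.image_image] at h1
    refine Ideal.mem_comap.2 ?_
    simp only [Localization.localRingHom_to_map] at h1
    exact h1

lemma isRegularLocalRing_iff_chart [Infinite k] {x : ℙ k (Fin n → k)} {i : Fin n}
    (hv : x.rep i ≠ 0) {E : Set (MvPolynomial (Fin n) k)}
    (hE : ∀ f ∈ E, ∃ m, f.IsHomogeneous m) :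
    IsRegularLocalRing (LocalRingAt x ⧸ localIdeal E x) ↔
      IsRegularLocalRing (Localization.AtPrime (RingHom.ker (eval (chartPoint x.rep i))) ⧸
        Ideal.span ((fun f => algebraMap _ (Localization.AtPrime (RingHom.ker
          (eval (chartPoint x.rep i)))) (dehom x.rep i f)) '' E)) := by
  have e := Ideal.quotientEquiv (localIdeal E x) _ (chartEquiv hv) (map_localIdeal hv hE)
  exact ⟨fun _ => .of_ringEquiv e, fun h => h.of_ringEquiv e.symm⟩

lemma tangentDataAt_D_dehom {v : Fin n → k} {i : Fin n} (hv : v i ≠ 0)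
    (f : MvPolynomial (Fin n) k) :
    (tangentDataAt (chartPoint v i)).D (algebraMap _ _ (dehom v i f)) =
      fun j : {j : Fin n // j ≠ i} => v i * grad f v j := by
  rw [tangentDataAt_D]
  have h : (aeval (fun j => TrivSqZeroExt.inl (chartPoint v i j) +
      TrivSqZeroExt.inr (Pi.single j 1) : _ → TrivSqZeroExt k ({j : Fin n // j ≠ i} → k))).comp
      (dehom v i) = aeval (fun j => TrivSqZeroExt.inl (v j) + TrivSqZeroExt.inr
        (if h : j = i then 0 else Pi.single ⟨j, h⟩ (v i))) := by
    ext j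
    · simp only [dehom, AlgHom.comp_apply, aeval_X]
      split_ifs with h
      · subst h; simp [TrivSqZeroExt.algebraMap_eq_inl, ← algebraMap_eq]
      · simp [TrivSqZeroExt.algebraMap_eq_inl, ← algebraMap_eq, chartPoint]
        field_simp
    · simp only [dehom, AlgHom.comp_apply, aeval_X]
      split_ifs with h
      · subst h; simp [TrivSqZeroExt.algebraMap_eq_inl, ← algebraMap_eq]
      · simp [TrivSqZeroExt.algebraMap_eq_inl, ← algebraMap_eq, chartPoint, Pi.single_apply]
  have h2 := DFunLike.congr_fun h f
  rw [AlgHom.comp_apply] at h2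
  rw [h2, snd_aeval_trivSqZeroExt]
  ext j
  rw [Finset.sum_apply, Finset.sum_eq_single (j : Fin n)]
  · simp [j.2, grad, mul_comm]
  · intro l _ hl
    by_cases h : l = i
    · simp [h]
    · simp only [h, dite_false, Pi.smul_apply]
      rw [Pi.single_eq_of_ne, smul_zero]
      rintro rfl
      exact hl rfl
  · simp

end Chart

/-! ### Singular points of hypersurfaces and of codimension-two intersections -/

section SingularPoints

attribute [local instance] MvPolynomial.gradedAlgebra

variable {k : Type*} [Field k] {n : ℕ}

lemma exists_rep_ne_zero (x : ℙ k (Fin n → k)) : ∃ i, x.rep i ≠ 0 :=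
  Function.ne_iff.1 x.rep_nonzero

lemma dotProduct_grad {f : MvPolynomial (Fin n) k} {m : ℕ} (hf : f.IsHomogeneous m)
    (x : Fin n → k) : x ⬝ᵥ grad f x = m * eval x f := by
  have := congrArg (eval x) hf.sum_X_mul_pderiv
  simpa [dotProduct, grad, map_sum, nsmul_eq_mul] using this

/-- By Euler's relation the gradient at a point of the hypersurface is orthogonal to v, so no
information is lost when the component in the chart direction i is dropped. -/
lemma grad_restrict_injective {v g : Fin n → k} {i : Fin n} (hv : v i ≠ 0) (h : v ⬝ᵥ g = 0)
    (hg : ∀ j, j ≠ i → g j = 0) : g = 0 := by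
  have : v i * g i = 0 := by
    rw [← h, dotProduct, Finset.sum_eq_single i (fun j _ hj => by rw [hg j hj, mul_zero])
      (by simp)]
  ext j
  by_cases hj : j = i
  · subst hj; exact (mul_eq_zero.1 this).resolve_left hv
  · exact hg j hj

/-- Where the gradients are independent, the scheme is regular. -/
theorem jacSing_of_mem_sing [Infinite k] {r : ℕ} {E : Fin r → MvPolynomial (Fin n) k}
    (hE : ∀ j, ∃ m, (E j).IsHomogeneous m) {x : ℙ k (Fin n → k)} (hx : x ∈ Sing (Set.range E)) :
    JacSing E x.rep := by
  rw [jacSing_iff]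
  refine ⟨fun j => hx.1 _ ⟨j, rfl⟩, fun hli => hx.2 ?_⟩
  obtain ⟨i, hi⟩ := exists_rep_ne_zero x
  rw [isRegularLocalRing_iff_chart hi (by rintro _ ⟨j, rfl⟩; exact hE j), ← Set.range_comp]
  refine (tangentDataAt (chartPoint x.rep i)).isRegularLocalRing_quotient (fun j => ?_) ?_
  · rw [Function.comp_apply, tangentDataAt_ev, eval_chartPoint_dehom hi]
    exact hx.1 _ ⟨j, rfl⟩
  · simp only [Function.comp_apply, tangentDataAt_D_dehom hi]
    let ρ : (Fin n → k) →ₗ[k] ({j : Fin n // j ≠ i} → k) :=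
      x.rep i • LinearMap.funLeft k k Subtype.val
    have h1 : Submodule.span k (Set.range fun j => grad (E j) x.rep) ≤
        LinearMap.ker (dotProductBilin k k x.rep) := by
      rw [Submodule.span_le]
      rintro _ ⟨j, rfl⟩
      obtain ⟨m, hm⟩ := hE j
      rw [SetLike.mem_coe, LinearMap.mem_ker]
      change x.rep ⬝ᵥ grad (E j) x.rep = 0
      rw [dotProduct_grad hm, hx.1 _ ⟨j, rfl⟩, mul_zero]
    refine hli.map (f := ρ) ?_
    rw [Submodule.disjoint_def]
    intro g hg hg'
    refine grad_restrict_injective hi (LinearMap.mem_ker.1 (h1 hg)) fun j hj => ?_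
    have := congrFun (LinearMap.mem_ker.1 hg') ⟨j, hj⟩
    exact (mul_eq_zero.1 this).resolve_left hi

lemma algebraMap_dehom_ne_zero [Infinite k] {v : Fin n → k} {i : Fin n} (hv : v i ≠ 0)
    {f : MvPolynomial (Fin n) k} {m : ℕ} (hf : f.IsHomogeneous m) (h : f ≠ 0) :
    algebraMap _ (Localization.AtPrime (RingHom.ker (eval (chartPoint v i)))) (dehom v i f) ≠ 0 :=
  fun h0 => h (dehom_injOn hv hf (IsLocalization.injective
    (Localization.AtPrime (RingHom.ker (eval (chartPoint v i))))
      (RingHom.ker (eval (chartPoint v i))).primeCompl_le_nonZeroDivisors (by rw [h0, map_zero])))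

/-- A hypersurface is singular where the gradient vanishes. -/
theorem mem_sing_singleton [Infinite k] {F : MvPolynomial (Fin n) k} {m : ℕ}
    (hF : F.IsHomogeneous m) (h0 : F ≠ 0) {x : ℙ k (Fin n → k)} (hx : eval x.rep F = 0)
    (hg : grad F x.rep = 0) : x ∈ Sing {F} := by
  refine ⟨by simpa using hx, ?_⟩
  obtain ⟨i, hi⟩ := exists_rep_ne_zero x
  rw [isRegularLocalRing_iff_chart hi (by rintro _ rfl; exact ⟨m, hF⟩), Set.image_singleton]
  refine (tangentDataAt (chartPoint x.rep i)).not_isRegularLocalRing_quotient_singleton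
    (algebraMap_dehom_ne_zero hi hF h0) ?_ ?_
  · rw [tangentDataAt_ev, eval_chartPoint_dehom hi, hx]
  · rw [tangentDataAt_D_dehom hi, hg]
    ext j
    simp

/-- Clearing denominators makes F divide G times a power of X i times a denominator. The last two do
not vanish at v while F does, so the prime F divides G. -/
lemma dvd_of_algebraMap_dehom_dvd [Infinite k] {v : Fin n → k} {i : Fin n} (hv : v i ≠ 0)
    {F G : MvPolynomial (Fin n) k} {d e : ℕ} (hF : F.IsHomogeneous d) (hG : G.IsHomogeneous e)
    (hp : Prime F) (hFv : eval v F = 0)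
    (h : algebraMap _ (Localization.AtPrime (RingHom.ker (eval (chartPoint v i))))
      (dehom v i F) ∣ algebraMap _ _ (dehom v i G)) : F ∣ G := by
  have hmono : chartHom hv (chartFrac hv hF) ∣ chartHom hv (chartFrac hv hG) := by
    rw [← chartHom_chartFrac hv hF, ← chartHom_chartFrac hv hG] at h
    exact (isUnit_algebraMap_C _ (pow_ne_zero e hv)).dvd_mul_right.1 ((dvd_mul_right _ _).trans h)
  obtain ⟨b, hb⟩ := hmono
  obtain ⟨a, rfl⟩ := chartHom_surjective hv b
  rw [← map_mul] at hb
  have h1 := congrArg HomogeneousLocalization.val (chartHom_injective hv hb)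
  rw [HomogeneousLocalization.val_mul] at h1
  obtain ⟨c, rfl⟩ := HomogeneousLocalization.mk_surjective a
  have h2 : (HomogeneousLocalization.mk c).val * algebraMap _ _ (c.den : MvPolynomial (Fin n) k) =
      algebraMap _ (Localization.AtPrime (idealOf v)) (c.num : MvPolynomial (Fin n) k) := by
    rw [HomogeneousLocalization.val_mk, Localization.mk_eq_mk']
    exact IsLocalization.mk'_spec _ _ _
  have h3 : G * X i ^ d * (c.den : MvPolynomial (Fin n) k) =
      F * X i ^ e * (c.num : MvPolynomial (Fin n) k) := by
    refine IsLocalization.injective (Localization.AtPrime (idealOf v))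
      (idealOf v).primeCompl_le_nonZeroDivisors ?_
    rw [map_mul, map_mul, map_mul, map_mul, ← h2, ← chartFrac_mul_pow hv hF,
      ← chartFrac_mul_pow hv hG, h1]
    ring
  have h4 : F ∣ G * X i ^ d * (c.den : MvPolynomial (Fin n) k) :=
    ⟨X i ^ e * (c.num : MvPolynomial (Fin n) k), by rw [h3]; ring⟩
  have hnd : ∀ q : MvPolynomial (Fin n) k, eval v q ≠ 0 → ¬ F ∣ q := by
    rintro _ hq ⟨q, rfl⟩
    rw [map_mul, hFv, zero_mul] at hq
    exact hq rfl
  have h5 := (hp.dvd_or_dvd h4).resolve_right (hnd _ c.den_mem)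
  refine (hp.dvd_or_dvd h5).resolve_right (hnd _ ?_)
  rw [map_pow, eval_X]
  exact pow_ne_zero _ hv

/-- An intersection of two hypersurfaces is singular where the gradients are dependent. -/
theorem mem_sing_pair [Infinite k] {F G : MvPolynomial (Fin n) k} {d e : ℕ}
    (hF : F.IsHomogeneous d) (hG : G.IsHomogeneous e) (hp : Prime F) (hFG : ¬ F ∣ G)
    {x : ℙ k (Fin n → k)} (hFx : eval x.rep F = 0) (hGx : eval x.rep G = 0)
    (hgF : grad F x.rep ≠ 0) (hgG : ∃ c : k, grad G x.rep = c • grad F x.rep) :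
    x ∈ Sing {F, G} := by
  refine ⟨by rintro _ (rfl | rfl) <;> assumption, ?_⟩
  obtain ⟨i, hi⟩ := exists_rep_ne_zero x
  rw [isRegularLocalRing_iff_chart hi (by
    rintro _ (rfl | rfl)
    exacts [⟨d, hF⟩, ⟨e, hG⟩]), Set.image_pair]
  have : UniqueFactorizationMonoid (Localization.AtPrime
      (RingHom.ker (eval (chartPoint x.rep i)))) := inferInstance
  refine (tangentDataAt (chartPoint x.rep i)).not_isRegularLocalRing_quotient_pair ?_ ?_ ?_ ?_
    fun h => hFG (dvd_of_algebraMap_dehom_dvd hi hF hG hp hFx h)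
  · rw [tangentDataAt_ev, eval_chartPoint_dehom hi, hFx]
  · rw [tangentDataAt_ev, eval_chartPoint_dehom hi, hGx]
  · rw [tangentDataAt_D_dehom hi]
    refine fun h => hgF (grad_restrict_injective hi ?_ fun j hj => ?_)
    · rw [dotProduct_grad hF, hFx, mul_zero]
    · exact (mul_eq_zero.1 (congrFun h ⟨j, hj⟩)).resolve_left hi
  · obtain ⟨c, hc⟩ := hgG
    refine ⟨c, ?_⟩
    rw [tangentDataAt_D_dehom hi, tangentDataAt_D_dehom hi, hc]
    ext j
    simp only [Pi.smul_apply, smul_eq_mul]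
    ring

end SingularPoints

/-! ### Irreducibility of smooth forms in at least three variables -/

section Irreducible

variable {k : Type*} [Field k] {n : ℕ}

lemma height_ker_eval {σ : Type*} [Fintype σ] (v : σ → k) :
    (RingHom.ker (eval v)).height = Fintype.card σ := by
  classical
  have h1 := IsLocalization.AtPrime.ringKrullDim_eq_height (RingHom.ker (eval v))
    (Localization.AtPrime (RingHom.ker (eval v)))
  rw [(tangentDataAt v).ringKrullDim_eq] at h1
  exact_mod_cast h1.symm

/-- Fewer than `n` forms in `n` variables have a common nontrivial zero. -/
lemma exists_common_zero [IsAlgClosed k] {ι : Type*} [Fintype ι] (hn : Fintype.card ι < n)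
    {f : ι → MvPolynomial (Fin n) k} (hf : ∀ j, eval 0 (f j) = 0) :
    ∃ x : Fin n → k, x ≠ 0 ∧ ∀ j, eval x (f j) = 0 := by
  classical
  by_contra! h
  obtain ⟨N, hN⟩ := exists_span_X_pow_le_span (f := f) fun x hx => by
    by_contra hx0
    obtain ⟨j, hj⟩ := h x hx0
    exact hj (hx j)
  have hker : RingHom.ker (eval (0 : Fin n → k)) =
      Ideal.span (Set.range (X : Fin n → MvPolynomial (Fin n) k)) := by
    rw [ker_eval_eq_span]
    simp
  have hle : Ideal.span (Set.range f) ≤ RingHom.ker (eval (0 : Fin n → k)) := by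
    rw [Ideal.span_le]
    rintro _ ⟨j, rfl⟩
    exact hf j
  have hmin : RingHom.ker (eval (0 : Fin n → k)) ∈
      (Ideal.span ((Finset.univ.image f : Finset _) :
        Set (MvPolynomial (Fin n) k))).minimalPrimes := by
    -- Without nontrivial zeros the ideal of the origin, of height n, would be minimal over fewer
    -- than n generators, against Krull's height theorem.
    rw [Finset.coe_image, Finset.coe_univ, Set.image_univ]
    refine ⟨⟨ker_eval_isPrime _, hle⟩, fun Q hQ _ => ?_⟩
    rw [hker]
    have := hQ.1
    exact Ideal.IsPrime.le_of_pow_le (hN.trans hQ.2)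
  have := Ideal.height_le_card_of_mem_minimalPrimes_span_finset hmin
  rw [height_ker_eval, Fintype.card_fin] at this
  have h2 : n ≤ (Finset.univ.image f).card := by exact_mod_cast this
  have h3 : (Finset.univ.image f).card ≤ Fintype.card ι := Finset.card_image_le
  omega

/-- The product of the lowest homogeneous components of two polynomials. -/
lemma homogeneousComponent_mul_of_forall_lt {p q : MvPolynomial (Fin n) k} {a b : ℕ}
    (hp : ∀ i < a, homogeneousComponent i p = 0) (hq : ∀ i < b, homogeneousComponent i q = 0) :
    homogeneousComponent (a + b) (p * q) =
      homogeneousComponent a p * homogeneousComponent b q := by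
  have hout : ∀ (p : MvPolynomial (Fin n) k) (a : ℕ), a ∉ Finset.range (p.totalDegree + 1) →
      homogeneousComponent a p = 0 := fun p a ha =>
    homogeneousComponent_eq_zero _ _ (by rw [Finset.mem_range] at ha; omega)
  have h1 : ∀ i j, homogeneousComponent (a + b)
      (homogeneousComponent i p * homogeneousComponent j q) =
      if i = a ∧ j = b then homogeneousComponent a p * homogeneousComponent b q else 0 := by
    intro i j
    have hm := IsHomogeneous.mul (homogeneousComponent_isHomogeneous i p)
      (homogeneousComponent_isHomogeneous j q)
    rw [homogeneousComponent_of_mem hm]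
    by_cases h : i = a ∧ j = b
    · simp [h]
    · rw [if_neg h]
      split_ifs with hs
      · rcases lt_or_ge i a with hi | hi
        · rw [hp i hi, zero_mul]
        · rw [hq j (by omega), mul_zero]
      · rfl
  conv_lhs => rw [← sum_homogeneousComponent p, ← sum_homogeneousComponent q]
  rw [Finset.sum_mul_sum, map_sum]
  simp only [map_sum, h1]
  rw [Finset.sum_eq_single a, Finset.sum_eq_single b]
  · simp
  · intro j _ hj; simp [hj]
  · intro hb; simp [hout q b hb]
  · intro i _ hi; simp [hi]
  · intro ha; simp [hout p a ha]

lemma exists_lowest_homogeneousComponent {p : MvPolynomial (Fin n) k} (hp : p ≠ 0) :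
    ∃ a, homogeneousComponent a p ≠ 0 ∧ ∀ i < a, homogeneousComponent i p = 0 := by
  classical
  have h : ∃ a, homogeneousComponent a p ≠ 0 := by
    by_contra! h
    apply hp
    rw [← sum_homogeneousComponent p]
    exact Finset.sum_eq_zero fun i _ => h i
  exact ⟨Nat.find h, Nat.find_spec h, fun i hi => not_not.1 (Nat.find_min h hi)⟩

/-- The degrees of p and q add up to d, and q already has degree at least d. -/
lemma isUnit_of_lowest_component_zero {p q F : MvPolynomial (Fin n) k} {d : ℕ}
    (hF : F.IsHomogeneous d) (hF0 : F ≠ 0) (hpq : F = p * q)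
    (hq : homogeneousComponent d q ≠ 0) : IsUnit p := by
  have hp0 : p ≠ 0 := by rintro rfl; simp at hpq; exact hF0 hpq
  have hq0 : q ≠ 0 := by rintro rfl; simp at hpq; exact hF0 hpq
  have h1 := totalDegree_mul_of_isDomain hp0 hq0
  rw [← hpq, hF.totalDegree hF0] at h1
  have h2 : d ≤ q.totalDegree := by
    by_contra! h
    exact hq (homogeneousComponent_eq_zero _ _ h)
  have h3 : p.totalDegree = 0 := by omega
  rw [totalDegree_eq_zero_iff_eq_C] at h3
  rw [h3] at hp0 ⊢
  exact (isUnit_iff_ne_zero.2 fun h => hp0 (by rw [h, map_zero])).map C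

/-- A form in at least three variables whose gradient has no nontrivial zero is irreducible. -/
theorem irreducible_of_grad_ne_zero [IsAlgClosed k] (hn : 3 ≤ n) {F : MvPolynomial (Fin n) k}
    {d : ℕ} (hd : 0 < d) (hF : F.IsHomogeneous d) (hg : ∀ x, grad F x = 0 → x = 0) :
    Irreducible F := by
  have hF0 : F ≠ 0 := by
    rintro rfl
    have h1 : (fun _ => 1 : Fin n → k) = 0 := hg _ (by ext i; simp [grad])
    exact one_ne_zero (congrFun h1 ⟨0, by omega⟩)
  have hzero : ∀ {m : ℕ} {f : MvPolynomial (Fin n) k}, 0 < m → f.IsHomogeneous m →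
      eval 0 f = 0 := fun {m f} hm hf => by
    have := eval_smul_of_isHomogeneous hf (0 : k) (0 : Fin n → k)
    rwa [zero_pow hm.ne', zero_mul, smul_zero] at this
  refine ⟨fun hu => ?_, fun p q hpq => ?_⟩
  · have := hu.map (eval (0 : Fin n → k))
    rw [hzero hd hF] at this
    exact not_isUnit_zero this
  have hp0 : p ≠ 0 := by rintro rfl; simp at hpq; exact hF0 hpq
  have hq0 : q ≠ 0 := by rintro rfl; simp at hpq; exact hF0 hpq
  obtain ⟨a, ha, ha'⟩ := exists_lowest_homogeneousComponent hp0
  obtain ⟨b, hb, hb'⟩ := exists_lowest_homogeneousComponent hq0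
  have h1 := homogeneousComponent_mul_of_forall_lt ha' hb'
  rw [← hpq, homogeneousComponent_of_mem hF] at h1
  have hab : a + b = d := by
    by_contra h
    rw [if_neg h] at h1
    exact mul_ne_zero ha hb h1.symm
  rw [if_pos hab] at h1
  rcases Nat.eq_zero_or_pos a with h | hapos
  · left
    exact isUnit_of_lowest_component_zero hF hF0 hpq (by rwa [← hab, h, zero_add])
  rcases Nat.eq_zero_or_pos b with h | hbpos
  · right
    exact isUnit_of_lowest_component_zero hF hF0 (hpq.trans (mul_comm _ _))
      (by rwa [← hab, h, add_zero])
  exfalso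
  have hAh := homogeneousComponent_isHomogeneous a p
  have hBh := homogeneousComponent_isHomogeneous b q
  -- F is the product of the lowest components of p and q. If both have positive degree they have a
  -- common nontrivial zero, as 2 < n, and there the gradient of the product vanishes.
  obtain ⟨x, hx0, hx⟩ := exists_common_zero (k := k) (n := n) (ι := Fin 2)
    (f := ![homogeneousComponent a p, homogeneousComponent b q]) (by simp; omega) (by
      intro j
      fin_cases j
      · exact hzero hapos hAh
      · exact hzero hbpos hBh)
  refine hx0 (hg x ?_)
  have hx1 := hx 0
  have hx2 := hx 1
  simp only [Matrix.cons_val_zero, Matrix.cons_val_one] at hx1 hx2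
  ext i
  rw [h1]
  simp [grad, Derivation.leibniz, hx1, hx2]

end Irreducible

/-! ### Polynomials restricted to lines through the origin -/

section Line

variable {k : Type*} [Field k] {n : ℕ}

/-- Restriction of polynomials to the line through `v`. -/
def lineHom (v : Fin n → k) : MvPolynomial (Fin n) k →ₐ[k] Polynomial k :=
  aeval fun i => Polynomial.C (v i) * Polynomial.X

lemma eval_lineHom (v : Fin n → k) (f : MvPolynomial (Fin n) k) (t : k) :
    (lineHom v f).eval t = eval (t • v) f := by
  have : (Polynomial.aeval t).comp (lineHom v) = aeval (t • v) := by
    ext i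
    simp only [lineHom, AlgHom.comp_apply, aeval_X, Pi.smul_apply, smul_eq_mul]
    simp [mul_comm t]
  have h2 := DFunLike.congr_fun this f
  simpa [MvPolynomial.aeval_eq_eval, Polynomial.aeval_def] using h2

lemma lineHom_of_isHomogeneous (v : Fin n → k) {f : MvPolynomial (Fin n) k} {m : ℕ}
    (hf : f.IsHomogeneous m) : lineHom v f = Polynomial.C (eval v f) * Polynomial.X ^ m := by
  rw [lineHom, aeval_def, eval₂_eq', eval_eq', map_sum, Finset.sum_mul]
  refine Finset.sum_congr rfl fun d hd => ?_
  have hdeg : ∑ i, d i = m := by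
    have := hf (mem_support_iff.1 hd)
    rwa [Finsupp.weight_apply, Finsupp.sum_fintype _ _ (by simp), Finset.sum_congr rfl
      (fun i _ => by simp : ∀ i ∈ Finset.univ, d i • (1 : Fin n → ℕ) i = d i)] at this
  simp only [mul_pow, Finset.prod_mul_distrib, Finset.prod_pow_eq_pow_sum, hdeg]
  simp [mul_assoc]

lemma lineHom_eq_sum (v : Fin n → k) (f : MvPolynomial (Fin n) k) :
    lineHom v f = ∑ m ∈ Finset.range (f.totalDegree + 1),
      Polynomial.C (eval v (homogeneousComponent m f)) * Polynomial.X ^ m := by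
  conv_lhs => rw [← sum_homogeneousComponent f]
  rw [map_sum]
  exact Finset.sum_congr rfl fun m _ =>
    lineHom_of_isHomogeneous v (homogeneousComponent_isHomogeneous m f)

lemma lineHom_eq_zero_iff (v : Fin n → k) (f : MvPolynomial (Fin n) k) :
    lineHom v f = 0 ↔ ∀ m, eval v (homogeneousComponent m f) = 0 := by
  constructor
  · intro h m
    by_cases hm : m ∈ Finset.range (f.totalDegree + 1)
    · have := congrArg (fun p => Polynomial.coeff p m) (lineHom_eq_sum v f)
      simp only [h, Polynomial.coeff_zero, Polynomial.finsetSum_coeff,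
        Polynomial.coeff_C_mul_X_pow] at this
      rw [Finset.sum_ite_eq] at this
      rw [if_pos hm] at this
      exact this.symm
    · rw [homogeneousComponent_eq_zero _ _ (by rw [Finset.mem_range] at hm; omega), map_zero]
  · intro h
    rw [lineHom_eq_sum]
    exact Finset.sum_eq_zero fun m _ => by rw [h, map_zero, zero_mul]

lemma lineHom_eq_zero_of_forall [Infinite k] {v : Fin n → k} {f : MvPolynomial (Fin n) k}
    (h : ∀ t : k, eval (t • v) f = 0) : lineHom v f = 0 :=
  Polynomial.funext fun t => by rw [eval_lineHom, h, Polynomial.eval_zero]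

end Line

/-! ### The Zariski topology of projective space induced from the prime spectrum -/

section Spectrum

open TopologicalSpace Topology

attribute [local instance] zariskiTopology

variable {k : Type*} [Field k] {n : ℕ}

/-- The prime ideal of the polynomials vanishing on the line `x`, as a point of the spectrum. -/
def toSpec (x : ℙ k (Fin n → k)) : PrimeSpectrum (MvPolynomial (Fin n) k) :=
  ⟨RingHom.ker (lineHom x.rep), RingHom.ker_isPrime _⟩

lemma mem_toSpec {x : ℙ k (Fin n → k)} {f : MvPolynomial (Fin n) k} :
    f ∈ (toSpec x).asIdeal ↔ lineHom x.rep f = 0 := Iff.rfl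

lemma isHomogeneous_mem_toSpec {x : ℙ k (Fin n → k)} {f : MvPolynomial (Fin n) k} {m : ℕ}
    (hf : f.IsHomogeneous m) : f ∈ (toSpec x).asIdeal ↔ eval x.rep f = 0 := by
  rw [mem_toSpec, lineHom_of_isHomogeneous _ hf, mul_eq_zero, Polynomial.C_eq_zero,
    or_iff_left (pow_ne_zero _ Polynomial.X_ne_zero)]

lemma isInducing_toSpec : IsInducing (toSpec : ℙ k (Fin n → k) → _) := by
  refine ⟨le_antisymm ?_ ?_⟩
  · rw [← continuous_iff_le_induced, PrimeSpectrum.isTopologicalBasis_basic_opens.continuous_iff]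
    rintro _ ⟨f, rfl⟩
    have : toSpec ⁻¹' (PrimeSpectrum.basicOpen f : Set (PrimeSpectrum (MvPolynomial (Fin n) k))) =
        ⋃ m, {x : ℙ k (Fin n → k) | eval x.rep (homogeneousComponent m f) ≠ 0} := by
      ext x
      rw [Set.mem_preimage, SetLike.mem_coe, PrimeSpectrum.mem_basicOpen, mem_toSpec,
        lineHom_eq_zero_iff, Set.mem_iUnion, not_forall]
      rfl
    rw [this]
    exact isOpen_iUnion fun m => TopologicalSpace.isOpen_generateFrom_of_mem
      ⟨_, m, homogeneousComponent_isHomogeneous m f, rfl⟩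
  · refine le_generateFrom ?_
    rintro _ ⟨f, m, hf, rfl⟩
    refine ⟨PrimeSpectrum.basicOpen f, (PrimeSpectrum.basicOpen f).isOpen, ?_⟩
    ext x
    rw [Set.mem_preimage, SetLike.mem_coe, PrimeSpectrum.mem_basicOpen,
      isHomogeneous_mem_toSpec hf]
    rfl

lemma mem_closure_iff_lineHom {S : Set (ℙ k (Fin n → k))} {x : ℙ k (Fin n → k)} :
    x ∈ closure S ↔ ∀ f, (∀ y ∈ S, lineHom y.rep f = 0) → lineHom x.rep f = 0 := by
  rw [isInducing_toSpec.closure_eq_preimage_closure_image, Set.mem_preimage,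
    ← PrimeSpectrum.zeroLocus_vanishingIdeal_eq_closure, PrimeSpectrum.mem_zeroLocus]
  constructor
  · intro h f hf
    refine h ((PrimeSpectrum.mem_vanishingIdeal _ _).2 ?_)
    rintro _ ⟨y, hy, rfl⟩
    exact hf y hy
  · intro h f hf
    refine h f fun y hy => ?_
    exact (PrimeSpectrum.mem_vanishingIdeal _ _).1 hf _ ⟨y, hy, rfl⟩

/-- A criterion for a set of points to be closed, in terms of not necessarily homogeneous
polynomials. -/
lemma isClosed_of_forall_exists [Infinite k] {T : Set (ℙ k (Fin n → k))}
    (h : ∀ y ∉ T, ∃ a : MvPolynomial (Fin n) k, eval y.rep a ≠ 0 ∧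
      ∀ z ∈ T, ∀ t : k, eval (t • z.rep) a = 0) : IsClosed T := by
  rw [← closure_subset_iff_isClosed]
  intro y hy
  by_contra hyT
  obtain ⟨a, ha, ha'⟩ := h y hyT
  have := mem_closure_iff_lineHom.1 hy a fun z hz => lineHom_eq_zero_of_forall (ha' z hz)
  apply ha
  have h2 := eval_lineHom y.rep a 1
  rw [this, one_smul, Polynomial.eval_zero] at h2
  exact h2.symm

lemma noetherianSpace : NoetherianSpace (ℙ k (Fin n → k)) :=
  isInducing_toSpec.noetherianSpace

end Spectrum

/-! ### Chains of primes and the height theorem -/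

section Chains

variable {R : Type*} [CommRing R] [IsNoetherianRing R]

/-- The height theorem, for a chain of primes which need not start at a minimal prime. -/
lemma length_le_card_of_mem_minimalPrimes (q : LTSeries (PrimeSpectrum R)) (s : Finset R)
    (h : q.last.asIdeal ∈ (q.head.asIdeal ⊔ Ideal.span (s : Set R)).minimalPrimes) :
    q.length ≤ s.card := by
  classical
  set P := q.head.asIdeal with hP
  let mk := Ideal.Quotient.mk P
  have hmk : Function.Surjective mk := Ideal.Quotient.mk_surjective
  have hle : ∀ i, P ≤ (q i).asIdeal := fun i => q.head_le i
  have hcomap : ∀ i, ((q i).asIdeal.map mk).comap mk = (q i).asIdeal := fun i => by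
    rw [Ideal.comap_map_of_surjective _ hmk, ← RingHom.ker_eq_comap_bot, Ideal.mk_ker]
    exact sup_eq_left.2 (hle i)
  let q' : LTSeries (PrimeSpectrum (R ⧸ P)) := LTSeries.mk q.length
    (fun i => ⟨(q i).asIdeal.map mk, Ideal.map_isPrime_of_surjective hmk (by
      rw [Ideal.mk_ker]; exact hle i)⟩) (by
      intro i j hij
      have hlt : (q i).asIdeal < (q j).asIdeal := q.strictMono hij
      refine lt_of_le_of_ne (Ideal.map_mono hlt.le) fun heq => hlt.ne ?_
      rw [← hcomap i, ← hcomap j]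
      exact congrArg (fun I : PrimeSpectrum (R ⧸ P) => I.asIdeal.comap mk) heq)
  have h1 : (q'.length : ℕ∞) ≤ Order.height q'.last := Order.length_le_height_last
  have hlast : q'.last.asIdeal = q.last.asIdeal.map mk := rfl
  have h2 : q'.last.asIdeal ∈ (Ideal.span ((s.image mk : Finset (R ⧸ P)) :
      Set (R ⧸ P))).minimalPrimes := by
    refine ⟨⟨q'.last.isPrime, ?_⟩, fun Q hQ hle' => ?_⟩
    · rw [hlast, Ideal.span_le, Finset.coe_image]
      rintro _ ⟨a, ha, rfl⟩
      exact Ideal.mem_map_of_mem _ (h.1.2 (Ideal.mem_sup_right (Ideal.subset_span ha)))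
    · have hQp := hQ.1
      have h3 : q.last.asIdeal ≤ Q.comap mk := by
        refine h.2 ⟨Ideal.comap_isPrime mk Q, sup_le ?_ (Ideal.span_le.2 fun a ha => ?_)⟩ ?_
        · intro a ha
          rw [Ideal.mem_comap, show mk a = 0 from Ideal.Quotient.eq_zero_iff_mem.2 ha]
          exact Q.zero_mem
        · refine hQ.2 (Ideal.subset_span ?_)
          exact Finset.mem_coe.2 (Finset.mem_image_of_mem _ ha)
        · rw [← (show (q.last.asIdeal.map mk).comap mk = q.last.asIdeal from hcomap _)]
          exact Ideal.comap_mono hle'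
      rw [hlast]
      exact Ideal.map_le_iff_le_comap.2 h3
  have h3 := Ideal.height_le_card_of_mem_minimalPrimes_span_finset h2
  have h4 : q'.last.asIdeal.height = Order.height q'.last :=
    PrimeSpectrum.height_eq_orderHeight _
  rw [h4] at h3
  have h5 : (q.length : ℕ∞) ≤ (s.image mk).card := h1.trans h3
  have h6 : q.length ≤ (s.image mk).card := by exact_mod_cast h5
  exact h6.trans Finset.card_image_le

end Chains

/-! ### Dimension and linear sections of sets of projective points -/

section Dimension

open TopologicalSpace Topology

attribute [local instance] zariskiTopology

variable {k : Type*} [Field k] {n : ℕ}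

/-- The linear forms `c` have no common zero in the set `S` of points of projective space. -/
def ProjMisses (S : Set (ℙ k (Fin n → k))) {m : ℕ} (c : Fin m → Fin n → k) : Prop :=
  ∀ x ∈ S, ¬ ∀ j, c j ⬝ᵥ x.rep = 0

/-- The generic point of an irreducible closed subset of a set of points. -/
def genericPoint {S : Set (ℙ k (Fin n → k))} (Z : IrreducibleCloseds S) :
    PrimeSpectrum (MvPolynomial (Fin n) k) :=
  ⟨PrimeSpectrum.vanishingIdeal ((fun x : S => toSpec x.1) '' Z),
    PrimeSpectrum.isIrreducible_iff_vanishingIdeal_isPrime.1 (Z.isIrreducible.image _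
      (isInducing_toSpec.comp IsInducing.subtypeVal).continuous.continuousOn)⟩

lemma mem_genericPoint {S : Set (ℙ k (Fin n → k))} {Z : IrreducibleCloseds S}
    {f : MvPolynomial (Fin n) k} :
    f ∈ (genericPoint Z).asIdeal ↔ ∀ x ∈ Z, lineHom x.1.rep f = 0 := by
  rw [genericPoint, PrimeSpectrum.mem_vanishingIdeal, Set.forall_mem_image]
  rfl

lemma genericPoint_strictAnti {S : Set (ℙ k (Fin n → k))} :
    StrictAnti (genericPoint (S := S)) := by
  intro Z Z' h
  have hind : IsInducing (fun x : S => toSpec x.1) :=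
    isInducing_toSpec.comp IsInducing.subtypeVal
  have key : ∀ Z : IrreducibleCloseds S, (Z : Set S) =
      (fun x : S => toSpec x.1) ⁻¹' PrimeSpectrum.zeroLocus (genericPoint Z).asIdeal := fun Z => by
    rw [genericPoint, PrimeSpectrum.zeroLocus_vanishingIdeal_eq_closure,
      ← hind.closure_eq_preimage_closure_image, Z.isClosed.closure_eq]
  refine lt_of_le_of_ne (fun f hf => ?_) fun heq => h.ne ?_
  · rw [mem_genericPoint] at hf ⊢
    exact fun x hx => hf x (h.le hx)
  · exact IrreducibleCloseds.ext (by rw [key Z, key Z', heq])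

lemma mk_rep_eq_smul {v : Fin n → k} (hv : v ≠ 0) :
    ∃ a : k, a ≠ 0 ∧ a • v = (Projectivization.mk k v hv).rep := by
  obtain ⟨a, ha⟩ := Projectivization.exists_smul_eq_mk_rep k v hv
  exact ⟨a, a.ne_zero, ha⟩

/-- Vanishing ideals turn the chain into a reversed chain of primes, which extends by the ideal M of
the origin. Missing C, the b linear forms together with the smallest prime of the chain have only
the origin as zero, so M is minimal over them; the height theorem bounds the extended length
p.length + 1 by b. -/
lemma length_lt_of_projMisses [IsAlgClosed k] {S C : Set (ℙ k (Fin n → k))} (hC : IsClosed C)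
    {b : ℕ} {c : Fin b → Fin n → k} (hc : ProjMisses C c) (p : LTSeries (IrreducibleCloseds S))
    (hp : ∀ x ∈ p.last, (x : ℙ k (Fin n → k)) ∈ C) : p.length < b := by
  classical
  let q : LTSeries (PrimeSpectrum (MvPolynomial (Fin n) k)) := LTSeries.mk p.length
    (fun i => genericPoint (p i.rev)) (fun i j hij =>
      genericPoint_strictAnti (p.strictMono (Fin.rev_lt_rev.2 hij)))
  have hker : RingHom.ker (eval (0 : Fin n → k)) =
      Ideal.span (Set.range (X : Fin n → MvPolynomial (Fin n) k)) := by
    rw [ker_eval_eq_span]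
    simp
  let M : PrimeSpectrum (MvPolynomial (Fin n) k) :=
    ⟨RingHom.ker (eval (0 : Fin n → k)), ker_eval_isPrime _⟩
  have hlt : ∀ Z : IrreducibleCloseds S, genericPoint Z < M := by
    intro Z
    obtain ⟨x, hx⟩ := Z.isIrreducible.nonempty
    have hle : (genericPoint Z).asIdeal ≤ M.asIdeal := fun f hf => by
      have := eval_lineHom x.1.rep f 0
      rw [mem_genericPoint.1 hf x hx, Polynomial.eval_zero, zero_smul] at this
      exact this.symm
    obtain ⟨i, hi⟩ := exists_rep_ne_zero x.1
    refine lt_of_le_of_ne hle fun heq => hi ?_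
    have h1 : (X i : MvPolynomial (Fin n) k) ∈ (genericPoint Z).asIdeal := by
      rw [heq]
      change eval 0 (X i) = 0
      simp
    have h2 := eval_lineHom x.1.rep (X i) 1
    rw [mem_genericPoint.1 h1 x hx, Polynomial.eval_zero, one_smul, eval_X] at h2
    exact h2.symm
  let q' := q.snoc M (hlt _)
  have hlast : q'.last = M := RelSeries.last_snoc _ _ _
  have hhead : q'.head = genericPoint p.last := by
    refine (RelSeries.head_snoc _ _ _).trans ?_
    change genericPoint (p (Fin.rev 0)) = _
    rw [Fin.rev_zero]
    rfl
  have hzero : ∀ v : Fin n → k, (∀ f ∈ (genericPoint p.last).asIdeal ⊔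
      Ideal.span (Set.range fun j => linForm (c j)), eval v f = 0) → v = 0 := by
    intro v hv
    by_contra hv0
    obtain ⟨a, ha0, ha⟩ := mk_rep_eq_smul hv0
    have hmem : Projectivization.mk k v hv0 ∈ C := by
      rw [← hC.closure_eq, mem_closure_iff_lineHom]
      intro f hf
      refine lineHom_eq_zero_of_forall fun t => ?_
      rw [← ha, smul_smul]
      -- The polynomial f need not be homogeneous. Vanishing on full lines is stable under the
      -- rescaling f(s·x), which lets the value of f at any multiple of v be read off at v itself.
      set s := t * a
      have h1 : ∀ w : Fin n → k, eval w (aeval (fun i => MvPolynomial.C s * X i) f) =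
          eval (s • w) f := by
        intro w
        have : (aeval w).comp (aeval fun i => MvPolynomial.C s * X i) = aeval (s • w) := by
          ext i
          simp
        have h2 := DFunLike.congr_fun this f
        simpa [MvPolynomial.aeval_eq_eval] using h2
      rw [← h1]
      refine hv _ (Ideal.mem_sup_left (mem_genericPoint.2 fun x hx => ?_))
      refine lineHom_eq_zero_of_forall fun t' => ?_
      rw [h1, smul_smul, ← eval_lineHom, hf _ (hp x hx), Polynomial.eval_zero]
    refine hc _ hmem fun j => ?_
    have := hv _ (Ideal.mem_sup_right (Ideal.subset_span ⟨j, rfl⟩))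
    rw [eval_linForm] at this
    rw [← ha, dotProduct_smul, this, smul_zero]
  obtain ⟨N, hN⟩ := exists_span_X_pow_le hzero
  have hmin := length_le_card_of_mem_minimalPrimes q' (Finset.univ.image fun j => linForm (c j)) (by
    rw [hlast, hhead, Finset.coe_image, Finset.coe_univ, Set.image_univ]
    refine ⟨⟨M.isPrime, sup_le (hlt _).le (Ideal.span_le.2 ?_)⟩, fun Q hQ _ => ?_⟩
    · rintro _ ⟨j, rfl⟩
      change eval 0 (linForm (c j)) = 0
      rw [eval_linForm, dotProduct_zero]
    · have hQp := hQ.1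
      change RingHom.ker (eval (0 : Fin n → k)) ≤ Q
      rw [hker]
      exact Ideal.IsPrime.le_of_pow_le (hN.trans hQ.2))
  have h1 : q'.length = p.length + 1 := rfl
  have h2 : (Finset.univ.image fun j => linForm (c j)).card ≤ b :=
    Finset.card_image_le.trans (by simp)
  omega

lemma projDim_eq (S : Set (ℙ k (Fin n → k))) :
    projDim S = WithBot.recBotCoe (-1) (fun m : ℕ∞ => (m.toNat : ℤ)) (topologicalKrullDim S) := rfl

lemma projDim_le_of_length_lt {S : Set (ℙ k (Fin n → k))} {b : ℕ}
    (h : ∀ p : LTSeries (IrreducibleCloseds S), p.length < b) : projDim S ≤ (b : ℤ) - 1 := by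
  rw [projDim_eq]
  rcases isEmpty_or_nonempty (IrreducibleCloseds S) with he | ⟨⟨Z⟩⟩
  · rw [topologicalKrullDim, Order.krullDim_eq_bot, WithBot.recBotCoe_bot]
    omega
  · have hb : 0 < b := (Nat.zero_le _).trans_lt (h (RelSeries.singleton _ Z))
    have h1 : topologicalKrullDim S ≤ ((b - 1 : ℕ) : ℕ∞) := by
      refine iSup_le fun p => ?_
      have := h p
      exact_mod_cast (by omega : p.length ≤ b - 1)
    revert h1
    generalize topologicalKrullDim S = x
    intro h1
    induction x with
    | bot => rw [WithBot.recBotCoe_bot]; omega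
    | coe x =>
      rw [WithBot.recBotCoe_coe]
      have h2 : x ≤ ((b - 1 : ℕ) : ℕ∞) := WithBot.coe_le_coe.1 h1
      have h3 := ENat.toNat_le_of_le_natCast h2
      omega

/-- A set contained in the union of two closed sets, each of which is missed by `b` linear forms,
has dimension less than `b`. -/
theorem projDim_le_of_subset_union [IsAlgClosed k] {S C₁ C₂ : Set (ℙ k (Fin n → k))}
    (h₁ : IsClosed C₁) (h₂ : IsClosed C₂) (hS : S ⊆ C₁ ∪ C₂) {b : ℕ}
    {c₁ c₂ : Fin b → Fin n → k} (hc₁ : ProjMisses C₁ c₁) (hc₂ : ProjMisses C₂ c₂) :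
    projDim S ≤ (b : ℤ) - 1 := by
  refine projDim_le_of_length_lt fun p => ?_
  have hirr := p.last.isIrreducible.isPreirreducible
  rw [isPreirreducible_iff_isClosed_union_isClosed] at hirr
  rcases hirr _ _ (h₁.preimage continuous_subtype_val) (h₂.preimage continuous_subtype_val)
    (fun x _ => hS x.2) with h | h
  · exact length_lt_of_projMisses h₁ hc₁ p fun x hx => h hx
  · exact length_lt_of_projMisses h₂ hc₂ p fun x hx => h hx

lemma projMisses_univ : ProjMisses (Set.univ : Set (ℙ k (Fin n → k)))
    (fun j => Pi.single j 1 : Fin n → Fin n → k) := by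
  intro x _ h
  obtain ⟨i, hi⟩ := exists_rep_ne_zero x
  exact hi (by simpa using h i)

lemma length_lt_of_isAlgClosed [IsAlgClosed k] {S : Set (ℙ k (Fin n → k))}
    (p : LTSeries (IrreducibleCloseds S)) : p.length < n :=
  length_lt_of_projMisses isClosed_univ projMisses_univ p fun _ _ => Set.mem_univ _

lemma length_le_projDim [IsAlgClosed k] {S : Set (ℙ k (Fin n → k))}
    (p : LTSeries (IrreducibleCloseds S)) : (p.length : ℤ) ≤ projDim S := by
  rw [projDim_eq]
  have h1 : (p.length : WithBot ℕ∞) ≤ topologicalKrullDim S := Order.LTSeries.length_le_krullDim p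
  have h2 : topologicalKrullDim S ≤ (n : ℕ∞) := iSup_le fun q => by
    exact_mod_cast (length_lt_of_isAlgClosed q).le
  revert h1 h2
  generalize topologicalKrullDim S = x
  intro h1 h2
  induction x with
  | bot => simp at h1
  | coe x =>
    rw [WithBot.recBotCoe_coe]
    have h3 : x ≤ (n : ℕ∞) := WithBot.coe_le_coe.1 h2
    have h4 : (p.length : ℕ∞) ≤ x := WithBot.coe_le_coe.1 h1
    lift x to ℕ using ne_top_of_le_ne_top (ENat.natCast_ne_top n) h3
    rw [ENat.toNat_natCast]
    exact_mod_cast h4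

lemma projDim_le_card_sub_one [IsAlgClosed k] (S : Set (ℙ k (Fin n → k))) :
    projDim S ≤ (n : ℤ) - 1 :=
  projDim_le_of_length_lt length_lt_of_isAlgClosed

lemma neg_one_le_projDim (S : Set (ℙ k (Fin n → k))) : -1 ≤ projDim S := by
  rw [projDim_eq]
  generalize topologicalKrullDim S = x
  induction x with
  | bot => rw [WithBot.recBotCoe_bot]
  | coe x => rw [WithBot.recBotCoe_coe]; omega

lemma isClosed_hyperplane [Infinite k] (c : Fin n → k) :
    IsClosed {x : ℙ k (Fin n → k) | c ⬝ᵥ x.rep = 0} := by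
  refine isClosed_of_forall_exists fun y hy => ⟨linForm c, by rwa [eval_linForm], ?_⟩
  intro z hz t
  have hz' : c ⬝ᵥ z.rep = 0 := hz
  rw [eval_linForm, dotProduct_smul, hz', smul_zero]

/-- A set of dimension less than `r` is missed by `r` linear forms. -/
theorem exists_projMisses [IsAlgClosed k] : ∀ (r : ℕ) (S : Set (ℙ k (Fin n → k))),
    (∀ p : LTSeries (IrreducibleCloseds S), p.length < r) →
      ∃ c : Fin r → Fin n → k, ProjMisses S c
  | 0, S, h => by
    refine ⟨Fin.elim0, fun x hx _ => ?_⟩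
    let Z : IrreducibleCloseds S := ⟨closure {⟨x, hx⟩}, isIrreducible_singleton.closure,
      isClosed_closure⟩
    exact absurd (h (RelSeries.singleton _ Z)) (by simp)
  | r + 1, S, h => by
    classical
    have hno : NoetherianSpace (ℙ k (Fin n → k)) := noetherianSpace
    have hfin : (irreducibleComponents S).Finite := NoetherianSpace.finite_irreducibleComponents
    have hne : ∀ Y : irreducibleComponents S, ∃ x : S, x ∈ Y.1 := fun Y => Y.2.1.nonempty
    choose y hy using hne
    have := hfin.to_subtype
    -- One hyperplane missing a chosen point of every irreducible component. A chain in the section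
    -- S' can then be lengthened by a component of S, so chains in S' are shorter by one.
    obtain ⟨f, hf⟩ := Module.exists_dual_forall_apply_ne_zero (K := k)
      (fun Y => (y Y).1.rep) (fun Y => (y Y).1.rep_nonzero)
    obtain ⟨c, hc⟩ : ∃ c : Fin n → k, ∀ v, f v = c ⬝ᵥ v := by
      refine ⟨fun i => f (Pi.single i 1), fun v => ?_⟩
      conv_lhs => rw [pi_eq_sum_univ' v]
      rw [map_sum]
      simp [dotProduct, mul_comm]
    have hcl := isClosed_hyperplane (k := k) c
    let S' : Set (ℙ k (Fin n → k)) := S ∩ {x | c ⬝ᵥ x.rep = 0}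
    obtain ⟨c', hc'⟩ := exists_projMisses r S' fun p => by
      let ι : S' → S := Set.inclusion Set.inter_subset_left
      have hι : IsInducing ι := (IsEmbedding.inclusion Set.inter_subset_left).isInducing
      have hs := IrreducibleCloseds.map_strictMono_of_isInducing hι
      let p' := p.map _ hs
      obtain ⟨Y, hY, hpY⟩ := exists_mem_irreducibleComponents_subset_of_isIrreducible
        (p'.last : Set S) p'.last.isIrreducible
      let Y' : IrreducibleCloseds S := ⟨Y, hY.1, isClosed_of_mem_irreducibleComponents Y hY⟩
      have hsub : (p'.last : Set S) ⊆ Subtype.val ⁻¹' {x | c ⬝ᵥ x.rep = 0} := by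
        have hlast : (p'.last : Set S) = closure (ι '' (p.last : Set S')) := rfl
        rw [hlast]
        refine closure_minimal ?_ (hcl.preimage continuous_subtype_val)
        rintro _ ⟨x, _, rfl⟩
        exact x.2.2
      have hlt : p'.last < Y' := by
        refine lt_of_le_of_ne hpY fun heq => hf ⟨Y, hY⟩ ?_
        have hmem : y ⟨Y, hY⟩ ∈ (p'.last : Set S) := by
          rw [heq]
          exact hy ⟨Y, hY⟩
        rw [hc]
        exact hsub hmem
      have := h (p'.snoc Y' hlt)
      have h2 : (p'.snoc Y' hlt).length = p.length + 1 := rfl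
      omega
    refine ⟨Fin.cons c c', fun x hx hall => ?_⟩
    have h0 : c ⬝ᵥ x.rep = 0 := by simpa using hall 0
    exact hc' x ⟨hx, h0⟩ fun j => by simpa using hall j.succ

theorem exists_projMisses_of_projDim_le [IsAlgClosed k] {r : ℕ} {S : Set (ℙ k (Fin n → k))}
    (h : projDim S ≤ (r : ℤ) - 1) : ∃ c : Fin r → Fin n → k, ProjMisses S c :=
  exists_projMisses r S fun p => by
    have := length_le_projDim p
    omega

/-- The projection of a critical locus to the second factor is closed. -/
theorem isClosed_exists_crit [IsAlgClosed k] {r a : ℕ} {E : Fin r → MvPolynomial (Fin n) k}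
    {G : MvPolynomial (Fin n) k} {e : Fin r → ℕ} {g : ℕ} (hE : ∀ j, (E j).IsHomogeneous (e j))
    (hG : G.IsHomogeneous g) (u : Fin a → Fin n → k) :
    IsClosed {z : ℙ k (Fin n → k) | ∃ x : Fin n → k, x ≠ 0 ∧ (∀ j, u j ⬝ᵥ x = 0) ∧
      Crit E G x z.rep} := by
  have heval : ∀ (x z : Fin n → k), (∀ s, biEval (RingHom.id k) x z (critEqn E G s) = 0) ↔
      Crit E G x z := fun x z => by
    rw [forall_map_critEqn_eq_zero_iff, biEval_comp_C_comp_C]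
    simp [MvPolynomial.map_id]
  refine isClosed_of_forall_exists fun y hy => ?_
  let f : (Fin r ⊕ (Fin (r + 1) → Fin n)) ⊕ Fin a → BiPoly n k :=
    Sum.elim (critEqn E G) fun j => linForm fun i => C (u j i)
  have hlin : ∀ (x z : Fin n → k) j,
      biEval (RingHom.id k) x z (linForm fun i => C (u j i)) = u j ⬝ᵥ x := fun x z j => by
    simp [linForm, biEval, dotProduct]
  have hmap : ∀ (x z : Fin n → k) (p : BiPoly n k),
      eval x (map (eval z) p) = biEval (RingHom.id k) x z p := fun x z p => by
    have : (eval x).comp (map (eval z)) = biEval (RingHom.id k) x z := by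
      ext i <;> simp [biEval]
    exact RingHom.congr_fun this p
  -- At y outside the set the system in x has only the trivial zero, so some eliminant α does not
  -- vanish at y. If z is in the set, a zero x with x_i ≠ 0 forces α · x_i^N, and hence α, to vanish
  -- at every multiple of z.
  obtain ⟨α, N, hα, hN⟩ := exists_eliminant (eval y.rep) (f := f)
    (e := Sum.elim (Sum.elim e
      (fun _ => ∑ i, (Fin.cons (g - 1 - 1) (fun j => e j - 1) : Fin (r + 1) → ℕ) i)) fun _ => 1) (by
      rintro (s | j)
      · exact critEqn_isHomogeneous hE hG s
      · exact linForm_isHomogeneous _) (by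
      intro x hx
      by_contra hx0
      refine hy ⟨x, hx0, fun j => ?_, (heval _ _).1 fun s => ?_⟩
      · rw [← hlin x y.rep j, ← hmap]
        exact hx (Sum.inr j)
      · rw [← hmap]
        exact hx (Sum.inl s))
  refine ⟨α, hα, ?_⟩
  rintro z ⟨x, hx0, hxu, hx⟩ t
  obtain ⟨i, hi⟩ := Function.ne_iff.1 hx0
  have h1 : Ideal.span (Set.range f) ≤ RingHom.ker (biEval (RingHom.id k) x (t • z.rep)) := by
    rw [Ideal.span_le]
    rintro _ ⟨s | j, rfl⟩
    · have := hx.smul hE hG 1 t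
      rw [one_smul] at this
      exact (heval _ _).2 this s
    · rw [SetLike.mem_coe, RingHom.mem_ker]
      exact (hlin _ _ _).trans (hxu j)
  have h2 := h1 (hN i)
  rw [RingHom.mem_ker, map_mul, map_pow, biEval_X] at h2
  have h3 : biEval (RingHom.id k) x (t • z.rep) (C α) = eval (t • z.rep) α := by
    rw [← hmap]
    simp
  rw [h3] at h2
  exact (mul_eq_zero.1 h2).resolve_right (pow_ne_zero _ hi)

/-- A critical locus is closed. -/
theorem isClosed_crit [Infinite k] {r : ℕ} {E : Fin r → MvPolynomial (Fin n) k}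
    {G : MvPolynomial (Fin n) k} {e : Fin r → ℕ} {g : ℕ} (hE : ∀ j, (E j).IsHomogeneous (e j))
    (hG : G.IsHomogeneous g) (z : Fin n → k) :
    IsClosed {x : ℙ k (Fin n → k) | Crit E G x.rep z} := by
  have heval : ∀ x : Fin n → k, (∀ s, eval x (map (eval z) (critEqn E G s)) = 0) ↔
      Crit E G x z := fun x => by
    have := forall_map_critEqn_eq_zero_iff E G ((eval x).comp (map (eval z)))
    rw [show ((eval x).comp (map (eval z))).comp (C.comp C) = RingHom.id k by ext; simp] at this
    simpa [MvPolynomial.map_id] using this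
  refine isClosed_of_forall_exists fun y hy => ?_
  have hy' : ¬ Crit E G y.rep z := hy
  rw [← heval, not_forall] at hy'
  obtain ⟨s, hs⟩ := hy'
  refine ⟨_, hs, fun x hx t => ?_⟩
  have h1 : Crit E G x.rep z := hx
  have h2 := h1.smul hE hG t 1
  rw [one_smul] at h2
  exact (heval _).2 h2 s

end Dimension

/-! ### Directional derivatives and Euler's relations -/

section DirectionalDerivative

variable {k : Type*} [Field k] {n : ℕ}

lemma dirDeriv_isHomogeneous {G : MvPolynomial (Fin n) k} {g : ℕ} (hG : G.IsHomogeneous g)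
    (y : Fin n → k) : (dirDeriv y G).IsHomogeneous (g - 1) :=
  IsHomogeneous.sum _ _ _ fun i _ => hG.pderiv.C_mul (y i)

lemma grad_dirDeriv (G : MvPolynomial (Fin n) k) (x y : Fin n → k) :
    grad (dirDeriv y G) x = hessMul G x y := by
  ext i
  simp [grad, dirDeriv, hessMul, map_sum, Derivation.leibniz]

lemma pderiv_pderiv_comm (i l : Fin n) (G : MvPolynomial (Fin n) k) :
    pderiv i (pderiv l G) = pderiv l (pderiv i G) := by
  have h : ⁅pderiv (R := k) i, pderiv (R := k) l⁆ = 0 := by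
    refine MvPolynomial.derivation_ext fun j => ?_
    rw [Derivation.commutator_apply, pderiv_X, pderiv_X]
    simp [Pi.single_apply, apply_ite]
  have h2 := DFunLike.congr_fun h G
  rwa [Derivation.commutator_apply, Derivation.zero_apply, sub_eq_zero] at h2

lemma hessMul_self {G : MvPolynomial (Fin n) k} {g : ℕ} (hG : G.IsHomogeneous g) (y : Fin n → k) :
    hessMul G y y = ((g - 1 : ℕ) : k) • grad G y := by
  ext i
  have h := dotProduct_grad (hG.pderiv (i := i)) y
  rw [Pi.smul_apply, smul_eq_mul]
  rw [show grad G y i = eval y (pderiv i G) from rfl, ← h, dotProduct]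
  refine Finset.sum_congr rfl fun l _ => ?_
  have hcomm : pderiv i (pderiv l G) = pderiv l (pderiv i G) := pderiv_pderiv_comm i l G
  rw [hcomm]
  rfl

lemma grad_smul {G : MvPolynomial (Fin n) k} {g : ℕ} (hG : G.IsHomogeneous g) (a : k)
    (x : Fin n → k) : grad G (a • x) = a ^ (g - 1) • grad G x := by
  ext i
  exact eval_smul_of_isHomogeneous hG.pderiv a x

/-- By Euler's relation the gradient of F^y at the point y itself equals (d - 1)∇F(y). -/
lemma dirDeriv_ne_zero {F : MvPolynomial (Fin n) k} {d : ℕ} (hF : F.IsHomogeneous d)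
    (hd : ((d - 1 : ℕ) : k) ≠ 0) (hg : ∀ x, grad F x = 0 → x = 0) {y : Fin n → k} (hy : y ≠ 0) :
    dirDeriv y F ≠ 0 := by
  intro h
  have h1 := grad_dirDeriv F y y
  rw [h, hessMul_self hF] at h1
  have h2 : grad (0 : MvPolynomial (Fin n) k) y = 0 := by ext i; simp [grad]
  rw [h2] at h1
  exact hy (hg y ((smul_eq_zero.1 h1.symm).resolve_left hd))

/-- The gradient of G^z at x is Hess G(x)z, so the two matrices agree. The equation G^z(x) = 0 is
discarded: critical loci only bound singular loci from above. -/
lemma crit_of_jacSing_cons {r : ℕ} {E : Fin r → MvPolynomial (Fin n) k}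
    {G : MvPolynomial (Fin n) k} {x z : Fin n → k}
    (h : JacSing (Fin.cons (dirDeriv z G) E : Fin (r + 1) → MvPolynomial (Fin n) k) x) :
    Crit E G x z := by
  rw [jacSing_iff] at h
  rw [crit_iff]
  refine ⟨fun j => by simpa using h.1 j.succ, fun hli => h.2 ?_⟩
  convert hli using 1
  ext j : 1
  refine Fin.cases ?_ (fun j => ?_) j
  · simp [grad_dirDeriv]
  · simp

end DirectionalDerivative

/-! ### From generic linear forms to the dimensions of the loci -/

section Loci

attribute [local instance] zariskiTopology MvPolynomial.gradedAlgebra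

variable {k : Type*} [Field k] {n : ℕ}

lemma sing_subset_crit [Infinite k] {r : ℕ} {E : Fin r → MvPolynomial (Fin n) k}
    {G : MvPolynomial (Fin n) k} {e : Fin r → ℕ} {g : ℕ} (hE : ∀ j, (E j).IsHomogeneous (e j))
    (hG : G.IsHomogeneous g) (z : Fin n → k) :
    Sing (insert (dirDeriv z G) (Set.range E)) ⊆ {x | Crit E G x.rep z} := by
  intro x hx
  refine crit_of_jacSing_cons (jacSing_of_mem_sing (fun j => ?_) ?_)
  · refine Fin.cases ?_ (fun j => ?_) j
    · exact ⟨_, dirDeriv_isHomogeneous hG z⟩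
    · exact ⟨_, hE j⟩
  · rwa [Fin.range_cons]

/-- Otherwise a linear forms would miss a closed set containing the singular locus, whose dimension
would then be at most a - 1. -/
lemma exists_crit_of_le_projDim [IsAlgClosed k] {r a : ℕ} {E : Fin r → MvPolynomial (Fin n) k}
    {G : MvPolynomial (Fin n) k} {e : Fin r → ℕ} {g : ℕ} (hE : ∀ j, (E j).IsHomogeneous (e j))
    (hG : G.IsHomogeneous g) (u : Fin a → Fin n → k) {z : Fin n → k}
    (h : (a : ℤ) ≤ projDim (Sing (insert (dirDeriv z G) (Set.range E)))) :
    ∃ x : Fin n → k, x ≠ 0 ∧ (∀ j, u j ⬝ᵥ x = 0) ∧ Crit E G x z := by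
  by_contra! hcon
  have hm : ProjMisses {x : ℙ k (Fin n → k) | Crit E G x.rep z} u := fun x hx hu =>
    hcon x.rep x.rep_nonzero hu hx
  have hcl := isClosed_crit hE hG z
  have := projDim_le_of_subset_union hcl hcl
    ((sing_subset_crit hE hG z).trans Set.subset_union_left) hm hm
  omega

lemma projMisses_of_avoids {r a b : ℕ} {E : Fin r → MvPolynomial (Fin n) k}
    {G : MvPolynomial (Fin n) k} {u : Fin a → Fin n → k} {w : Fin b → Fin n → k}
    (h : Avoids E G u w) :
    ProjMisses {z : ℙ k (Fin n → k) | ∃ x : Fin n → k, x ≠ 0 ∧ (∀ j, u j ⬝ᵥ x = 0) ∧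
      Crit E G x z.rep} w := by
  rintro z ⟨x, hx0, hxu, hx⟩ hz
  exact h x z.rep hx0 z.rep_nonzero hx hxu hz

lemma sing_singleton_eq_empty [Infinite k] {F : MvPolynomial (Fin n) k} {d : ℕ}
    (hF : F.IsHomogeneous d) (hg : ∀ x, grad F x = 0 → x = 0) : Sing {F} = ∅ := by
  rw [Set.eq_empty_iff_forall_notMem]
  intro x hx
  have hx' : x ∈ Sing (Set.range ![F]) := by simpa using hx
  have h := jacSing_of_mem_sing (fun j => ⟨d, by fin_cases j; exact hF⟩) hx'
  rw [jacSing_iff] at h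
  refine h.2 ?_
  rw [linearIndependent_unique_iff]
  exact fun h0 => x.rep_nonzero (hg _ h0)

lemma sing_insert_zero (E : Set (MvPolynomial (Fin n) k)) : Sing (insert 0 E) = Sing E := by
  have h : ∀ x : ℙ k (Fin n → k), localIdeal (insert 0 E) x = localIdeal E x := fun x => by
    rw [localIdeal, localIdeal, Ideal.span_insert_zero]
  ext x
  have h2 : ∀ I J : Ideal (LocalRingAt x), I = J →
      (IsRegularLocalRing (LocalRingAt x ⧸ I) ↔ IsRegularLocalRing (LocalRingAt x ⧸ J)) := by
    rintro I _ rfl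
    rfl
  simp only [Sing, Set.mem_ofPred_eq, Set.forall_mem_insert, map_zero, true_and, h2 _ _ (h x)]

lemma sing_empty [Infinite k] : Sing (∅ : Set (MvPolynomial (Fin n) k)) = ∅ := by
  rw [Set.eq_empty_iff_forall_notMem]
  intro x hx
  have hx' : x ∈ Sing (Set.range (Fin.elim0 : Fin 0 → MvPolynomial (Fin n) k)) := by
    rwa [Set.range_eq_empty]
  have h := jacSing_of_mem_sing (fun j => j.elim0) hx'
  rw [jacSing_iff] at h
  exact h.2 (linearIndependent_empty_type)

lemma projDim_empty : projDim (∅ : Set (ℙ k (Fin n → k))) = -1 := by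
  refine le_antisymm ?_ (neg_one_le_projDim _)
  have := projDim_le_of_length_lt (S := (∅ : Set (ℙ k (Fin n → k)))) (b := 0) fun p => by
    obtain ⟨x, -⟩ := p.last.isIrreducible.nonempty
    exact x.2.elim
  simpa using this

lemma dirDeriv_zero_left (F : MvPolynomial (Fin n) k) : dirDeriv 0 F = 0 := by
  simp [dirDeriv]

lemma dirDeriv_zero_right (y : Fin n → k) : dirDeriv y (0 : MvPolynomial (Fin n) k) = 0 := by
  simp [dirDeriv]

/-- The bound for the dimension of the set of directions in which the derivative is very singular,
given sufficiently general linear forms. -/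
theorem projDim_sigmaLocus_le [IsAlgClosed k] {F : MvPolynomial (Fin n) k} {d : ℕ}
    (hF : F.IsHomogeneous d) {a b : ℕ} {u u' : Fin a → Fin n → k} {w w' : Fin b → Fin n → k}
    (h : Avoids (Fin.elim0 : Fin 0 → MvPolynomial (Fin n) k) F u w) (h' : Avoids ![F] F u' w') :
    projDim (sigmaLocus F a) ≤ (b : ℤ) - 1 := by
  have hE : ∀ j : Fin 0, ((Fin.elim0 j : MvPolynomial (Fin n) k)).IsHomogeneous
    ((Fin.elim0 : Fin 0 → ℕ) j) := fun j => j.elim0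
  have hE' : ∀ j : Fin 1, (![F] j).IsHomogeneous (![d] j) := fun j => by fin_cases j; exact hF
  refine projDim_le_of_subset_union (isClosed_exists_crit hE hF u) (isClosed_exists_crit hE' hF u')
    (fun y hy => ?_) (projMisses_of_avoids h) (projMisses_of_avoids h')
  rcases le_max_iff.1 (show (a : ℤ) ≤ max _ _ from hy) with h1 | h1
  · right
    refine exists_crit_of_le_projDim hE' hF u' ?_
    rwa [Matrix.range_cons, Matrix.range_empty, Set.union_empty, Set.pair_comm]
  · left
    refine exists_crit_of_le_projDim hE hF u ?_
    rwa [Set.range_eq_empty, insert_empty_eq]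

/-- The bound for the dimension of the set of second directions, given sufficiently general linear
forms. -/
theorem projDim_diffLocus_le [IsAlgClosed k] {F : MvPolynomial (Fin n) k} {d : ℕ}
    (hF : F.IsHomogeneous d) {y : Fin n → k} {a b : ℕ} {u : Fin a → Fin n → k}
    {w : Fin b → Fin n → k} (h : Avoids ![F, dirDeriv y F] (dirDeriv y F) u w) :
    projDim (diffLocus F y a) ≤ (b : ℤ) - 1 := by
  have hG := dirDeriv_isHomogeneous hF y
  have hE : ∀ j : Fin 2, (![F, dirDeriv y F] j).IsHomogeneous (![d, d - 1] j) := fun j => by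
    fin_cases j
    exacts [hF, hG]
  have hcl := isClosed_exists_crit hE hG u
  refine projDim_le_of_subset_union hcl hcl (fun z hz => Or.inl ?_) (projMisses_of_avoids h)
    (projMisses_of_avoids h)
  refine exists_crit_of_le_projDim hE hG u ?_
  have hz' : (a : ℤ) ≤ projDim (Sing {F, dirDeriv y F, dirDeriv z.rep (dirDeriv y F)}) := hz
  convert hz' using 3
  rw [Matrix.range_cons, Matrix.range_cons, Matrix.range_empty, Set.union_empty]
  ext f
  simp only [Set.mem_insert_iff, Set.mem_union, Set.mem_singleton_iff]
  tauto

/-- Since d - 1 is nonzero in k, Euler's relation puts the zeros of ∇F^y on F^y = 0, where they are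
singular points; by hypothesis these have dimension at most m - 1. -/
lemma exists_misses_grad_dirDeriv [IsAlgClosed k] {F : MvPolynomial (Fin n) k} {d : ℕ}
    (hF : F.IsHomogeneous d) (hd : ((d - 1 : ℕ) : k) ≠ 0) (hg : ∀ x, grad F x = 0 → x = 0)
    {y : Fin n → k} (hy : y ≠ 0) {m : ℕ} (hm : sigma F y ≤ (m : ℤ) - 1) :
    ∃ c : Fin m → Fin n → k, Misses {x | grad (dirDeriv y F) x = 0} c := by
  obtain ⟨c, hc⟩ := exists_projMisses_of_projDim_le ((le_max_right _ _).trans hm)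
  refine ⟨c, fun x hx hcx => ?_⟩
  by_contra hx0
  obtain ⟨a, -, ha⟩ := mk_rep_eq_smul hx0
  have hG := dirDeriv_isHomogeneous hF y
  have h1 : grad (dirDeriv y F) (Projectivization.mk k x hx0).rep = 0 := by
    rw [← ha, grad_smul hG, show grad (dirDeriv y F) x = 0 from hx, smul_zero]
  refine hc (Projectivization.mk k x hx0) (mem_sing_singleton hG (dirDeriv_ne_zero hF hd hg hy)
    ?_ h1) fun j => by rw [← ha, dotProduct_smul, hcx j, smul_zero]
  have h2 := dotProduct_grad hG (Projectivization.mk k x hx0).rep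
  rw [h1, dotProduct_zero] at h2
  exact (mul_eq_zero.1 h2.symm).resolve_left hd

/-- Points with dependent gradients are singular on V(F, F^y) because it is a genuine
codimension-two intersection: F is irreducible, and F does not divide the nonzero form F^y of
smaller degree. Moreover ∇F ≠ 0 at each such point. -/
lemma exists_misses_jacSing [IsAlgClosed k] (hn : 3 ≤ n) {F : MvPolynomial (Fin n) k} {d : ℕ}
    (hF : F.IsHomogeneous d) (hd0 : 0 < d) (hd : ((d - 1 : ℕ) : k) ≠ 0)
    (hg : ∀ x, grad F x = 0 → x = 0)
    {y : Fin n → k} (hy : y ≠ 0) {m : ℕ} (hm : sigma F y ≤ (m : ℤ) - 1) :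
    ∃ c : Fin m → Fin n → k, Misses {x | JacSing ![F, dirDeriv y F] x} c := by
  obtain ⟨c, hc⟩ := exists_projMisses_of_projDim_le ((le_max_left _ _).trans hm)
  refine ⟨c, fun x hx hcx => ?_⟩
  by_contra hx0
  obtain ⟨a, ha0, ha⟩ := mk_rep_eq_smul hx0
  have hG := dirDeriv_isHomogeneous hF y
  have hG0 := dirDeriv_ne_zero hF hd hg hy
  have hirr := irreducible_of_grad_ne_zero hn hd0 hF hg
  have hndvd : ¬ F ∣ dirDeriv y F := by
    rintro ⟨q, hq⟩
    have hq0 : q ≠ 0 := by rintro rfl; rw [mul_zero] at hq; exact hG0 hq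
    have h1 := totalDegree_mul_of_isDomain hirr.ne_zero hq0
    rw [← hq, hG.totalDegree hG0, hF.totalDegree hirr.ne_zero] at h1
    omega
  obtain ⟨hx1, hx2⟩ := jacSing_iff.1 (show JacSing ![F, dirDeriv y F] x from hx)
  have hFx : grad F x ≠ 0 := fun h => hx0 (hg x h)
  have hdep : ∃ t : k, t • grad F x = grad (dirDeriv y F) x := by
    by_contra! hcon
    refine hx2 ?_
    have h2 := (LinearIndependent.pair_iff' hFx).2 hcon
    have h3 : (fun j => grad (![F, dirDeriv y F] j) x) =
        ![grad F x, grad (dirDeriv y F) x] := by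
      ext j : 1
      fin_cases j <;> rfl
    rw [h3]
    exact h2
  obtain ⟨t, ht⟩ := hdep
  have hgF : grad F (a • x) ≠ 0 := by
    rw [grad_smul hF]
    exact smul_ne_zero (pow_ne_zero _ ha0) hFx
  refine hc (Projectivization.mk k x hx0) (mem_sing_pair hF hG hirr.prime hndvd ?_ ?_ ?_ ?_)
    fun j => by rw [← ha, dotProduct_smul, hcx j, smul_zero]
  · rw [← ha, eval_smul_of_isHomogeneous hF, show eval x F = 0 from hx1 0, mul_zero]
  · rw [← ha, eval_smul_of_isHomogeneous hG, show eval x (dirDeriv y F) = 0 from hx1 1, mul_zero]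
  · rwa [← ha]
  · refine ⟨a ^ (d - 1 - 1) * t * (a ^ (d - 1))⁻¹, ?_⟩
    rw [← ha, grad_smul hF, grad_smul hG, ← ht, smul_smul, smul_smul]
    congr 1
    field_simp

end Loci

/-! ### The three conditions at large primes -/

section LargePrimes

/-- For large primes, a form with nowhere vanishing gradient satisfies all the conditions. -/
theorem exists_good_of_large_prime {n d : ℕ} (hn : 3 ≤ n) (hd : 3 ≤ d) :
    ∃ N : ℕ, ∀ (p : ℕ) [Fact p.Prime], N < p →
      ∀ F : MvPolynomial (Fin n) (AlgebraicClosure (ZMod p)), F.IsHomogeneous d →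
        (∀ x, grad F x = 0 → x = 0) →
        IsNonsingularHypersurface F ∧
        (∀ s : ℤ, -1 ≤ s → s ≤ (n : ℤ) - 1 → projDim (sigmaLocus F s) ≤ (n : ℤ) - 2 - s) ∧
        ∀ (y : Fin n → AlgebraicClosure (ZMod p)) (s : ℤ), -1 ≤ s → s ≤ (n : ℤ) - 1 →
          projDim (diffLocus F y (sigma F y + s + 1)) ≤ (n : ℤ) - 2 - s := by
  -- Thresholds for the three applications: E empty and E = (F) with G = F and m = 0, for V(F^y) and
  -- V(F, F^y); then E = (F, F^y) with G = F^y. Each time b = n - 1 - s.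
  have H0 : ∀ s, ∃ N, s < n → _ := fun s => by
    by_cases hs : s < n
    · obtain ⟨N, hN⟩ := exists_avoids_of_large_prime n (Fin.elim0 : Fin 0 → ℕ) (g := d) (by omega)
        0 s (n - 1 - s) (by omega)
      exact ⟨N, fun _ => hN⟩
    · exact ⟨0, fun h => absurd h hs⟩
  have H1 : ∀ s, ∃ N, s < n → _ := fun s => by
    by_cases hs : s < n
    · obtain ⟨N, hN⟩ := exists_avoids_of_large_prime n ![d] (g := d) (by omega)
        0 s (n - 1 - s) (by omega)
      exact ⟨N, fun _ => hN⟩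
    · exact ⟨0, fun h => absurd h hs⟩
  have H2 : ∀ m s, ∃ N, s < n → _ := fun m s => by
    by_cases hs : s < n
    · obtain ⟨N, hN⟩ := exists_avoids_of_large_prime n ![d, d - 1] (g := d - 1) (by omega)
        m (m + s) (n - 1 - s) (by omega)
      exact ⟨N, fun _ => hN⟩
    · exact ⟨0, fun h => absurd h hs⟩
  choose N0 hN0 using H0
  choose N1 hN1 using H1
  choose N2 hN2 using H2
  -- The parameter m = σ_y + 1 runs from 0 to n, hence the range n + 1. The summand d ensures that p
  -- does not divide d - 1.
  refine ⟨d + ∑ s ∈ Finset.range n, N0 s + ∑ s ∈ Finset.range n, N1 s +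
    ∑ m ∈ Finset.range (n + 1), ∑ s ∈ Finset.range n, N2 m s, fun p _ hp F hF hg => ?_⟩
  have hle0 : ∀ s < n, N0 s ≤ ∑ s ∈ Finset.range n, N0 s := fun s hs =>
    Finset.single_le_sum (f := N0) (fun _ _ => Nat.zero_le _) (Finset.mem_range.2 hs)
  have hle1 : ∀ s < n, N1 s ≤ ∑ s ∈ Finset.range n, N1 s := fun s hs =>
    Finset.single_le_sum (f := N1) (fun _ _ => Nat.zero_le _) (Finset.mem_range.2 hs)
  have hle2 : ∀ m < n + 1, ∀ s < n,
      N2 m s ≤ ∑ m ∈ Finset.range (n + 1), ∑ s ∈ Finset.range n, N2 m s := fun m hm s hs =>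
    (Finset.single_le_sum (f := N2 m) (fun _ _ => Nat.zero_le _) (Finset.mem_range.2 hs)).trans
      (Finset.single_le_sum (f := fun m => ∑ s ∈ Finset.range n, N2 m s)
        (fun _ _ => Nat.zero_le _) (Finset.mem_range.2 hm))
  have hchar : ((d - 1 : ℕ) : AlgebraicClosure (ZMod p)) ≠ 0 := by
    have : CharP (AlgebraicClosure (ZMod p)) p :=
      charP_of_injective_algebraMap (algebraMap (ZMod p) (AlgebraicClosure (ZMod p))).injective p
    rw [Ne, CharP.cast_eq_zero_iff _ p]
    intro h
    have := Nat.le_of_dvd (by omega) h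
    omega
  have hm0 : ∀ {S : Set (Fin n → AlgebraicClosure (ZMod p))}, (∀ x ∈ S, x = 0) →
      Misses S (Fin.elim0 : Fin 0 → Fin n → AlgebraicClosure (ZMod p)) := fun h x hx _ => h x hx
  refine ⟨⟨(irreducible_of_grad_ne_zero hn (by omega) hF hg).ne_zero,
    sing_singleton_eq_empty hF hg⟩, fun s hs hs' => ?_, fun y s hs hs' => ?_⟩
  -- For s = -1 the claim is the trivial bound n - 1.
  · rcases hs.eq_or_lt with rfl | hs
    · have := projDim_le_card_sub_one (sigmaLocus F (-1))
      omega
    · lift s to ℕ using by omega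
      have hsn : s < n := by omega
      have h0 := hle0 s hsn
      have h1 := hle1 s hsn
      obtain ⟨u, w, h⟩ := hN0 s hsn p (by omega) Fin.elim0 F (fun j => j.elim0) hF Fin.elim0
        Fin.elim0 (hm0 hg) (hm0 fun x hx =>
          absurd linearIndependent_empty_type (jacSing_iff.1 hx).2)
      obtain ⟨u', w', h'⟩ := hN1 s hsn p (by omega) ![F] F (fun j => by fin_cases j; exact hF) hF
        Fin.elim0 Fin.elim0 (hm0 hg) (hm0 fun x hx => by
          by_contra hx0
          refine (jacSing_iff.1 hx).2 ?_
          rw [linearIndependent_unique_iff]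
          exact fun h0 => hx0 (hg _ h0))
      have := projDim_sigmaLocus_le hF h h'
      omega
  · rcases hs.eq_or_lt with rfl | hs
    · have := projDim_le_card_sub_one (diffLocus F y (sigma F y + -1 + 1))
      omega
    lift s to ℕ using by omega
    have hsn : s < n := by omega
    -- For y = 0 all derivatives vanish. Then V(F, 0, 0) = V(F) is smooth and σ = -1, so the locus
    -- is empty once s ≥ 0.
    by_cases hy : y = 0
    · subst hy
      have hsing : Sing {F, (0 : MvPolynomial (Fin n) (AlgebraicClosure (ZMod p)))} = ∅ := by
        rw [Set.pair_comm, sing_insert_zero, sing_singleton_eq_empty hF hg]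
      have hsing' : Sing {(0 : MvPolynomial (Fin n) (AlgebraicClosure (ZMod p)))} = ∅ := by
        rw [← insert_empty_eq, sing_insert_zero, sing_empty]
      have hsig : sigma F 0 = -1 := by
        rw [sigma, dirDeriv_zero_left, hsing, hsing', projDim_empty, max_self]
      have hdiff : diffLocus F 0 (sigma F 0 + s + 1) = ∅ := by
        rw [Set.eq_empty_iff_forall_notMem]
        intro z hz
        have hz' : sigma F 0 + s + 1 ≤ projDim (Sing {F, dirDeriv 0 F,
          dirDeriv z.rep (dirDeriv 0 F)}) := hz
        rw [hsig, dirDeriv_zero_left, dirDeriv_zero_right, Set.pair_eq_singleton, hsing,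
          projDim_empty] at hz'
        omega
      rw [hdiff, projDim_empty]
      omega
    · have hsig1 : -1 ≤ sigma F y := (neg_one_le_projDim _).trans (le_max_left _ _)
      have hsig2 : sigma F y ≤ n - 1 :=
        max_le (projDim_le_card_sub_one _) (projDim_le_card_sub_one _)
      obtain ⟨m, hm⟩ : ∃ m : ℕ, sigma F y = (m : ℤ) - 1 := ⟨(sigma F y + 1).toNat, by omega⟩
      have hmn : m < n + 1 := by omega
      obtain ⟨c, hc⟩ := exists_misses_grad_dirDeriv hF hchar hg hy hm.le
      obtain ⟨c', hc'⟩ := exists_misses_jacSing hn hF (by omega) hchar hg hy hm.le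
      have h2 := hle2 m hmn s hsn
      have hG := dirDeriv_isHomogeneous hF y
      obtain ⟨u, w, h⟩ := hN2 m s hsn p (by omega) ![F, dirDeriv y F] (dirDeriv y F)
        (fun j => by fin_cases j; exacts [hF, hG]) hG c c' hc hc'
      have := projDim_diffLocus_le hF h
      rw [hm, show (m : ℤ) - 1 + s + 1 = ((m + s : ℕ) : ℤ) by push_cast; ring]
      omega

end LargePrimes

/-! ### Eliminants of the general form and their size -/

section Discriminant

variable {n d : ℕ}

/-- The monomials of degree `d` in `n` variables. -/
abbrev Mon (n d : ℕ) : Type := {m : Fin n →₀ ℕ // m.degree = d}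

instance : Fintype (Mon n d) :=
  have : Finite (Mon n d) := (Finsupp.finite_of_degree_eq d).to_subtype
  Fintype.ofFinite _

/-- The general form of degree `d` in `n` variables. -/
def generalForm (n d : ℕ) : MvPolynomial (Fin n) (MvPolynomial (Mon n d) ℤ) :=
  ∑ m : Mon n d, monomial m.1 (X m)

lemma generalForm_isHomogeneous : (generalForm n d).IsHomogeneous d :=
  IsHomogeneous.sum _ _ _ fun m _ => isHomogeneous_monomial _ m.2

lemma map_generalForm {F : MvPolynomial (Fin n) ℤ} (hF : F.IsHomogeneous d) :
    map (eval fun m : Mon n d => coeff m.1 F) (generalForm n d) = F := by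
  classical
  ext m
  rw [generalForm, map_sum, coeff_sum]
  simp only [map_monomial, eval_X, coeff_monomial]
  by_cases hm : m.degree = d
  · rw [Finset.sum_eq_single (⟨m, hm⟩ : Mon n d)]
    · simp
    · intro m' _ hne
      rw [if_neg fun h => hne (Subtype.ext h)]
    · simp
  · rw [hF.coeff_eq_zero hm]
    exact Finset.sum_eq_zero fun m' _ => if_neg fun h : m'.1 = m => hm (h ▸ m'.2)

/-- The ideal of those polynomials in the coefficients of a form whose non-vanishing implies that
the gradient of the form has no nontrivial zero. -/
def discIdeal (n d : ℕ) : Ideal (MvPolynomial (Mon n d) ℤ) where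
  carrier := {a | ∃ N : ℕ, ∀ i, C a * X i ^ N ∈
    Ideal.span (Set.range fun j => pderiv j (generalForm n d))}
  zero_mem' := ⟨0, fun i => by rw [map_zero, zero_mul]; exact Ideal.zero_mem _⟩
  add_mem' := by
    rintro a b ⟨N, hN⟩ ⟨M, hM⟩
    refine ⟨N + M, fun i => ?_⟩
    rw [map_add, add_mul, pow_add]
    refine Ideal.add_mem _ ?_ ?_
    · rw [← mul_assoc]
      exact Ideal.mul_mem_right _ _ (hN i)
    · rw [mul_comm (X i ^ N), ← mul_assoc]
      exact Ideal.mul_mem_right _ _ (hM i)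
  smul_mem' := by
    rintro c a ⟨N, hN⟩
    refine ⟨N, fun i => ?_⟩
    rw [smul_eq_mul, map_mul, mul_assoc]
    exact Ideal.mul_mem_left _ _ (hN i)

/-- Specialising the defining relations of the ideal at F and evaluating at a zero x of the gradient
gives a(F) · x_i^N = 0 in k. -/
lemma grad_ne_zero_of_mem_discIdeal {k : Type*} [Field k] {F : MvPolynomial (Fin n) ℤ}
    (hF : F.IsHomogeneous d) {a : MvPolynomial (Mon n d) ℤ} (ha : a ∈ discIdeal n d)
    (h : ((eval (fun m : Mon n d => coeff m.1 F) a : ℤ) : k) ≠ 0) :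
    ∀ x, grad (map (Int.castRingHom k) F) x = 0 → x = 0 := by
  intro x hx
  obtain ⟨N, hN⟩ := ha
  let ψ : MvPolynomial (Mon n d) ℤ →+* k :=
    (Int.castRingHom k).comp (eval fun m : Mon n d => coeff m.1 F)
  have hψ : map ψ (generalForm n d) = map (Int.castRingHom k) F := by
    rw [← map_map, map_generalForm hF]
  have hle : Ideal.span (Set.range fun j => pderiv j (generalForm n d)) ≤
      RingHom.ker ((eval x).comp (map ψ)) := by
    rw [Ideal.span_le]
    rintro _ ⟨j, rfl⟩
    rw [SetLike.mem_coe, RingHom.mem_ker, RingHom.comp_apply, ← pderiv_map, hψ]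
    exact congrFun hx j
  ext i
  have h1 := hle (hN i)
  rw [RingHom.mem_ker, RingHom.comp_apply] at h1
  simp only [map_mul, map_C, eval_C, map_pow, map_X, eval_X] at h1
  exact eq_zero_of_pow_eq_zero ((mul_eq_zero.1 h1).resolve_left h)

/-- Applies `exists_eliminant` to the partial derivatives of the general form. The eliminant has
integer coefficients, so its value at F is a nonzero integer. -/
lemma exists_mem_discIdeal {k : Type*} [Field k] [IsAlgClosed k] {F : MvPolynomial (Fin n) ℤ}
    (hF : F.IsHomogeneous d) (hg : ∀ x, grad (map (Int.castRingHom k) F) x = 0 → x = 0) :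
    ∃ a ∈ discIdeal n d, eval (fun m : Mon n d => coeff m.1 F) a ≠ 0 := by
  let ψ : MvPolynomial (Mon n d) ℤ →+* k :=
    (Int.castRingHom k).comp (eval fun m : Mon n d => coeff m.1 F)
  have hψ : map ψ (generalForm n d) = map (Int.castRingHom k) F := by
    rw [← map_map, map_generalForm hF]
  obtain ⟨a, N, ha, hN⟩ := exists_eliminant ψ (f := fun j => pderiv j (generalForm n d))
    (fun j => generalForm_isHomogeneous.pderiv) (fun x hx => hg x (by
      ext j
      have := hx j
      rwa [← pderiv_map, hψ] at this))
  exact ⟨a, ⟨N, hN⟩, fun h => ha (by rw [RingHom.comp_apply, h, map_zero])⟩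

lemma natAbs_eval_le {ι : Type*} (g : MvPolynomial ι ℤ) {c : ι → ℤ} {h : ℕ} (hh : 1 ≤ h)
    (hc : ∀ i, (c i).natAbs ≤ h) :
    (eval c g).natAbs ≤ (∑ m ∈ g.support, (coeff m g).natAbs) * h ^ g.totalDegree := by
  rw [eval_eq, Finset.sum_mul]
  refine (Int.natAbs_sum_le _ _).trans (Finset.sum_le_sum fun m hm => ?_)
  rw [Int.natAbs_mul]
  refine Nat.mul_le_mul_left _ ?_
  have h1 : (∏ i ∈ m.support, c i ^ m i).natAbs = ∏ i ∈ m.support, (c i).natAbs ^ m i := by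
    rw [← Int.natAbsHom_apply, map_prod]
    simp [Int.natAbs_pow]
  rw [h1]
  refine (Finset.prod_le_prod' fun i _ => Nat.pow_le_pow_left (hc i) (m i)).trans ?_
  rw [Finset.prod_pow_eq_pow_sum]
  exact Nat.pow_le_pow_right hh (le_totalDegree hm)

lemma natAbs_coeff_le_height (F : MvPolynomial (Fin n) ℤ) (m : Fin n →₀ ℕ) :
    (coeff m F).natAbs ≤ height F := by
  by_cases hm : m ∈ F.support
  · exact Finset.le_sup (f := fun m => (F.coeff m).natAbs) hm
  · rw [notMem_support_iff.1 hm]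
    simp

lemma one_le_height {F : MvPolynomial (Fin n) ℤ} (hF : F ≠ 0) : 1 ≤ height F := by
  obtain ⟨m, hm⟩ := ne_zero_iff.1 hF
  exact (Int.natAbs_pos.2 hm).trans_le (natAbs_coeff_le_height F m)

/-- The discriminant of a non-singular form may be taken from a finite list of polynomials. -/
theorem exists_discriminant_bound (n d : ℕ) :
    ∃ B κ : ℕ, ∀ {k : Type} [Field k] [IsAlgClosed k] (F : MvPolynomial (Fin n) ℤ),
      F.IsHomogeneous d → F ≠ 0 → (∀ x, grad (map (Int.castRingHom k) F) x = 0 → x = 0) →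
      ∃ D : ℕ, D ≠ 0 ∧ D ≤ B * height F ^ κ ∧ ∀ p : ℕ, p.Prime → ¬ p ∣ D →
        ∀ {K : Type} [Field K] [CharP K p] (x : Fin n → K),
          grad (map (Int.castRingHom K) F) x = 0 → x = 0 := by
  -- The ideal has a finite generating set depending only on n and d, and B and κ are read off from
  -- it. As some element of the ideal does not vanish at F, some generator does not either; D is the
  -- absolute value of its value at F.
  obtain ⟨s, hs⟩ := IsNoetherian.noetherian (discIdeal n d)
  refine ⟨∑ g ∈ s, ∑ m ∈ g.support, (coeff m g).natAbs, ∑ g ∈ s, g.totalDegree, ?_⟩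
  intro k _ _ F hF hF0 hg
  obtain ⟨a, ha, ha0⟩ := exists_mem_discIdeal hF hg
  obtain ⟨g, hgs, hg0⟩ : ∃ g ∈ s, eval (fun m : Mon n d => coeff m.1 F) g ≠ 0 := by
    by_contra! hcon
    rw [← hs] at ha
    have : Submodule.span (MvPolynomial (Mon n d) ℤ) (s : Set (MvPolynomial (Mon n d) ℤ)) ≤
        RingHom.ker (eval fun m : Mon n d => coeff m.1 F) :=
      Submodule.span_le.2 fun g hg => hcon g hg
    exact ha0 (this ha)
  have hgd : g ∈ discIdeal n d := by
    rw [← hs]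
    exact Submodule.subset_span hgs
  have hh := one_le_height hF0
  refine ⟨(eval (fun m : Mon n d => coeff m.1 F) g).natAbs, Int.natAbs_ne_zero.2 hg0, ?_, ?_⟩
  · refine (natAbs_eval_le g hh fun m => natAbs_coeff_le_height F m.1).trans ?_
    refine Nat.mul_le_mul ?_ (Nat.pow_le_pow_right hh ?_)
    · exact Finset.single_le_sum (f := fun g => ∑ m ∈ g.support, (coeff m g).natAbs)
        (fun _ _ => Nat.zero_le _) hgs
    · exact Finset.single_le_sum (f := fun g : MvPolynomial (Mon n d) ℤ => g.totalDegree)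
        (fun _ _ => Nat.zero_le _) hgs
  · intro p _ hpD K _ _
    refine grad_ne_zero_of_mem_discIdeal hF hgd ?_
    rw [Ne, CharP.intCast_eq_zero_iff K p]
    rwa [← Int.natCast_dvd] at hpD

lemma grad_ne_zero_of_isNonsingularHypersurface {k : Type*} [Field k] [CharZero k]
    {F : MvPolynomial (Fin n) k} (hd : 0 < d) (hF : F.IsHomogeneous d)
    (h : IsNonsingularHypersurface F) (x : Fin n → k) (hx : grad F x = 0) : x = 0 := by
  by_contra hx0
  obtain ⟨a, -, ha⟩ := mk_rep_eq_smul hx0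
  have h1 : grad F (Projectivization.mk k x hx0).rep = 0 := by
    rw [← ha, grad_smul hF, hx, smul_zero]
  have h2 := dotProduct_grad hF (Projectivization.mk k x hx0).rep
  rw [h1, dotProduct_zero] at h2
  have h3 := mem_sing_singleton hF h.1 ((mul_eq_zero.1 h2.symm).resolve_left
    (Nat.cast_ne_zero.2 hd.ne')) h1
  rw [h.2] at h3
  exact h3

end Discriminant

end Forms

/-! ### The product of the bad primes -/

theorem corollary2p1 (n d : ℕ) (hn : 3 ≤ n) (hd : 3 ≤ d) :
    ∃ (C : ℝ) (κ : ℕ), ∀ F : MvPolynomial (Fin n) ℤ, F.IsHomogeneous d → Forms.R0Zero F →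
      ∃ hfin : (Forms.badPrimes F).Finite,
        ∏ p ∈ hfin.toFinset, (p : ℝ) ≤ C * (Forms.height F : ℝ) ^ κ := by
  obtain ⟨N, hN⟩ := Forms.exists_good_of_large_prime hn hd
  obtain ⟨B, κ, hB⟩ := Forms.exists_discriminant_bound n d
  refine ⟨(N.factorial * B : ℕ), κ, fun F hF hR => ?_⟩
  have hF0 : F ≠ 0 := by
    rintro rfl
    exact hR.1 (by simp [Forms.baseChange])
  obtain ⟨D, hD0, hDle, hD⟩ := hB (k := AlgebraicClosure ℚ) F hF hF0
    (Forms.grad_ne_zero_of_isNonsingularHypersurface (by omega) (hF.map _) hR)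
  have hprime : ∀ p ∈ Forms.badPrimes F, p.Prime := fun p ⟨h, _⟩ => h.out
  have hbad : ∀ p ∈ Forms.badPrimes F, N < p → p ∣ D := by
    rintro p ⟨hp, hcon⟩ hlt
    by_contra hpD
    have : CharP (AlgebraicClosure (ZMod p)) p :=
      charP_of_injective_algebraMap (algebraMap (ZMod p) (AlgebraicClosure (ZMod p))).injective p
    obtain ⟨h0, h1, h2⟩ := hN p hlt (Forms.baseChange (ZMod p) F) (hF.map _)
      (hD p hp.out hpD)
    exact hcon ⟨h0, h1, fun y s hs hs' => h2 _ s hs hs'⟩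
  have hfin : (Forms.badPrimes F).Finite := by
    refine ((Finset.range (N + 1) ∪ D.divisors).finite_toSet).subset fun p hp => ?_
    rw [Finset.mem_coe, Finset.mem_union, Finset.mem_range, Nat.mem_divisors]
    rcases Nat.lt_or_ge N p with h | h
    · exact Or.inr ⟨hbad p hp h, hD0⟩
    · exact Or.inl (by omega)
  refine ⟨hfin, ?_⟩
  -- Bad primes up to N are distinct factors of N!; those above N are distinct primes dividing D.
  have h1 : ∏ p ∈ hfin.toFinset with p ≤ N, p ≤ N.factorial := by
    refine Nat.le_of_dvd N.factorial_pos ?_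
    rw [← Finset.prod_Ico_id_eq_factorial]
    refine Finset.prod_dvd_prod_of_subset _ _ _ fun p hp => ?_
    rw [Finset.mem_filter, Set.Finite.mem_toFinset] at hp
    exact Finset.mem_Ico.2 ⟨(hprime p hp.1).one_le, Nat.lt_succ_of_le hp.2⟩
  have h2 : ∏ p ∈ hfin.toFinset with ¬ p ≤ N, p ≤ D := by
    refine Nat.le_of_dvd (Nat.pos_of_ne_zero hD0) (Finset.prod_primes_dvd _ ?_ ?_)
    · intro p hp
      rw [Finset.mem_filter, Set.Finite.mem_toFinset] at hp
      exact (hprime p hp.1).prime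
    · intro p hp
      rw [Finset.mem_filter, Set.Finite.mem_toFinset] at hp
      exact hbad p hp.1 (not_le.1 hp.2)
  have h3 : ∏ p ∈ hfin.toFinset, p ≤ N.factorial * B * Forms.height F ^ κ := by
    rw [← Finset.prod_filter_mul_prod_filter_not _ (fun p => p ≤ N), mul_assoc]
    exact Nat.mul_le_mul h1 (h2.trans hDle)
  have h4 : ((∏ p ∈ hfin.toFinset, p : ℕ) : ℝ) ≤
      ((N.factorial * B * Forms.height F ^ κ : ℕ) : ℝ) := Nat.cast_le.2 h3
  rw [Nat.cast_prod, Nat.cast_mul, Nat.cast_pow] at h4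
  exact h4

end
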